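/- **Model.** In the (randomized) CONGEST model a network is a simple graph whose nodes have distinct identifiers; all nodes compute in synchronous rounds, and in each round every node may send one message to each neighbour. A node initially knows its own identifier and those of its neighbours, draws fresh private uniform randomness from a finite set in every round, and local computation is free. Fix integers $\kappa,\beta\ge 1$. For integers $n,D,\Delta$ let $\mathcal G(n,D,\Delta)$ be the class of networks whose graph has at least three and at most $n$ vertices, is $2$-vertex connected (it stays connected after the removal of any one vertex), and has diameter at most $D$ and maximum degree at most $\Delta$, with arbitrary distinct identifiers of $\kappa\log_2 n$ bits (numbers below $n^\kappa$). Algorithms for $\mathcal G(n,D,\Delta)$ may depend on $n,D,\Delta$ and use messages of $\beta\log_2 n$ bits (alphabet of size $n^\beta$, or no message). **Structures.** A $(d,c)$-cycle cover of $G$ is a family of cycles of $G$, each of length at most $d$, such that every edge lies on at least one and at most $c$ cycles of the family. It is output distributedly: the cycles are labelled, and each node knows, for each incident edge, the labels of the cycles through that edge. $(d,c)$-private neighbourhood trees of $G=(V,E)$ are subtrees $T(u)\subseteq G$, $u\in V$, such that $T(u)$ contains all neighbours of $u$ but not $u$ itself, $T(u)$ has diameter at most $d$, and every edge of $G$ appears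 in at most $c$ of the trees. They are output distributedly: each tree is rooted, and each node knows, for every $v\in V$, its parent in $T(v)$ (if it has one). **Lemma.** There are constants $K,k$, depending only on $\kappa$ and $\beta$, such that for all $n,D,\Delta,d,c,r$ and every real $\delta$ the following holds. Suppose that there is an $r$-round distributed algorithm that, on every network of $\mathcal G(n^2,3D+2,\Delta)$, constructs a $(d,c)$-cycle cover with failure probability at most $\delta$. Then there is a distributed algorithm that, on every network of $\mathcal G(n,D,\Delta)$, constructs $$\bigl(d\,\Delta,\; c\,d\,\lfloor\log_2\Delta\rfloor\bigr)\text{-private neighbourhood trees}$$ with failure probability at most $\lfloor\log_2\Delta\rfloor\,\delta$, in at most $$K\,(\lfloor\log_2 n\rfloor+1)^{k}\,(r+d\,c)$$ rounds, that is, in $\widetilde O(r+d\,c)$ rounds; in particular, in $r\cdot\widetilde O(d\,c)$ rounds if $r\ge 1$. -/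

import Mathlib

namespace PrivateTrees

/-! ### Graph-theoretic notions -/

/-- `G` is 2-vertex connected: it has at least three vertices and stays connected after the removal
of any single vertex. -/
def TwoVertexConnected {V : Type} [Fintype V] (G : SimpleGraph V) : Prop :=
  3 ≤ Fintype.card V ∧ ∀ u : V, (G.induce ({u}ᶜ : Set V)).Connected

/-- The family `C i`, `i ∈ I`, of edge sets is a `(d, c)`-cycle cover of `G`: every member is the
edge set of a (simple) cycle of `G` of length at most `d`, and every edge of `G` lies on at least
one and at most `c` members of the family. -/
def IsCycleCover {V : Type} (G : SimpleGraph V) (d c : ℕ) {ι : Type} (I : Finset ι)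
    (C : ι → Set (Sym2 V)) : Prop :=
  (∀ i ∈ I, ∃ (v : V) (p : G.Walk v v), p.IsCycle ∧ p.length ≤ d ∧ C i = {e | e ∈ p.edges}) ∧
  ∀ e ∈ G.edgeSet, 1 ≤ {i | i ∈ I ∧ e ∈ C i}.ncard ∧ {i | i ∈ I ∧ e ∈ C i}.ncard ≤ c

/-- The subgraphs `T u` are `(d, c)`-private neighbourhood trees of `G`: `T u` is a tree of diameter
at most `d` that contains all neighbours of `u` but not `u`, and every edge of `G` appears in at
most `c` of the trees. -/
def IsPrivateNeighborhoodTrees {V : Type} (G : SimpleGraph V) (d c : ℕ)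
    (T : V → G.Subgraph) : Prop :=
  (∀ u, (T u).coe.IsTree ∧ G.neighborSet u ⊆ (T u).verts ∧ u ∉ (T u).verts ∧
    (T u).coe.diam ≤ d) ∧
  ∀ e ∈ G.edgeSet, {u | e ∈ (T u).edgeSet}.ncard ≤ c

/-- In the tree `T` rooted at `ρ`, the vertex `p` is the parent of `w`. -/
def IsParent {V : Type} {G : SimpleGraph V} (T : G.Subgraph) (ρ w p : V) : Prop :=
  T.Adj w p ∧ T.spanningCoe.dist ρ w = T.spanningCoe.dist ρ p + 1

/-! ### The synchronous message passing model with bounded messages -/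

/-- An `r`-round randomized distributed algorithm whose messages are taken from an alphabet of `M`
letters (`none` stands for "no message"). Initially a node knows its own identifier and those of its
neighbours. In round `i` it gets its state, the messages received from its neighbours (indexed by
the identifier of the sender) and fresh private randomness, uniform in the finite set `Seed`, and
it computes its new state and its outgoing messages (indexed by the identifier of the receiver).
Local computation is free. -/
structure Algorithm (r M : ℕ) (Out : Type) where
  State : Type
  Seed : Type
  seedFinite : Finite Seed
  seedNonempty : Nonempty Seed
  init : ℕ → Finset ℕ → State
  step : Fin r → State → (ℕ → Option (Fin M)) → Seed → State × (ℕ → Option (Fin M))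
  output : State → Out

/-- The messages that `v` receives, indexed by the identifier of the sender, when every node `u`
has prepared the messages `out u`. -/
noncomputable def inbox {V : Type} {M : ℕ} (G : SimpleGraph V) (ident : V → ℕ)
    (out : V → ℕ → Option (Fin M)) (v : V) : ℕ → Option (Fin M) :=
  open Classical in
  fun x => if h : ∃ u, G.Adj v u ∧ ident u = x then out h.choose (ident v) else none

/-- The identifiers of the neighbours of `v`. -/
noncomputable def neighborIdents {V : Type} [Fintype V] (G : SimpleGraph V) (ident : V → ℕ)
    (v : V) : Finset ℕ :=
  open Classical in
  (Finset.univ.filter (fun u => G.Adj v u)).image ident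

namespace Algorithm

variable {r M : ℕ} {Out : Type}

/-- State and outgoing messages of every node after `t` rounds; `ω v i` is the randomness of `v` in
round `i`. -/
noncomputable def config (A : Algorithm r M Out) {V : Type} [Fintype V] (G : SimpleGraph V)
    (ident : V → ℕ) (ω : V → Fin r → A.Seed) : ℕ → V → A.State × (ℕ → Option (Fin M))
  | 0 => fun v => (A.init (ident v) (neighborIdents G ident v), fun _ => none)
  | t + 1 => fun v =>
      if h : t < r then
        A.step ⟨t, h⟩ (A.config G ident ω t v).1
          (inbox G ident (fun u => (A.config G ident ω t u).2) v) (ω v ⟨t, h⟩)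
      else A.config G ident ω t v

/-- The outputs of all nodes after `r` rounds. -/
noncomputable def result (A : Algorithm r M Out) {V : Type} [Fintype V] (G : SimpleGraph V)
    (ident : V → ℕ) (ω : V → Fin r → A.Seed) (v : V) : Out :=
  A.output (A.config G ident ω r v).1

/-- The probability, over the independent uniform private randomness of all nodes in all rounds,
that the outputs violate `P`. -/
noncomputable def failureProb (A : Algorithm r M Out) {V : Type} [Fintype V] (G : SimpleGraph V)
    (ident : V → ℕ) (P : (V → Out) → Prop) : ℝ :=
  (Nat.card {ω : V → Fin r → A.Seed // ¬ P (A.result G ident ω)} : ℝ) /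
    (Nat.card (V → Fin r → A.Seed) : ℝ)

end Algorithm

/-- Input networks with parameters `n`, `D`, `Δ`: a 2-vertex connected graph with at most `n`
vertices, diameter at most `D` and maximum degree at most `Δ`, with arbitrary distinct identifiers
of `κ log n` bits. -/
def IsNetwork (n D Δ κ : ℕ) {V : Type} [Fintype V] (G : SimpleGraph V) (ident : V → ℕ) : Prop :=
  TwoVertexConnected G ∧ Fintype.card V ≤ n ∧ G.diam ≤ D ∧
    (∀ v, (G.neighborSet v).ncard ≤ Δ) ∧ Function.Injective ident ∧ ∀ v, ident v < n ^ κ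

/-- Distributed output of a cycle cover: the cycles carry labels (natural numbers), and each node
knows, for each of its incident edges (given by the identifier of the other endpoint), the set of
the labels of the cycles through this edge. -/
def IsCycleCoverOutput {V : Type} (G : SimpleGraph V) (ident : V → ℕ) (d c : ℕ)
    (out : V → ℕ → Finset ℕ) : Prop :=
  ∃ (I : Finset ℕ) (C : ℕ → Set (Sym2 V)), IsCycleCover G d c I C ∧
    ∀ u v, G.Adj u v → ∀ l, l ∈ out u (ident v) ↔ l ∈ I ∧ s(u, v) ∈ C l

/-- Distributed output of private neighbourhood trees: every tree is rooted, and each node `w`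
knows, for every node `v` (given by its identifier), the identifier of its parent in `T v`; the
value is `none` if there is no parent, that is, if `w` is the root of `T v` or is not in `T v`. -/
def IsPrivateTreesOutput {V : Type} (G : SimpleGraph V) (ident : V → ℕ) (d c : ℕ)
    (out : V → ℕ → Option ℕ) : Prop :=
  ∃ T : V → G.Subgraph, IsPrivateNeighborhoodTrees G d c T ∧
    (∀ v, ∃ ρ ∈ (T v).verts, ∀ w,
      (∃ p, IsParent (T v) ρ w p ∧ out w (ident v) = some (ident p)) ∨
      ((w = ρ ∨ w ∉ (T v).verts) ∧ out w (ident v) = none)) ∧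
    ∀ w x, (∀ v, ident v ≠ x) → out w x = none

/-- `A` constructs `(d, c)`-cycle covers, with failure probability at most `δ`, on all networks
with parameters `n`, `D`, `Δ`. -/
def ConstructsCycleCovers {r M : ℕ} (A : Algorithm r M (ℕ → Finset ℕ)) (n D Δ κ d c : ℕ)
    (δ : ℝ) : Prop :=
  ∀ (V : Type) [Fintype V] (G : SimpleGraph V) (ident : V → ℕ), IsNetwork n D Δ κ G ident →
    A.failureProb G ident (IsCycleCoverOutput G ident d c) ≤ δ

/-- `B` constructs `(d, c)`-private neighbourhood trees, with failure probability at most `δ`, on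
all networks with parameters `n`, `D`, `Δ`. -/
def ConstructsPrivateTrees {r M : ℕ} (B : Algorithm r M (ℕ → Option ℕ)) (n D Δ κ d c : ℕ)
    (δ : ℝ) : Prop :=
  ∀ (V : Type) [Fintype V] (G : SimpleGraph V) (ident : V → ℕ), IsNetwork n D Δ κ G ident →
    B.failureProb G ident (IsPrivateTreesOutput G ident d c) ≤ δ

end PrivateTrees

/-!
Two neighbours of `u` belong to the same class if the cycles found so far join them outside `u`.
Split every vertex `u` into a star: a centre and one vertex for each class (for each neighbour, once
there is only one class), where an edge of `G` is attached to the vertex of the class of its other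
endpoint. This is a 2-vertex connected network with at most `n ^ 2` vertices and of diameter at most
`3 D + 2`, and each node of `G` can simulate its cluster. In a cycle cover of the split graph, the
cycle through the edge from a class vertex to the centre of `u` passes on to another class vertex,
hence it links the class to a different one. So the classes at least double in size in every phase,
and after `⌊log₂ Δ⌋` phases one class is left.

In each phase every node `u` sends tokens around the cycles through its cluster to learn which
neighbours are linked by segments outside `u`. From the links of all phases it computes an
exploration of its neighbourhood in which every segment starts at a vertex reached before, and
sends tokens along these segments. The parent of `w` in `T u` is the node from which `w` receives
its first token of `u`, in the order of the exploration. An edge lies on at most `c` cycles in each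
phase, and a cycle meets at most `d` clusters; this bounds the congestion by `c d ⌊log₂ Δ⌋`. The
phases use independent randomness, so a phase succeeds with probability `1 - δ` or more, whatever
happened before, and the union bound applies.
-/

namespace PrivateTrees

/-! ### Parametrized cycles -/

section Cycle

variable {V : Type*} {G : SimpleGraph V} {C : Set (Sym2 V)} {m : ℕ} {p : ℤ → V}

/-- `p` runs periodically through a cycle of length `m` of `G` with edge set `C`. Indexing by `ℤ`
makes rotations and reversals of the cycle into shifts and negations of the index. -/
structure IsCycleParam (G : SimpleGraph V) (C : Set (Sym2 V)) (m : ℕ) (p : ℤ → V) : Prop where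
  three_le : 3 ≤ m
  eq_iff : ∀ i j, p i = p j ↔ (m : ℤ) ∣ i - j
  adj : ∀ i, G.Adj (p i) (p (i + 1))
  mem_iff : ∀ e, e ∈ C ↔ ∃ i, e = s(p i, p (i + 1))

/-- The vertices of a closed walk, indexed periodically by `ℤ`. -/
def periodicVert {v : V} (w : G.Walk v v) (i : ℤ) : V := w.getVert (i % w.length).toNat

theorem periodicVert_natCast {v : V} (w : G.Walk v v) {i : ℕ} (hi : i < w.length) :
    periodicVert w i = w.getVert i := by
  rw [periodicVert, Int.emod_eq_of_lt (by omega) (by omega), Int.toNat_natCast]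

theorem periodicVert_add_one {v : V} (w : G.Walk v v) (hw : 2 ≤ w.length) (i : ℤ) :
    periodicVert w (i + 1) = w.getVert ((i % w.length).toNat + 1) := by
  have h₀ := Int.emod_nonneg i (b := w.length) (by omega)
  have h₁ := Int.emod_lt_of_pos i (b := w.length) (by omega)
  have hsucc : (i + 1) % w.length = (i % w.length + 1) % w.length := by
    rw [Int.add_emod, Int.emod_eq_of_lt (a := 1) (by omega) (by omega)]
  rcases (Int.add_one_le_iff.2 h₁).lt_or_eq with hlt | heq
  · rw [periodicVert, hsucc, Int.emod_eq_of_lt (by omega) hlt, Int.toNat_add h₀ zero_le_one,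
      Int.toNat_one]
  · rw [periodicVert, hsucc, heq, Int.emod_self, show (i % w.length).toNat + 1 = w.length by omega]
    simp

theorem isCycleParam_periodicVert {v : V} {w : G.Walk v v} (hw : w.IsCycle) :
    IsCycleParam G {e | e ∈ w.edges} w.length (periodicVert w) := by
  have h3 := hw.three_le_length
  have hlt (i : ℤ) : (i % w.length).toNat < w.length := by
    have := Int.emod_lt_of_pos i (b := w.length) (by omega)
    omega
  refine ⟨h3, fun i j => ?_, fun i => ?_, fun e => ?_⟩
  · rw [← Int.emod_eq_emod_iff_emod_sub_eq_zero.trans Int.dvd_iff_emod_eq_zero.symm]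
    refine ⟨fun h => ?_, fun h => by rw [periodicVert, h, periodicVert]⟩
    have hinj := hw.getVert_injOn' (Nat.le_pred_of_lt (hlt i)) (Nat.le_pred_of_lt (hlt j)) h
    have hi := Int.emod_nonneg i (b := w.length) (by omega)
    have hj := Int.emod_nonneg j (b := w.length) (by omega)
    omega
  · rw [periodicVert_add_one w (by omega)]
    exact w.adj_getVert_succ (hlt i)
  · induction e with | h a b =>
    rw [Set.mem_ofPred_eq, SimpleGraph.Walk.mk_mem_edges_iff_exists]
    constructor
    · rintro ⟨i, hi, h⟩
      refine ⟨i, ?_⟩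
      rw [periodicVert_add_one w (by omega), periodicVert_natCast w hi,
        Int.emod_eq_of_lt (by omega) (by omega), Int.toNat_natCast]
      exact h.symm
    · rintro ⟨i, h⟩
      exact ⟨_, hlt i, by rw [h, periodicVert_add_one w (by omega), periodicVert]⟩

namespace IsCycleParam

theorem shift (h : IsCycleParam G C m p) (k : ℤ) : IsCycleParam G C m (fun i => p (i + k)) where
  three_le := h.three_le
  eq_iff i j := by rw [h.eq_iff]; ring_nf
  adj i := by rw [show i + 1 + k = i + k + 1 by ring]; exact h.adj _
  mem_iff e := by
    rw [h.mem_iff]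
    constructor
    · rintro ⟨i, rfl⟩
      exact ⟨i - k, by ring_nf⟩
    · rintro ⟨i, rfl⟩
      exact ⟨i + k, by ring_nf⟩

theorem reverse (h : IsCycleParam G C m p) : IsCycleParam G C m (fun i => p (-i)) where
  three_le := h.three_le
  eq_iff i j := by rw [h.eq_iff, show -i - -j = -(i - j) by ring, dvd_neg]
  adj i := by
    have hadj := h.adj (-(i + 1))
    rw [show -(i + 1) + 1 = -i by ring] at hadj
    exact hadj.symm
  mem_iff e := by
    rw [h.mem_iff]
    constructor <;>
    · rintro ⟨i, rfl⟩
      exact ⟨-(i + 1), by rw [Sym2.eq_swap]; ring_nf⟩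

theorem exists_of_mem (h : IsCycleParam G C m p) {u v : V} (he : s(u, v) ∈ C) :
    ∃ q, IsCycleParam G C m q ∧ q 0 = u ∧ q 1 = v := by
  obtain ⟨i, hi⟩ := (h.mem_iff _).1 he
  rcases Sym2.eq_iff.1 hi with ⟨rfl, rfl⟩ | ⟨rfl, rfl⟩
  · exact ⟨_, h.shift i, by ring_nf, by ring_nf⟩
  · exact ⟨_, (h.shift (i + 1)).reverse, by ring_nf, by ring_nf⟩

theorem add_one_ne_sub_one (h : IsCycleParam G C m p) (i : ℤ) : p (i + 1) ≠ p (i - 1) := by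
  rw [Ne, h.eq_iff]
  intro hd
  have := Int.le_of_dvd (by omega) hd
  have := h.three_le
  omega

theorem mem (h : IsCycleParam G C m p) (i : ℤ) : s(p i, p (i + 1)) ∈ C :=
  (h.mem_iff _).2 ⟨i, rfl⟩

theorem mk_mem_iff (h : IsCycleParam G C m p) (i : ℤ) (v : V) :
    s(p i, v) ∈ C ↔ v = p (i + 1) ∨ v = p (i - 1) := by
  constructor
  · intro he
    obtain ⟨j, hj⟩ := (h.mem_iff _).1 he
    rcases Sym2.eq_iff.1 hj with ⟨hij, rfl⟩ | ⟨hij, rfl⟩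
    · left
      rwa [eq_comm, h.eq_iff, ← add_sub_add_right_eq_sub j i 1, ← h.eq_iff] at hij
    · right
      rwa [eq_comm, h.eq_iff, ← sub_sub_eq_add_sub, ← h.eq_iff] at hij
  · rintro (rfl | rfl)
    · exact h.mem i
    · exact (h.mem_iff _).2 ⟨i - 1, by rw [Sym2.eq_swap]; ring_nf⟩

theorem natCast_eq_natCast {m' : ℕ} {q : ℤ → V} (h : IsCycleParam G C m p)
    (h' : IsCycleParam G C m' q) (h₀ : p 0 = q 0) (h₁ : p 1 = q 1) (i : ℕ) : p i = q i := by
  suffices p i = q i ∧ p (i + 1) = q (i + 1) from this.1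
  induction i with
  | zero => simpa using ⟨h₀, h₁⟩
  | succ i ih =>
    obtain ⟨e₀, e₁⟩ := ih
    push_cast
    refine ⟨e₁, ?_⟩
    have hmem := h.mem (i + 1)
    rw [e₁, h'.mk_mem_iff, add_sub_cancel_right, ← e₀] at hmem
    refine hmem.resolve_right fun hback => h.add_one_ne_sub_one (i + 1) ?_
    rwa [add_sub_cancel_right]

theorem apply_period (h : IsCycleParam G C m p) : p m = p 0 := by
  rw [h.eq_iff]; simp

theorem range_subset_image (h : IsCycleParam G C m p) :
    Set.range p ⊆ (fun i : ℕ => p i) '' Set.Iio m := by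
  rintro _ ⟨i, rfl⟩
  have hpos : (0 : ℤ) < m := by have := h.three_le; omega
  have h₀ := Int.emod_nonneg i hpos.ne'
  have h₁ := Int.emod_lt_of_pos i hpos
  refine ⟨(i % m).toNat, by rw [Set.mem_Iio]; omega, ?_⟩
  dsimp only
  rw [Int.toNat_of_nonneg h₀, h.eq_iff]
  exact (Int.mod_modEq i m).symm.dvd

theorem finite_range (h : IsCycleParam G C m p) : (Set.range p).Finite :=
  ((Set.finite_Iio m).image _).subset h.range_subset_image

theorem ncard_range_le (h : IsCycleParam G C m p) : (Set.range p).ncard ≤ m :=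
  calc (Set.range p).ncard ≤ ((fun i : ℕ => p i) '' Set.Iio m).ncard :=
        Set.ncard_le_ncard h.range_subset_image ((Set.finite_Iio m).image _)
    _ ≤ (Set.Iio m).ncard := Set.ncard_image_le (Set.finite_Iio m)
    _ = m := by simp

end IsCycleParam

theorem IsCycleCover.exists_isCycleParam {V : Type} {G : SimpleGraph V} {d c : ℕ} {ι : Type}
    {I : Finset ι} {C : ι → Set (Sym2 V)} (h : IsCycleCover G d c I C) {i : ι} (hi : i ∈ I) :
    ∃ m ≤ d, ∃ p, IsCycleParam G (C i) m p := by
  obtain ⟨v, w, hw, hd, he⟩ := h.1 i hi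
  exact ⟨_, hd, _, he ▸ isCycleParam_periodicVert hw⟩

theorem IsCycleCover.exists_mem_of_mem_edgeSet {V : Type} {G : SimpleGraph V} {d c : ℕ} {ι : Type}
    {I : Finset ι} {C : ι → Set (Sym2 V)} (h : IsCycleCover G d c I C) {e : Sym2 V}
    (he : e ∈ G.edgeSet) : ∃ i ∈ I, e ∈ C i :=
  Set.nonempty_of_ncard_ne_zero (Nat.one_le_iff_ne_zero.1 (h.2 e he).1)

end Cycle

/-! ### Rooted trees -/

section RootedTree

theorem exists_adj_dist_add_one_eq {V : Type*} {G : SimpleGraph V} {u w : V}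
    (h : G.Reachable u w) (hne : w ≠ u) : ∃ x, G.Adj w x ∧ G.dist u x + 1 = G.dist u w := by
  obtain ⟨p, hp⟩ := h.symm.exists_walk_length_eq_dist
  cases p with
  | nil => exact absurd rfl hne
  | @cons _ x _ hwx p =>
    refine ⟨x, hwx, ?_⟩
    have hle := SimpleGraph.dist_le p
    have hdiff := hwx.diff_dist_adj (u := u)
    rw [SimpleGraph.Walk.length_cons, SimpleGraph.dist_comm] at hp
    rw [SimpleGraph.dist_comm] at hle
    omega

/-- Parent pointers on `S` with root `ρ`: every vertex of `S` other than `ρ` points to a neighbour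
in `S` with a smaller key. -/
structure IsParentMap {V : Type*} (G : SimpleGraph V) (S : Set V) (ρ : V) (par : V → V)
    (key : V → ℕ) : Prop where
  root_mem : ρ ∈ S
  par_mem : ∀ w ∈ S, w ≠ ρ → par w ∈ S
  adj : ∀ w ∈ S, w ≠ ρ → G.Adj w (par w)
  key_lt : ∀ w ∈ S, w ≠ ρ → key (par w) < key w

namespace IsParentMap

variable {V : Type*} {G : SimpleGraph V} {S : Set V} {ρ : V} {par : V → V} {key : V → ℕ}

/-- The tree given by parent pointers. -/
def tree (h : IsParentMap G S ρ par key) : G.Subgraph where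
  verts := S
  Adj w x := (w ∈ S ∧ w ≠ ρ ∧ x = par w) ∨ (x ∈ S ∧ x ≠ ρ ∧ w = par x)
  adj_sub := by
    rintro w x (⟨hw, hne, rfl⟩ | ⟨hx, hne, rfl⟩)
    · exact h.adj _ hw hne
    · exact (h.adj _ hx hne).symm
  edge_vert := by
    rintro w x (⟨hw, -, rfl⟩ | ⟨hx, hne, rfl⟩)
    · exact hw
    · exact h.par_mem _ hx hne
  symm := ⟨fun _ _ hw => hw.symm⟩

theorem tree_adj_par (h : IsParentMap G S ρ par key) {w : V} (hw : w ∈ S) (hne : w ≠ ρ) :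
    h.tree.Adj w (par w) := Or.inl ⟨hw, hne, rfl⟩

theorem reachable_root (h : IsParentMap G S ρ par key) (w : h.tree.verts) :
    h.tree.coe.Reachable w ⟨ρ, h.root_mem⟩ := by
  induction hk : key w using Nat.strong_induction_on generalizing w with
  | _ k ih =>
    by_cases hne : (w : V) = ρ
    · rw [show w = ⟨ρ, h.root_mem⟩ from Subtype.ext hne]
    · have hadj : h.tree.coe.Adj w ⟨par w, h.par_mem w w.2 hne⟩ := h.tree_adj_par w.2 hne
      exact hadj.reachable.trans (ih _ (hk ▸ h.key_lt w w.2 hne) _ rfl)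

theorem connected (h : IsParentMap G S ρ par key) : h.tree.coe.Connected :=
  SimpleGraph.connected_iff_exists_forall_reachable _ |>.2
    ⟨⟨ρ, h.root_mem⟩, fun w => (h.reachable_root w).symm⟩

theorem coe_edgeSet_subset (h : IsParentMap G S ρ par key) :
    h.tree.coe.edgeSet ⊆
      Set.range fun w : {w : h.tree.verts // w ≠ ⟨ρ, h.root_mem⟩} =>
        s(w.1, ⟨par w.1, h.par_mem w.1 w.1.2 fun e => w.2 (Subtype.ext e)⟩) := by
  rintro ⟨x, y⟩ (⟨-, hne, hy⟩ | ⟨-, hne, hx⟩)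
  · exact ⟨⟨x, fun e => hne (congrArg Subtype.val e)⟩, by simp only [← hy]⟩
  · exact ⟨⟨y, fun e => hne (congrArg Subtype.val e)⟩, by simp only [← hx]; exact Sym2.eq_swap⟩

theorem isTree [Finite V] (h : IsParentMap G S ρ par key) : h.tree.coe.IsTree := by
  classical
  have hcard : Nat.card {w : h.tree.verts // w ≠ ⟨ρ, h.root_mem⟩} + 1 = Nat.card h.tree.verts := by
    rw [← Finite.card_option]
    exact Nat.card_congr (Equiv.optionSubtypeNe _)
  have hedges : Nat.card h.tree.coe.edgeSet ≤
      Nat.card {w : h.tree.verts // w ≠ ⟨ρ, h.root_mem⟩} :=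
    (Nat.card_mono (Set.finite_range _) h.coe_edgeSet_subset).trans (Finite.card_range_le _)
  rw [SimpleGraph.isTree_iff_connected_and_card]
  exact ⟨h.connected, le_antisymm (by omega) h.connected.card_vert_le_card_edgeSet_add_one⟩

theorem diam_lt [Finite V] (h : IsParentMap G S ρ par key) : h.tree.coe.diam < S.ncard := by
  have : Nonempty h.tree.verts := ⟨⟨ρ, h.root_mem⟩⟩
  have hfin : Fintype h.tree.verts := Fintype.ofFinite _
  obtain ⟨u, v, huv⟩ := h.tree.coe.exists_dist_eq_diam
  obtain ⟨p, hp, hl⟩ := h.connected.exists_path_of_dist u v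
  calc h.tree.coe.diam = p.length := by rw [← huv, hl]
    _ < Fintype.card h.tree.verts := hp.length_lt
    _ = S.ncard := by rw [← Nat.card_eq_fintype_card]; exact Nat.card_coe_set_eq S

theorem reachable_root_spanningCoe (h : IsParentMap G S ρ par key) {w : V} (hw : w ∈ S) :
    h.tree.spanningCoe.Reachable ρ w :=
  ((h.reachable_root ⟨w, hw⟩).map
    (⟨Subtype.val, fun h => h⟩ : h.tree.coe →g h.tree.spanningCoe)).symm

theorem dist_par_lt (h : IsParentMap G S ρ par key) {w : V} (hw : w ∈ S) (hne : w ≠ ρ) :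
    h.tree.spanningCoe.dist ρ (par w) < h.tree.spanningCoe.dist ρ w := by
  induction hk : h.tree.spanningCoe.dist ρ w using Nat.strong_induction_on generalizing w with
  | _ k ih =>
    obtain ⟨x, hwx, hx⟩ := exists_adj_dist_add_one_eq (h.reachable_root_spanningCoe hw) hne
    rcases hwx with ⟨-, -, rfl⟩ | ⟨hxS, hxne, rfl⟩
    · omega
    -- If `w` were the parent of its neighbour `x` closer to the root, `x` would be a smaller
    -- counterexample.
    · have := ih _ (by omega) hxS hxne rfl
      omega

theorem isParent {V : Type} {G : SimpleGraph V} {S : Set V} {ρ : V} {par : V → V} {key : V → ℕ}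
    (h : IsParentMap G S ρ par key) {w : V} (hw : w ∈ S) (hne : w ≠ ρ) :
    IsParent h.tree ρ w (par w) := by
  refine ⟨h.tree_adj_par hw hne, ?_⟩
  have hadj : h.tree.spanningCoe.Adj w (par w) := h.tree_adj_par hw hne
  have hdiff := hadj.diff_dist_adj (u := ρ)
  have hlt := h.dist_par_lt hw hne
  omega

end IsParentMap

end RootedTree

/-! ### Counting, classes and explorations -/

section Counting

theorem card_comp_injective_div_card {X Y S : Type*} [Finite X] [Finite S] [Nonempty S]
    {j : Y → X} (hj : Function.Injective j) (Q : (Y → S) → Prop) :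
    (Nat.card {f : X → S // Q (f ∘ j)} : ℝ) / Nat.card (X → S) =
      (Nat.card {g : Y → S // Q g} : ℝ) / Nat.card (Y → S) := by
  classical
  let e : (X → S) ≃ (Y → S) × ({x // ¬ x ∈ Set.range j} → S) :=
    (Equiv.piEquivPiSubtypeProd (· ∈ Set.range j) (fun _ => S)).trans
      (Equiv.prodCongr ((Equiv.ofInjective j hj).symm.arrowCongr (Equiv.refl S)) (Equiv.refl _))
  have hsub : Nat.card {f : X → S // Q (f ∘ j)} =
      Nat.card {g : Y → S // Q g} * Nat.card ({x // ¬ x ∈ Set.range j} → S) := by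
    rw [← Nat.card_prod]
    exact Nat.card_congr ((Equiv.subtypeEquiv e (q := fun z => Q z.1) fun _ => Iff.rfl).trans
      Equiv.prodSubtypeFstEquivSubtypeProd)
  have hall : Nat.card (X → S) =
      Nat.card (Y → S) * Nat.card ({x // ¬ x ∈ Set.range j} → S) := by
    rw [← Nat.card_prod]
    exact Nat.card_congr e
  have hpos : (Nat.card ({x // ¬ x ∈ Set.range j} → S) : ℝ) ≠ 0 := by
    exact_mod_cast Nat.card_pos.ne'
  rw [hsub, hall]
  push_cast
  rw [mul_div_mul_right _ _ hpos]

theorem card_subtype_le_of_forall_update {L Z : Type*} [Finite L] [DecidableEq L] [Finite Z]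
    [Nonempty Z] (t : L) (E : (L → Z) → Prop) (δ : ℝ)
    (h : ∀ φ, (Nat.card {z : Z // E (Function.update φ t z)} : ℝ) ≤ δ * Nat.card Z) :
    (Nat.card {φ : L → Z // E φ} : ℝ) ≤ δ * Nat.card (L → Z) := by
  classical
  have := Fintype.ofFinite L
  have := Fintype.ofFinite Z
  let e : (L → Z) ≃ Z × ({j // j ≠ t} → Z) := Equiv.funSplitAt t Z
  let fibres : {φ : L → Z // E φ} ≃ (Σ y : {j // j ≠ t} → Z, {z : Z // E (e.symm (z, y))}) :=
    (Equiv.subtypeEquiv (q := fun x => E (e.symm (x.2, x.1))) (e.trans (Equiv.prodComm _ _))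
      (fun φ => by simp)).trans
      (Equiv.subtypeProdEquivSigmaSubtype (fun y z => E (e.symm (z, y))))
  have hfibre (y : {j // j ≠ t} → Z) :
      (Nat.card {z : Z // E (e.symm (z, y))} : ℝ) ≤ δ * Nat.card Z := by
    obtain ⟨z₀⟩ := ‹Nonempty Z›
    have hupdate (z : Z) : Function.update (e.symm (z₀, y)) t z = e.symm (z, y) := by
      funext j
      by_cases hj : j = t
      · subst hj
        simp [e, Equiv.funSplitAt_symm_apply]
      · simp [e, Equiv.funSplitAt_symm_apply, hj]
    simpa only [hupdate] using h (e.symm (z₀, y))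
  rw [Nat.card_congr fibres, Nat.card_sigma, Nat.card_congr e, Nat.card_prod]
  push_cast
  refine (Finset.sum_le_sum fun y _ => hfibre y).trans (le_of_eq ?_)
  rw [Finset.sum_const, nsmul_eq_mul, Finset.card_univ, Nat.card_eq_fintype_card]
  simp only [Nat.card_eq_fintype_card]
  ring

theorem card_not_le_sum_card_not {α ι : Type*} [Finite α] [Fintype ι] {P : α → Prop}
    {Q : ι → α → Prop} (h : ∀ x, (∀ i, Q i x) → P x) :
    Nat.card {x // ¬ P x} ≤ ∑ i, Nat.card {x // ¬ Q i x} := by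
  have hex (x : {x // ¬ P x}) : ∃ i, ¬ Q i x := by
    by_contra! hall
    exact x.2 (h x hall)
  choose i hi using hex
  rw [← Nat.card_sigma]
  refine Nat.card_le_card_of_injective
    (fun x => (⟨i x, x, hi x⟩ : Σ i, {x // ¬ Q i x})) fun x y hxy => ?_
  exact Subtype.ext (congrArg (fun z : Σ i, {x // ¬ Q i x} => (z.2 : α)) hxy)

end Counting

section Classes

/-- The name of the class of `x` in the partition of `S` by `E`; a partition with a single class is
replaced by the partition into singletons, so that there are always at least two classes. -/
noncomputable def classRep (S : Finset ℕ) (E : ℕ → ℕ → Prop) (x : ℕ) : ℕ :=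
  open Classical in if ∀ a ∈ S, ∀ b ∈ S, E a b then x else sInf {y | y ∈ S ∧ E x y}

theorem classRep_spec {S : Finset ℕ} {E : ℕ → ℕ → Prop} (hE : Equivalence E) {x : ℕ}
    (hx : x ∈ S) : classRep S E x ∈ S ∧ E x (classRep S E x) := by
  unfold classRep
  split_ifs
  · exact ⟨hx, hE.refl x⟩
  · exact Nat.sInf_mem (s := {y | y ∈ S ∧ E x y}) ⟨x, hx, hE.refl x⟩

theorem rel_of_classRep_eq {S : Finset ℕ} {E : ℕ → ℕ → Prop} (hE : Equivalence E) {x y : ℕ}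
    (hx : x ∈ S) (hy : y ∈ S) (h : classRep S E x = classRep S E y) : E x y :=
  hE.trans (h ▸ (classRep_spec hE hx).2) (hE.symm (classRep_spec hE hy).2)

theorem not_rel_of_classRep_ne {S : Finset ℕ} {E : ℕ → ℕ → Prop} (hE : Equivalence E)
    (htotal : ¬ ∀ a ∈ S, ∀ b ∈ S, E a b) {x y : ℕ} (h : classRep S E x ≠ classRep S E y) :
    ¬ E x y := by
  intro hxy
  apply h
  rw [classRep, classRep, if_neg htotal, if_neg htotal]
  congr 1
  ext z
  exact and_congr_right fun _ => ⟨hE.trans (hE.symm hxy), hE.trans hxy⟩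

theorem exists_classRep_ne {S : Finset ℕ} {E : ℕ → ℕ → Prop} (hE : Equivalence E)
    (hS : 2 ≤ S.card) : ∃ x ∈ S, ∃ y ∈ S, classRep S E x ≠ classRep S E y := by
  by_cases htotal : ∀ a ∈ S, ∀ b ∈ S, E a b
  · obtain ⟨x, hx, y, hy, hxy⟩ := Finset.one_lt_card.1 hS
    exact ⟨x, hx, y, hy, by rwa [classRep, classRep, if_pos htotal, if_pos htotal]⟩
  · push Not at htotal
    obtain ⟨x, hx, y, hy, hxy⟩ := htotal
    exact ⟨x, hx, y, hy, fun e => hxy (rel_of_classRep_eq hE hx hy e)⟩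

variable {β : Type*} {S : Finset β}

open Classical in
theorem card_filter_add_card_filter_of_not_rel {E : β → β → Prop} (hE : Equivalence E) {x y : β}
    (hxy : ¬ E x y) :
    (S.filter (E x)).card + (S.filter (E y)).card = (S.filter fun z => E x z ∨ E y z).card := by
  rw [Finset.filter_or, Finset.card_union_of_disjoint]
  exact Finset.disjoint_filter.2 fun z _ hxz hyz => hxy (hE.trans hxz (hE.symm hyz))

open Classical in
theorem rel_or_two_pow_le_card_class {E : ℕ → β → β → Prop} {L : ℕ}
    (hE : ∀ t, Equivalence (E t)) (hmono : ∀ t x y, E t x y → E (t + 1) x y)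
    (hmerge : ∀ t < L, (¬ ∀ a ∈ S, ∀ b ∈ S, E t a b) →
      ∀ x ∈ S, ∃ y ∈ S, E (t + 1) x y ∧ ¬ E t x y) {t : ℕ} (ht : t ≤ L) :
    (∀ a ∈ S, ∀ b ∈ S, E t a b) ∨ ∀ x ∈ S, 2 ^ t ≤ (S.filter (E t x)).card := by
  induction t with
  | zero =>
    refine Or.inr fun x hx => ?_
    rw [pow_zero, Nat.one_le_iff_ne_zero, Finset.card_ne_zero]
    exact ⟨x, Finset.mem_filter.2 ⟨hx, (hE 0).refl x⟩⟩
  | succ t ih =>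
    by_cases htotal : ∀ a ∈ S, ∀ b ∈ S, E t a b
    · exact Or.inl fun a ha b hb => hmono t a b (htotal a ha b hb)
    refine Or.inr fun x hx => ?_
    have hclass := (ih (by omega)).resolve_left htotal
    obtain ⟨y, hy, hxy, hnot⟩ := hmerge t (by omega) htotal x hx
    calc 2 ^ (t + 1) = 2 ^ t + 2 ^ t := by ring
      _ ≤ (S.filter (E t x)).card + (S.filter (E t y)).card :=
        add_le_add (hclass x hx) (hclass y hy)
      _ = (S.filter fun z => E t x z ∨ E t y z).card :=
        card_filter_add_card_filter_of_not_rel (hE t) hnot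
      _ ≤ (S.filter (E (t + 1) x)).card := by
        refine Finset.card_le_card (Finset.monotone_filter_right S fun z _ hz => ?_)
        exact hz.elim (hmono t x z) fun hyz => (hE (t + 1)).trans hxy (hmono t y z hyz)

/-- Each class at least doubles in every step, and there is no room for two disjoint classes with
`2 ^ L` elements. -/
theorem rel_of_merge {E : ℕ → β → β → Prop} {L : ℕ} (hE : ∀ t, Equivalence (E t))
    (hmono : ∀ t x y, E t x y → E (t + 1) x y)
    (hmerge : ∀ t < L, (¬ ∀ a ∈ S, ∀ b ∈ S, E t a b) →
      ∀ x ∈ S, ∃ y ∈ S, E (t + 1) x y ∧ ¬ E t x y)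
    (hcard : S.card < 2 ^ (L + 1)) : ∀ x ∈ S, ∀ y ∈ S, E L x y := by
  classical
  refine (rel_or_two_pow_le_card_class hE hmono hmerge le_rfl).elim id fun hclass x hx y hy => ?_
  by_contra hxy
  have hunion := card_filter_add_card_filter_of_not_rel (S := S) (hE L) hxy
  have hle := Finset.card_filter_le S fun z => E L x z ∨ E L y z
  have hx' := hclass x hx
  have hy' := hclass y hy
  rw [pow_succ] at hcard
  omega

end Classes

section Exploration

variable {α β : Type*} {S : Finset β} {R : α → β → β → Prop} {m : ℕ} {ρ : β}

/-- An oriented link with a label. -/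
structure Link (α β : Type*) where
  label : α
  source : β
  target : β

instance [Inhabited α] [Inhabited β] : Inhabited (Link α β) := ⟨⟨default, default, default⟩⟩

/-- The set that is visited from `ρ` by the first `m` links of a sequence. -/
def visited (ρ : β) (m : ℕ) (f : ℕ → Link α β) : Set β := {x | x = ρ ∨ ∃ j < m, (f j).target = x}

theorem visited_zero (ρ : β) (f : ℕ → Link α β) : visited ρ 0 f = {ρ} := by
  simp [visited]

theorem visited_succ (ρ : β) (m : ℕ) (f : ℕ → Link α β) :
    visited ρ (m + 1) f = insert (f m).target (visited ρ m f) := by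
  ext x
  simp only [visited, Nat.lt_succ_iff_lt_or_eq, or_and_right, exists_or, exists_eq_left,
    Set.mem_insert_iff, Set.mem_ofPred_eq, eq_comm (a := x) (b := (f m).target)]
  rw [← or_assoc, or_comm]

theorem visited_congr {f g : ℕ → Link α β} (h : ∀ j < m, f j = g j) :
    visited ρ m f = visited ρ m g := by
  ext x
  exact or_congr_right (exists_congr fun j => and_congr_right fun hj => by rw [h j hj])

/-- `m` links of `R`, each of which starts in the set visited from `ρ` by the earlier ones. -/
structure IsLinkSequence (R : α → β → β → Prop) (ρ : β) (m : ℕ) (f : ℕ → Link α β) : Prop where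
  rel : ∀ j < m, R (f j).label (f j).source (f j).target
  source_mem : ∀ j < m, (f j).source ∈ visited ρ j f

/-- A sequence of `m` links of `R` that visits all of `S` from the source of its first link. -/
structure IsExploration (S : Finset β) (R : α → β → β → Prop) (m : ℕ) (f : ℕ → Link α β) :
    Prop where
  pos : 0 < m
  lt_card : m < S.card
  isLinkSequence : IsLinkSequence R (f 0).source m f
  subset_visited : (S : Set β) ⊆ visited (f 0).source m f

theorem IsLinkSequence.snoc {f : ℕ → Link α β} (hf : IsLinkSequence R ρ m f) {e : Link α β}
    (he : R e.label e.source e.target) (hsource : e.source ∈ visited ρ m f) :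
    IsLinkSequence R ρ (m + 1) (Function.update f m e) := by
  have hlt (j : ℕ) (hj : j < m) : Function.update f m e j = f j :=
    Function.update_of_ne hj.ne _ _
  constructor <;> intro j hj <;> rcases Nat.lt_succ_iff_lt_or_eq.1 hj with hj | rfl
  · rw [hlt j hj]
    exact hf.rel j hj
  · rwa [Function.update_self]
  · rw [hlt j hj, visited_congr fun i hi => hlt i (hi.trans hj)]
    exact hf.source_mem j hj
  · rwa [Function.update_self, visited_congr hlt]

theorem exists_crossing {r : β → β → Prop} {U : Set β} {x y : β}
    (h : Relation.EqvGen r x y) (hx : x ∈ U) (hy : y ∉ U) :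
    ∃ a b, a ∈ U ∧ b ∉ U ∧ (r a b ∨ r b a) := by
  by_contra! hcon
  have hiff : ∀ a b, r a b → (a ∈ U ↔ b ∈ U) := fun a b hab =>
    ⟨fun ha => by_contra fun hb => (hcon a b ha hb).1 hab,
      fun hb => by_contra fun ha => (hcon b a hb ha).2 hab⟩
  have hequiv : Equivalence fun a b => (a ∈ U ↔ b ∈ U) :=
    ⟨fun _ => Iff.rfl, Iff.symm, Iff.trans⟩
  exact hy ((hequiv.eqvGen_iff.1 (h.mono hiff)).1 hx)

theorem exists_isLinkSequence [Nonempty α] (hρ : ρ ∈ S)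
    (hR : ∀ l b a, R l b a → a ∈ S) (hsymm : ∀ l b a, R l b a → R l a b)
    (hconn : ∀ x ∈ S, ∀ y ∈ S, Relation.EqvGen (fun b a => ∃ l, R l b a) x y) (hm : m < S.card) :
    ∃ f : ℕ → Link α β, IsLinkSequence R ρ m f ∧ visited ρ m f ⊆ S ∧
      (visited ρ m f).ncard = m + 1 := by
  induction m with
  | zero =>
    refine ⟨fun _ => ⟨Classical.arbitrary α, ρ, ρ⟩, ⟨by simp, by simp⟩, ?_, ?_⟩ <;>
      simp [visited_zero, hρ]
  | succ m ih =>
    obtain ⟨f, hf, hsub, hcard⟩ := ih (by omega)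
    obtain ⟨y, hy, hyU⟩ : ∃ y ∈ S, y ∉ visited ρ m f := by
      by_contra! hcon
      have := Set.ncard_le_ncard (t := visited ρ m f) hcon (S.finite_toSet.subset hsub)
      rw [Set.ncard_coe_finset] at this
      omega
    obtain ⟨b, a, hb, ha, hba⟩ := exists_crossing (hconn ρ hρ y hy) (Or.inl rfl) hyU
    obtain ⟨l, hl⟩ : ∃ l, R l b a :=
      hba.elim id fun ⟨l, hl⟩ => ⟨l, hsymm _ _ _ hl⟩
    have hvisited : visited ρ (m + 1) (Function.update f m ⟨l, b, a⟩) =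
        insert a (visited ρ m f) := by
      rw [visited_succ, Function.update_self,
        visited_congr fun j hj => Function.update_of_ne hj.ne _ _]
    refine ⟨_, hf.snoc (e := ⟨l, b, a⟩) hl hb, ?_, ?_⟩ <;> rw [hvisited]
    · exact Set.insert_subset (hR _ _ _ hl) hsub
    · rw [Set.ncard_insert_of_notMem ha (S.finite_toSet.subset hsub), hcard]

theorem exists_isExploration [Nonempty α] (hS : 2 ≤ S.card)
    (hR : ∀ l b a, R l b a → a ∈ S) (hsymm : ∀ l b a, R l b a → R l a b)
    (hconn : ∀ x ∈ S, ∀ y ∈ S, Relation.EqvGen (fun b a => ∃ l, R l b a) x y) :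
    ∃ m f, IsExploration S R m f := by
  obtain ⟨ρ, hρ⟩ : S.Nonempty := Finset.card_pos.1 (by omega)
  obtain ⟨f, hf, hsub, hcard⟩ :=
    exists_isLinkSequence hρ hR hsymm hconn (show S.card - 1 < S.card by omega)
  have hroot : (f 0).source = ρ := by
    have := hf.source_mem 0 (by omega)
    rwa [visited_zero] at this
  have hall : visited ρ (S.card - 1) f = S :=
    Set.eq_of_subset_of_ncard_le hsub (by rw [Set.ncard_coe_finset]; omega)
  exact ⟨S.card - 1, f, by omega, by omega, by rwa [hroot], by rw [hroot, hall]⟩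

/-- The length and the links of an exploration, if there is one. -/
noncomputable def exploration [Inhabited α] [Inhabited β] (S : Finset β) (R : α → β → β → Prop) :
    ℕ × (ℕ → Link α β) :=
  open Classical in
  if h : ∃ m f, IsExploration S R m f then (h.choose, h.choose_spec.choose) else (0, default)

theorem isExploration_exploration [Inhabited α] [Inhabited β] (h : ∃ m f, IsExploration S R m f) :
    IsExploration S R (exploration S R).1 (exploration S R).2 := by
  rw [exploration, dif_pos h]
  exact h.choose_spec.choose_spec

theorem exploration_fst_le_card [Inhabited α] [Inhabited β] (S : Finset β) (R : α → β → β → Prop) :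
    (exploration S R).1 ≤ S.card := by
  by_cases h : ∃ m f, IsExploration S R m f
  · exact (isExploration_exploration h).lt_card.le
  · rw [exploration, dif_neg h]
    exact Nat.zero_le _

/-- The first position of a link with label `l` and source `b` in the exploration. -/
noncomputable def rank [Inhabited α] [Inhabited β] (S : Finset β) (R : α → β → β → Prop) (l : α)
    (b : β) : Option ℕ :=
  open Classical in
  if h : ∃ j, j < (exploration S R).1 ∧ ((exploration S R).2 j).label = l ∧
    ((exploration S R).2 j).source = b then some (Nat.find h) else none

theorem rank_spec [Inhabited α] [Inhabited β] {l : α} {b : β} {j : ℕ}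
    (h : rank S R l b = some j) : j < (exploration S R).1 ∧ ((exploration S R).2 j).label = l ∧
      ((exploration S R).2 j).source = b := by
  classical
  unfold rank at h
  split_ifs at h with hex
  rw [← Option.some_inj.1 h]
  exact Nat.find_spec hex

theorem rank_lt_card [Inhabited α] [Inhabited β] {l : α} {b : β} {j : ℕ}
    (h : rank S R l b = some j) : j < S.card :=
  (rank_spec h).1.trans_le (exploration_fst_le_card S R)

theorem exists_rank_le [Inhabited α] [Inhabited β] {j : ℕ} (h : j < (exploration S R).1) :
    ∃ i ≤ j, rank S R ((exploration S R).2 j).label ((exploration S R).2 j).source = some i := by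
  classical
  have hex : ∃ i, i < (exploration S R).1 ∧
      ((exploration S R).2 i).label = ((exploration S R).2 j).label ∧
      ((exploration S R).2 i).source = ((exploration S R).2 j).source := ⟨j, h, rfl, rfl⟩
  exact ⟨Nat.find hex, Nat.find_min' hex ⟨h, rfl, rfl⟩, by rw [rank, dif_pos hex]⟩

end Exploration

/-! ### Deterministic protocols -/

section Protocols

/-- The messages that `v` receives, as in `inbox`, but with letters from an arbitrary type. -/
noncomputable def received {V Y : Type*} (G : SimpleGraph V) (ident : V → ℕ)
    (out : V → ℕ → Option Y) (v : V) : ℕ → Option Y :=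
  open Classical in
  fun x => if h : ∃ u, G.Adj v u ∧ ident u = x then out h.choose (ident v) else none

theorem received_of_adj {V Y : Type*} {G : SimpleGraph V} {ident : V → ℕ}
    (hident : Function.Injective ident) (out : V → ℕ → Option Y) {v u : V} (h : G.Adj v u) :
    received G ident out v (ident u) = out u (ident v) := by
  have hex : ∃ w, G.Adj v w ∧ ident w = ident u := ⟨u, h, rfl⟩
  rw [received, dif_pos hex, hident hex.choose_spec.2]

theorem received_eq_none {V Y : Type*} {G : SimpleGraph V} {ident : V → ℕ}
    (out : V → ℕ → Option Y) {v : V} {x : ℕ} (h : ¬ ∃ u, G.Adj v u ∧ ident u = x) :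
    received G ident out v x = none :=
  dif_neg h

/-- A deterministic protocol in which a node initially knows its identifier, the identifiers of its
neighbours and its random seed; `send` and `receive` also get the number of the round. -/
structure Protocol (M : ℕ) (Seed X : Type) where
  State : Type
  start : ℕ → Finset ℕ → Seed → State
  send : ℕ → State → ℕ → Option (Fin M)
  receive : ℕ → State → (ℕ → Option (Fin M)) → State
  output : State → X

variable {M T q : ℕ} {Seed X Y Z S : Type}

namespace Protocol

variable {V : Type} [Fintype V] (G : SimpleGraph V) (ident : V → ℕ) (φ : V → Seed)

/-- The states of the nodes after the given number of rounds. -/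
noncomputable def states (P : Protocol M Seed X) : ℕ → V → P.State
  | 0 => fun v => P.start (ident v) (neighborIdents G ident v) (φ v)
  | t + 1 => fun v => P.receive t (P.states t v)
      (received G ident (fun u => P.send t (P.states t u)) v)

/-- The protocol `P` with its output changed by `g`. -/
def map (P : Protocol M Seed X) (g : X → Y) : Protocol M Seed Y where
  __ := P
  output := g ∘ P.output

theorem states_map (P : Protocol M Seed X) (g : X → Y) (t : ℕ) :
    (P.map g).states G ident φ t = P.states G ident φ t := by
  induction t with
  | zero => rfl
  | succ t ih =>
    funext v
    simp only [states, ih]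
    rfl

/-- The first `T` rounds of `P`, followed by a round in which the nodes exchange letters that
depend on the output of `P`. -/
def exchangeAfter (P : Protocol M Seed X) (T : ℕ) (msg : X → ℕ → Option (Fin M)) :
    Protocol M Seed (X × (ℕ → Option (Fin M))) where
  State := P.State × (ℕ → Option (Fin M))
  start i nb s := (P.start i nb s, fun _ => none)
  send t s := if t < T then P.send t s.1 else msg (P.output s.1)
  receive t s m := if t < T then (P.receive t s.1 m, s.2) else (s.1, m)
  output s := (P.output s.1, s.2)

theorem states_exchangeAfter_fst (P : Protocol M Seed X) (msg : X → ℕ → Option (Fin M)) {t : ℕ}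
    (ht : t ≤ T) (v : V) :
    ((P.exchangeAfter T msg).states G ident φ t v).1 = P.states G ident φ t v := by
  induction t generalizing v with
  | zero => rfl
  | succ t ih =>
    have hlt : t < T := ht
    simp only [exchangeAfter] at ih
    simp only [states, exchangeAfter, hlt, if_true, ih hlt.le]

theorem states_exchangeAfter (P : Protocol M Seed X) (msg : X → ℕ → Option (Fin M)) (v : V) :
    (P.exchangeAfter T msg).states G ident φ (T + 1) v = (P.states G ident φ T v,
      received G ident (fun u => msg (P.output (P.states G ident φ T u))) v) := by
  have hfst := P.states_exchangeAfter_fst G ident φ msg (le_refl T)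
  simp only [exchangeAfter] at hfst
  simp only [states, exchangeAfter, lt_irrefl, if_false, hfst]

/-- The algorithm that executes `P` with the seeds of its first round; this takes one more round
because the initial state of an algorithm does not depend on the randomness. -/
noncomputable def toAlgorithm [Finite Seed] [Nonempty Seed] (P : Protocol M Seed X) (T : ℕ) :
    Algorithm (T + 1) M X where
  State := (ℕ × Finset ℕ) ⊕ P.State
  Seed := Seed
  seedFinite := inferInstance
  seedNonempty := inferInstance
  init i nb := Sum.inl (i, nb)
  step t s m ω :=
    let s' := Sum.elim (fun k => P.start k.1 k.2 ω) (fun s => P.receive (t - 1) s m) s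
    (Sum.inr s', P.send t s')
  output := Sum.elim (fun k => P.output (P.start k.1 k.2 (Classical.arbitrary Seed))) P.output

theorem config_toAlgorithm [Finite Seed] [Nonempty Seed] (P : Protocol M Seed X)
    (ω : V → Fin (T + 1) → Seed) {t : ℕ} (ht : t ≤ T) (v : V) :
    (P.toAlgorithm T).config G ident ω (t + 1) v =
      (Sum.inr (P.states G ident (fun v => ω v 0) t v),
        P.send t (P.states G ident (fun v => ω v 0) t v)) := by
  induction t generalizing v with
  | zero =>
    simp only [Algorithm.config, Nat.zero_lt_succ, dif_pos]
    rfl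
  | succ t ih =>
    have hin : inbox G ident (fun u => ((P.toAlgorithm T).config G ident ω (t + 1) u).2) v =
        received G ident (fun u => P.send t (P.states G ident (fun v => ω v 0) t u)) v := by
      simp only [ih (by omega)]
      rfl
    refine (dif_pos (show t + 1 < T + 1 by omega)).trans ?_
    rw [hin, ih (by omega) v]
    rfl

theorem result_toAlgorithm [Finite Seed] [Nonempty Seed] (P : Protocol M Seed X)
    (ω : V → Fin (T + 1) → Seed) (v : V) :
    (P.toAlgorithm T).result G ident ω v =
      P.output (P.states G ident (fun v => ω v 0) T v) :=
  congrArg (fun c : (P.toAlgorithm T).State × _ => (P.toAlgorithm T).output c.1)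
    (P.config_toAlgorithm G ident ω le_rfl v)

theorem failureProb_toAlgorithm [Finite Seed] [Nonempty Seed] (P : Protocol M Seed X)
    (Q : (V → X) → Prop) :
    (P.toAlgorithm T).failureProb G ident Q =
      (Nat.card {φ : V → Seed // ¬ Q fun v => P.output (P.states G ident φ T v)} : ℝ) /
        Nat.card (V → Seed) := by
  have hfirst : Function.Injective fun v : V => (v, (0 : Fin (T + 1))) :=
    fun a b hab => congrArg Prod.fst hab
  let e : (V → Fin (T + 1) → Seed) ≃ (V × Fin (T + 1) → Seed) := (Equiv.curry _ _ _).symm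
  have hfail : Nat.card {ω // ¬ Q ((P.toAlgorithm T).result G ident ω)} =
      Nat.card {f : V × Fin (T + 1) → Seed //
        ¬ Q fun v => P.output (P.states G ident (f ∘ fun v => (v, 0)) T v)} := by
    refine Nat.card_congr (Equiv.subtypeEquiv e fun ω => ?_)
    rw [funext (P.result_toAlgorithm G ident ω)]
    rfl
  have hall : Nat.card (V → Fin (T + 1) → Seed) = Nat.card (V × Fin (T + 1) → Seed) :=
    Nat.card_congr e
  rw [← card_comp_injective_div_card hfirst
    (fun φ => ¬ Q fun v => P.output (P.states G ident φ T v)), ← hfail, ← hall]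
  rfl

end Protocol

/-- Values at the nodes of networks whose nodes have random seeds. -/
abbrev LocalValue (Seed X : Type) : Type 1 :=
  ∀ (V : Type) [Fintype V] (_G : SimpleGraph V) (_ident : V → ℕ), (V → Seed) → V → X

/-- The value `F` is computable in `T` rounds with messages from an alphabet of `M` letters. -/
def ComputableIn (M T : ℕ) (F : LocalValue Seed X) : Prop :=
  ∃ P : Protocol M Seed X, ∀ (V : Type) [Fintype V] (G : SimpleGraph V) (ident : V → ℕ)
    (φ : V → Seed) (v : V), P.output (P.states G ident φ T v) = F V G ident φ v

/-- The messages `Option Y` can be transmitted by `q` letters from an alphabet of size `M`, silence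
being transmitted by silence. -/
def Transmissible (M q : ℕ) (Y : Type*) : Prop :=
  ∃ e : Option Y → Fin q → Option (Fin M), Function.Injective e ∧ e none = fun _ => none

theorem transmissible_of_card_le {Y : Type*} [Finite Y] (h : Nat.card Y + 1 ≤ (M + 1) ^ q) :
    Transmissible M q Y := by
  classical
  have := Fintype.ofFinite Y
  have hcard : Fintype.card (Option Y) ≤ Fintype.card (Fin q → Option (Fin M)) := by
    rw [Fintype.card_option, ← Nat.card_eq_fintype_card]
    simpa using h
  obtain ⟨e⟩ := Function.Embedding.nonempty_of_card_le hcard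
  exact ⟨fun y => Equiv.swap (e none) (fun _ => none) (e y),
    (Equiv.injective _).comp e.injective, Equiv.swap_apply_left _ _⟩

namespace ComputableIn

variable {F F' : LocalValue Seed X}

theorem init : ComputableIn M 0
    (fun _ _ G ident φ v => (ident v, neighborIdents G ident v, φ v) :
      LocalValue Seed (ℕ × Finset ℕ × Seed)) :=
  ⟨⟨_, fun i nb s => (i, nb, s), fun _ _ _ => none, fun _ s _ => s, id⟩, fun _ _ _ _ _ _ => rfl⟩

theorem congr (h : ComputableIn M T F)
    (hF : ∀ (V : Type) [Fintype V] (G : SimpleGraph V) (ident : V → ℕ) (φ : V → Seed) (v : V),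
      F V G ident φ v = F' V G ident φ v) : ComputableIn M T F' :=
  let ⟨P, hP⟩ := h
  ⟨P, fun V _ G ident φ v => (hP V G ident φ v).trans (hF V G ident φ v)⟩

theorem map (h : ComputableIn M T F) (g : X → Y) :
    ComputableIn M T (fun V _ G ident φ v => g (F V G ident φ v)) := by
  obtain ⟨P, hP⟩ := h
  refine ⟨P.map g, fun V _ G ident φ v => ?_⟩
  rw [Protocol.states_map]
  exact congrArg g (hP V G ident φ v)

theorem exchangeLetter (h : ComputableIn M T F) (msg : X → ℕ → Option (Fin M)) :
    ComputableIn M (T + 1) (fun V _ G ident φ v =>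
      (F V G ident φ v, received G ident (fun u => msg (F V G ident φ u)) v)) := by
  obtain ⟨P, hP⟩ := h
  refine ⟨P.exchangeAfter T msg, fun V _ G ident φ v => ?_⟩
  rw [Protocol.states_exchangeAfter]
  simp only [hP, Protocol.exchangeAfter]

theorem exchangeLetters (h : ComputableIn M T F) (msg : X → ℕ → ℕ → Option (Fin M)) (q : ℕ) :
    ComputableIn M (T + q) (fun V _ G ident φ v =>
      (F V G ident φ v, fun (i x : ℕ) => if i < q then
        received G ident (fun u y => msg (F V G ident φ u) y i) v x else none)) := by
  induction q with
  | zero =>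
    refine (h.map (fun x => (x, fun (_ _ : ℕ) => (none : Option (Fin M))))).congr ?_
    intros
    simp
  | succ q ih =>
    have hnext := (ih.exchangeLetter (fun s y => msg s.1 y q)).map
      (fun s => (s.1.1, fun (i x : ℕ) => if i = q then s.2 x else s.1.2 i x))
    refine hnext.congr fun V _ G ident φ v => Prod.ext rfl ?_
    funext i x
    rcases lt_trichotomy i q with hi | hi | hi
    · simp [hi, hi.ne, hi.trans (Nat.lt_succ_self q)]
    · simp [hi]
    · simp [show ¬ i < q + 1 by omega, show ¬ i < q by omega, hi.ne']

theorem exchange (h : ComputableIn M T F) (hY : Transmissible M q Y) (msg : X → ℕ → Option Y) :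
    ComputableIn M (T + q) (fun V _ G ident φ v =>
      (F V G ident φ v, received G ident (fun u => msg (F V G ident φ u)) v)) := by
  classical
  obtain ⟨encode, hencode, hnone⟩ := hY
  let letter (o : Option Y) (i : ℕ) : Option (Fin M) :=
    if hi : i < q then encode o ⟨i, hi⟩ else none
  have hletters := (h.exchangeLetters (fun s y i => letter (msg s y) i) q).map
    (fun s => (s.1, fun x => Function.invFun encode (fun i => s.2 i x)))
  refine hletters.congr fun V _ G ident φ v => Prod.ext rfl (funext fun x => ?_)
  by_cases hx : ∃ u, G.Adj v u ∧ ident u = x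
  · simp only [received, hx, dif_pos, letter, Fin.is_lt, if_true]
    exact Function.leftInverse_invFun hencode _
  · have hsilent (out : ℕ → V → ℕ → Option (Fin M)) :
        (fun i : Fin q => if (i : ℕ) < q then received G ident (out i) v x else none) =
          encode none := by
      funext i
      rw [received_eq_none _ hx, hnone, ite_self]
    exact (congrArg _ (hsilent fun i u y => letter (msg (F V G ident φ u) y) i)).trans
      ((Function.leftInverse_invFun hencode _).trans
        (received_eq_none (fun u => msg (F V G ident φ u)) hx).symm)

end ComputableIn

/-- The states of an iterated exchange of messages; `env` is constant during the iteration. -/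
noncomputable def iterate {V X Y S : Type*} (G : SimpleGraph V) (ident : V → ℕ) (env : V → X)
    (init : X → S) (msg : ℕ → X → S → ℕ → Option Y)
    (upd : ℕ → X → S → (ℕ → Option Y) → S) : ℕ → V → S
  | 0 => fun v => init (env v)
  | i + 1 => fun v => upd i (env v) (iterate G ident env init msg upd i v)
      (received G ident (fun u => msg i (env u) (iterate G ident env init msg upd i u)) v)

theorem ComputableIn.iterate {F : LocalValue Seed X} (h : ComputableIn M T F)
    (hY : Transmissible M q Y) (g : X → Z) (init : Z → S) (msg : ℕ → Z → S → ℕ → Option Y)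
    (upd : ℕ → Z → S → (ℕ → Option Y) → S) (R : ℕ) :
    ComputableIn M (T + R * q) (fun V _ G ident φ v => (F V G ident φ v,
      PrivateTrees.iterate G ident (fun u => g (F V G ident φ u)) init msg upd R v)) := by
  induction R with
  | zero =>
    rw [Nat.zero_mul]
    exact h.map (fun x => (x, init (g x)))
  | succ R ih =>
    have hnext := (ih.exchange hY (fun s => msg R (g s.1) s.2)).map
      (fun s => (s.1.1, upd R (g s.1.1) s.1.2 s.2))
    rwa [Nat.add_assoc, ← Nat.succ_mul] at hnext

theorem ComputableIn.exists_algorithm {F : LocalValue Seed X} [Finite Seed] [Nonempty Seed]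
    (h : ComputableIn M T F) :
    ∃ B : Algorithm (T + 1) M X, ∀ (V : Type) [Fintype V] (G : SimpleGraph V) (ident : V → ℕ)
      (Q : (V → X) → Prop), B.failureProb G ident Q =
        (Nat.card {φ : V → Seed // ¬ Q (F V G ident φ)} : ℝ) / Nat.card (V → Seed) := by
  obtain ⟨P, hP⟩ := h
  refine ⟨P.toAlgorithm T, fun V _ G ident Q => ?_⟩
  simp only [P.failureProb_toAlgorithm, hP]

end Protocols

/-! ### The split graph -/

section Split

variable {V : Type*} {G : SimpleGraph V} {ident : V → ℕ} {rep : V → ℕ → ℕ} {N : ℕ}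

/-- `rep u` partitions the neighbours of `u` (given by their identifiers) into at least two classes;
the name of a class is the identifier of a neighbour of `u`. -/
structure IsSplitting (G : SimpleGraph V) (ident : V → ℕ) (rep : V → ℕ → ℕ) : Prop where
  exists_ident : ∀ u v, G.Adj u v → ∃ w, G.Adj u w ∧ rep u (ident v) = ident w
  exists_ne : ∀ u, ∃ v w, G.Adj u v ∧ G.Adj u w ∧ rep u (ident v) ≠ rep u (ident w)

/-- The vertices of the split graph: every vertex `u` is replaced by a centre `(u, ident u)` and by
one vertex `(u, a)` for every class `a` of its neighbours. -/
def SplitVertex (G : SimpleGraph V) (ident : V → ℕ) (rep : V → ℕ → ℕ) : Type _ :=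
  {q : V × ℕ // q.2 = ident q.1 ∨ ∃ x, G.Adj q.1 x ∧ rep q.1 (ident x) = q.2}

namespace SplitVertex

/-- The vertex of the original graph to which a vertex of the split graph belongs. -/
def base (q : SplitVertex G ident rep) : V := q.1.1

/-- The name of a vertex of the split graph among those with the same base. -/
def name (q : SplitVertex G ident rep) : ℕ := q.1.2

theorem ext' {p q : SplitVertex G ident rep} (hbase : p.base = q.base) (hname : p.name = q.name) :
    p = q :=
  Subtype.ext (Prod.ext hbase hname)

theorem ne_of_base_ne {p q : SplitVertex G ident rep} (h : p.base ≠ q.base) : p ≠ q :=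
  fun hpq => h (congrArg base hpq)

/-- The centre of the cluster of `u`. -/
def center (u : V) : SplitVertex G ident rep := ⟨(u, ident u), Or.inl rfl⟩

/-- The endpoint in the cluster of `u` of the edge that corresponds to the edge from `u` to `v`. -/
def port {u v : V} (h : G.Adj u v) : SplitVertex G ident rep :=
  ⟨(u, rep u (ident v)), Or.inr ⟨v, h, rfl⟩⟩

theorem name_cases (q : SplitVertex G ident rep) :
    q.name = ident q.base ∨ ∃ x, G.Adj q.base x ∧ rep q.base (ident x) = q.name := q.2

theorem eq_center_or_port (q : SplitVertex G ident rep) :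
    q = center q.base ∨ ∃ (x : V) (h : G.Adj q.base x), q = port h := by
  rcases q.name_cases with h | ⟨x, hx, h⟩
  · exact Or.inl (ext' rfl h)
  · exact Or.inr ⟨x, hx, ext' rfl h.symm⟩

theorem name_port {u v : V} (h : G.Adj u v) :
    (port h : SplitVertex G ident rep).name = rep u (ident v) := rfl

theorem center_injective : Function.Injective (center : V → SplitVertex G ident rep) :=
  fun _ _ h => congrArg base h

end SplitVertex

open SplitVertex

/-- The split graph: centres are joined to the class vertices of their clusters, and every edge
`u v` of `G` joins the classes to which the endpoints assign each other. -/
def splitGraph (G : SimpleGraph V) (ident : V → ℕ) (rep : V → ℕ → ℕ) :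
    SimpleGraph (SplitVertex G ident rep) where
  Adj p q := (p.base = q.base ∧ p.name ≠ q.name ∧
      (p.name = ident p.base ∨ q.name = ident q.base)) ∨
    (G.Adj p.base q.base ∧ p.name = rep p.base (ident q.base) ∧
      q.name = rep q.base (ident p.base))
  symm := ⟨by
    rintro p q (⟨hbase, hname, hcenter⟩ | ⟨hG, hp, hq⟩)
    · exact Or.inl ⟨hbase.symm, hname.symm, hcenter.symm⟩
    · exact Or.inr ⟨hG.symm, hq, hp⟩⟩
  loopless := ⟨by
    rintro p (⟨-, hname, -⟩ | ⟨hG, -, -⟩)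
    · exact hname rfl
    · exact G.irrefl hG⟩

/-- The identifiers of the vertices of the split graph. -/
def splitIdent (N : ℕ) (G : SimpleGraph V) (ident : V → ℕ) (rep : V → ℕ → ℕ)
    (q : SplitVertex G ident rep) : ℕ := ident q.base * N + q.name

theorem splitGraph_adj_port {u v : V} (h : G.Adj u v) :
    (splitGraph G ident rep).Adj (port h) (port h.symm) := Or.inr ⟨h, rfl, rfl⟩

theorem eq_port_of_adj {p q : SplitVertex G ident rep} (h : (splitGraph G ident rep).Adj p q)
    (hne : p.base ≠ q.base) : ∃ hG : G.Adj p.base q.base, p = port hG ∧ q = port hG.symm := by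
  rcases h with ⟨hbase, -⟩ | ⟨hG, hp, hq⟩
  · exact absurd hbase hne
  · exact ⟨hG, ext' rfl hp, ext' rfl hq⟩

namespace IsSplitting

variable (hs : IsSplitting G ident rep)
include hs

theorem exists_name (q : SplitVertex G ident rep) :
    ∃ w, q.name = ident w ∧ (w = q.base ∨ G.Adj q.base w) := by
  rcases q.name_cases with h | ⟨x, hx, h⟩
  · exact ⟨_, h, Or.inl rfl⟩
  · obtain ⟨w, hw, hwx⟩ := hs.exists_ident _ _ hx
    exact ⟨w, h ▸ hwx, Or.inr hw⟩

theorem name_lt (hN : ∀ v, ident v < N) (q : SplitVertex G ident rep) : q.name < N := by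
  obtain ⟨v, hv, -⟩ := hs.exists_name q
  exact hv ▸ hN v

theorem splitIdent_lt (hN : ∀ v, ident v < N) (q : SplitVertex G ident rep) :
    splitIdent N G ident rep q < N * N := by
  have hname := hs.name_lt hN q
  have hbase := hN q.base
  unfold splitIdent
  nlinarith

theorem splitIdent_div (hN : ∀ v, ident v < N) (q : SplitVertex G ident rep) :
    splitIdent N G ident rep q / N = ident q.base := by
  have hname := hs.name_lt hN q
  rw [splitIdent, Nat.mul_comm, Nat.mul_add_div (by omega), Nat.div_eq_of_lt hname, Nat.add_zero]

theorem splitIdent_mod (hN : ∀ v, ident v < N) (q : SplitVertex G ident rep) :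
    splitIdent N G ident rep q % N = q.name := by
  rw [splitIdent, Nat.mul_add_mod', Nat.mod_eq_of_lt (hs.name_lt hN q)]

theorem splitIdent_injective (hident : Function.Injective ident) (hN : ∀ v, ident v < N) :
    Function.Injective (splitIdent N G ident rep) := by
  intro p q h
  refine ext' (hident ?_) ?_
  · rw [← hs.splitIdent_div hN, h, hs.splitIdent_div hN]
  · rw [← hs.splitIdent_mod hN, h, hs.splitIdent_mod hN]

/-- A vertex of the split graph, as a pair of vertices of the original graph. -/
noncomputable def toProd (q : SplitVertex G ident rep) : V × V :=
  (q.base, (hs.exists_name q).choose)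

theorem toProd_injective : Function.Injective hs.toProd := by
  intro p q h
  have hbase : p.base = q.base := congrArg (Prod.fst : V × V → V) h
  have hchoose : (hs.exists_name p).choose = (hs.exists_name q).choose :=
    congrArg (Prod.snd : V × V → V) h
  refine ext' hbase ?_
  rw [(hs.exists_name p).choose_spec.1, (hs.exists_name q).choose_spec.1, hchoose]

theorem finite [Finite V] : Finite (SplitVertex G ident rep) :=
  Finite.of_injective _ hs.toProd_injective

variable (hident : Function.Injective ident)
include hident

theorem rep_ne {u v : V} (h : G.Adj u v) : rep u (ident v) ≠ ident u := by
  obtain ⟨w, hw, hrep⟩ := hs.exists_ident _ _ h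
  rw [hrep]
  exact fun he => hw.ne' (hident he)

theorem adj_center_port {u v : V} (h : G.Adj u v) :
    (splitGraph G ident rep).Adj (center u) (port h) :=
  Or.inl ⟨rfl, (hs.rep_ne hident h).symm, Or.inl rfl⟩

theorem exists_eq_port_of_adj_center {u : V} {p : SplitVertex G ident rep}
    (h : (splitGraph G ident rep).Adj (center u) p) :
    ∃ (x : V) (hx : G.Adj u x), p = port hx := by
  rcases h with ⟨rfl, hname, -⟩ | ⟨hG, hname, -⟩
  · obtain hp | hp := p.eq_center_or_port
    · exact absurd (congrArg name hp).symm hname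
    · exact hp
  · exact absurd hname.symm (hs.rep_ne hident hG)

theorem eq_center_or_port_of_adj_port {u x : V} {hx : G.Adj u x} {p : SplitVertex G ident rep}
    (h : (splitGraph G ident rep).Adj (port hx) p) :
    p = center u ∨ ∃ (y : V) (hy : G.Adj u y),
      rep u (ident y) = rep u (ident x) ∧ p = port hy.symm := by
  rcases h with ⟨hbase, -, hcenter | hcenter⟩ | ⟨hG, hname, hp⟩
  · exact absurd hcenter (hs.rep_ne hident hx)
  · exact Or.inl (ext' hbase.symm (hcenter.trans (congrArg ident hbase.symm)))
  · exact Or.inr ⟨p.base, hG, hname.symm, ext' rfl hp⟩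

theorem ncard_neighborSet_center_le [Finite V] (u : V) :
    ((splitGraph G ident rep).neighborSet (center u)).ncard ≤ (G.neighborSet u).ncard := by
  have : Finite (SplitVertex G ident rep) := hs.finite
  have hsub : (splitGraph G ident rep).neighborSet (center u) ⊆
      Set.range fun x : G.neighborSet u => port x.2 := by
    intro p hp
    obtain ⟨x, hx, rfl⟩ := hs.exists_eq_port_of_adj_center hident hp
    exact ⟨⟨x, hx⟩, rfl⟩
  calc _ ≤ _ := Set.ncard_le_ncard hsub
    _ ≤ _ := Finite.card_range_le _

/-- All edges of `G` that lead to another class of `u` are replaced by the edge to the centre. -/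
theorem ncard_neighborSet_port_le [Finite V] {u x : V} (hx : G.Adj u x) :
    ((splitGraph G ident rep).neighborSet (port hx)).ncard ≤ (G.neighborSet u).ncard := by
  have : Finite (SplitVertex G ident rep) := hs.finite
  let A : Set V := {y | G.Adj u y ∧ rep u (ident y) = rep u (ident x)}
  have hA : A ⊂ G.neighborSet u := by
    refine ⟨fun y hy => hy.1, fun hall => ?_⟩
    obtain ⟨v, w, hv, hw, hvw⟩ := hs.exists_ne u
    exact hvw ((hall hv).2.trans (hall hw).2.symm)
  have hsub : (splitGraph G ident rep).neighborSet (port hx) ⊆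
      insert (center u) (Set.range fun y : A => port y.2.1.symm) := by
    intro p hp
    obtain rfl | ⟨y, hy, hyx, rfl⟩ := hs.eq_center_or_port_of_adj_port hident hp
    · exact Or.inl rfl
    · exact Or.inr ⟨⟨y, hy, hyx⟩, rfl⟩
  calc _ ≤ _ := Set.ncard_le_ncard hsub
    _ ≤ (Set.range fun y : A => (port y.2.1.symm : SplitVertex G ident rep)).ncard + 1 :=
      Set.ncard_insert_le _ _
    _ ≤ A.ncard + 1 := Nat.add_le_add_right (Finite.card_range_le _) 1
    _ ≤ (G.neighborSet u).ncard := Set.ncard_lt_ncard hA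

theorem ncard_neighborSet_le [Finite V] (q : SplitVertex G ident rep) :
    ((splitGraph G ident rep).neighborSet q).ncard ≤ (G.neighborSet q.base).ncard := by
  obtain hq | ⟨x, hx, hq⟩ := q.eq_center_or_port
  · exact (congrArg (fun p => ((splitGraph G ident rep).neighborSet p).ncard) hq).trans_le
      (hs.ncard_neighborSet_center_le hident q.base)
  · exact (congrArg (fun p => ((splitGraph G ident rep).neighborSet p).ncard) hq).trans_le
      (hs.ncard_neighborSet_port_le hident hx)

theorem exists_walk_center {u v : V} (p : G.Walk u v) :
    ∃ w : (splitGraph G ident rep).Walk (center u) (center v), w.length = 3 * p.length := by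
  induction p with
  | nil => exact ⟨.nil, rfl⟩
  | cons h p ih =>
    obtain ⟨w, hw⟩ := ih
    refine ⟨.cons (hs.adj_center_port hident h) (.cons (splitGraph_adj_port h)
      (.cons (hs.adj_center_port hident h.symm).symm w)), ?_⟩
    simp only [SimpleGraph.Walk.length_cons, hw]
    ring

theorem exists_walk_to_center (q : SplitVertex G ident rep) :
    ∃ w : (splitGraph G ident rep).Walk q (center q.base), w.length ≤ 1 := by
  obtain h | ⟨x, hx, h⟩ := q.eq_center_or_port
  · exact ⟨.copy .nil rfl h, by simp⟩
  · have hadj : (splitGraph G ident rep).Adj q (center q.base) := by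
      have := (hs.adj_center_port hident hx).symm
      rwa [← h] at this
    exact ⟨.cons hadj .nil, le_rfl⟩

theorem diam_le [Finite V] (hG : G.Connected) :
    (splitGraph G ident rep).diam ≤ 3 * G.diam + 2 := by
  have : Nonempty V := hG.nonempty
  have : Finite (SplitVertex G ident rep) := hs.finite
  have : Nonempty (SplitVertex G ident rep) := ⟨center (Classical.arbitrary V)⟩
  obtain ⟨p, q, h⟩ := (splitGraph G ident rep).exists_dist_eq_diam
  rw [← h]
  obtain ⟨wp, hwp⟩ := hs.exists_walk_to_center hident p
  obtain ⟨wq, hwq⟩ := hs.exists_walk_to_center hident q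
  obtain ⟨g, hg⟩ := hG.exists_walk_length_eq_dist p.base q.base
  obtain ⟨w, hw⟩ := hs.exists_walk_center hident g
  refine (SimpleGraph.dist_le (wp.append (w.append wq.reverse))).trans ?_
  have := SimpleGraph.dist_le_diam (SimpleGraph.connected_iff_ediam_ne_top.1 hG)
    (u := p.base) (v := q.base)
  simp only [SimpleGraph.Walk.length_append, SimpleGraph.Walk.length_reverse]
  omega

theorem reachable_center_of_base_ne {z q : SplitVertex G ident rep} (hq : q.base ≠ z.base) :
    ((splitGraph G ident rep).induce {z}ᶜ).Reachable ⟨q, ne_of_base_ne hq⟩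
      ⟨center q.base, ne_of_base_ne hq⟩ := by
  obtain h | ⟨x, hx, h⟩ := q.eq_center_or_port
  · rw [show (⟨q, ne_of_base_ne hq⟩ : ({z}ᶜ : Set _)) = ⟨center q.base, ne_of_base_ne hq⟩ from
      Subtype.ext h]
  · rw [show (⟨q, ne_of_base_ne hq⟩ : ({z}ᶜ : Set _)) = ⟨port hx, h ▸ ne_of_base_ne hq⟩ from
      Subtype.ext h]
    exact SimpleGraph.Adj.reachable (hs.adj_center_port hident hx).symm

theorem reachable_port_center {z : SplitVertex G ident rep} {u x : V} (hu : u = z.base)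
    (hx : G.Adj u x) (hz : (port hx : SplitVertex G ident rep) ≠ z) :
    ((splitGraph G ident rep).induce {z}ᶜ).Reachable ⟨port hx, hz⟩
      ⟨center x, ne_of_base_ne (hu ▸ hx.ne')⟩ := by
  have hxz : x ≠ z.base := hu ▸ hx.ne'
  have hport : ((splitGraph G ident rep).induce {z}ᶜ).Adj ⟨port hx, hz⟩
      ⟨port hx.symm, ne_of_base_ne hxz⟩ := splitGraph_adj_port hx
  exact hport.reachable.trans (hs.reachable_center_of_base_ne hident (q := port hx.symm) hxz)

omit hident in
theorem exists_port_ne (z : SplitVertex G ident rep) (u : V) :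
    ∃ (x : V) (hx : G.Adj u x), (port hx : SplitVertex G ident rep) ≠ z := by
  obtain ⟨v, w, hv, hw, hvw⟩ := hs.exists_ne u
  by_contra! hcon
  exact hvw ((congrArg name (hcon v hv)).trans (congrArg name (hcon w hw)).symm)

theorem exists_reachable_center {z q : SplitVertex G ident rep} (hq : q ≠ z) :
    ∃ (v : V) (hv : v ≠ z.base), ((splitGraph G ident rep).induce {z}ᶜ).Reachable ⟨q, hq⟩
      ⟨center v, ne_of_base_ne hv⟩ := by
  by_cases hbase : q.base = z.base
  · obtain h | ⟨x, hx, h⟩ := q.eq_center_or_port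
    · obtain ⟨x, hx, hxz⟩ := hs.exists_port_ne z q.base
      have hadj : ((splitGraph G ident rep).induce {z}ᶜ).Adj ⟨q, hq⟩ ⟨port hx, hxz⟩ := by
        have := hs.adj_center_port hident hx
        rwa [← h] at this
      exact ⟨x, hbase ▸ hx.ne',
        hadj.reachable.trans (hs.reachable_port_center hident hbase hx hxz)⟩
    · refine ⟨x, hbase ▸ hx.ne', ?_⟩
      rw [show (⟨q, hq⟩ : ({z}ᶜ : Set _)) = ⟨port hx, h ▸ hq⟩ from Subtype.ext h]
      exact hs.reachable_port_center hident hbase hx _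
  · exact ⟨q.base, hbase, hs.reachable_center_of_base_ne hident hbase⟩

theorem reachable_center_center {z : SplitVertex G ident rep} {v w : ({z.base}ᶜ : Set V)}
    (p : (G.induce {z.base}ᶜ).Walk v w) :
    ((splitGraph G ident rep).induce {z}ᶜ).Reachable ⟨center v.1, ne_of_base_ne v.2⟩
      ⟨center w.1, ne_of_base_ne w.2⟩ := by
  induction p with
  | nil => exact SimpleGraph.Reachable.refl _
  | @cons a b _ hab _ ih =>
    have hG : G.Adj a.1 b.1 := hab
    have hport : ((splitGraph G ident rep).induce {z}ᶜ).Adj ⟨port hG, ne_of_base_ne a.2⟩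
        ⟨port hG.symm, ne_of_base_ne b.2⟩ := splitGraph_adj_port hG
    exact (hs.reachable_center_of_base_ne hident (q := port hG) a.2).symm.trans
      (hport.reachable.trans
        ((hs.reachable_center_of_base_ne hident (q := port hG.symm) b.2).trans ih))

end IsSplitting

end Split

section SplitNetwork

variable {V : Type} [Fintype V] {G : SimpleGraph V} {ident : V → ℕ} {rep : V → ℕ → ℕ}

theorem TwoVertexConnected.exists_ne_ne (hG : TwoVertexConnected G) (u v : V) :
    ∃ w, w ≠ u ∧ w ≠ v := by
  classical
  obtain ⟨w, hw⟩ := Finset.exists_mem_notMem_of_card_lt_card (s := {u, v}) (t := Finset.univ)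
    (by rw [Finset.card_univ]; have := Finset.card_le_two (a := u) (b := v); have := hG.1; omega)
  exact ⟨w, by simpa using hw⟩

theorem TwoVertexConnected.connected (hG : TwoVertexConnected G) : G.Connected := by
  have : Nonempty V := Fintype.card_pos_iff.1 (by have := hG.1; omega)
  refine ⟨fun u v => ?_⟩
  obtain ⟨w, hu, hv⟩ := hG.exists_ne_ne u v
  exact ((hG.2 w).preconnected ⟨u, hu.symm⟩ ⟨v, hv.symm⟩).map
    (SimpleGraph.Embedding.induce _).toHom

variable [Fintype (SplitVertex G ident rep)] (hs : IsSplitting G ident rep)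
include hs

theorem IsSplitting.twoVertexConnected (hident : Function.Injective ident)
    (hG : TwoVertexConnected G) : TwoVertexConnected (splitGraph G ident rep) := by
  refine ⟨hG.1.trans (Fintype.card_le_of_injective _ SplitVertex.center_injective), fun z => ?_⟩
  obtain ⟨v, hv, -⟩ := hG.exists_ne_ne z.base z.base
  have : Nonempty ({z}ᶜ : Set (SplitVertex G ident rep)) :=
    ⟨⟨SplitVertex.center v, SplitVertex.ne_of_base_ne hv⟩⟩
  refine ⟨fun p q => ?_⟩
  obtain ⟨v, hv, hpv⟩ := hs.exists_reachable_center hident p.2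
  obtain ⟨w, hw, hqw⟩ := hs.exists_reachable_center hident q.2
  obtain ⟨path⟩ := (hG.2 z.base).preconnected ⟨v, hv⟩ ⟨w, hw⟩
  exact hpv.trans ((hs.reachable_center_center hident path).trans hqw.symm)

theorem IsSplitting.isNetwork {n D Δ κ : ℕ} (hG : IsNetwork n D Δ κ G ident) :
    IsNetwork (n ^ 2) (3 * D + 2) Δ κ (splitGraph G ident rep)
      (splitIdent (n ^ κ) G ident rep) := by
  obtain ⟨hconn, hn, hD, hΔ, hident, hlt⟩ := hG
  refine ⟨hs.twoVertexConnected hident hconn, ?_,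
    (hs.diam_le hident hconn.connected).trans (by omega),
    fun q => (hs.ncard_neighborSet_le hident q).trans (hΔ _),
    hs.splitIdent_injective hident hlt, fun q => ?_⟩
  · calc _ ≤ Fintype.card (V × V) := Fintype.card_le_of_injective _ hs.toProd_injective
      _ ≤ n ^ 2 := by rw [Fintype.card_prod, sq]; exact Nat.mul_le_mul hn hn
  · have := hs.splitIdent_lt hlt q
    rwa [← pow_mul, Nat.mul_comm, pow_mul, sq]

end SplitNetwork

/-! ### Simulation of an algorithm on the split graph -/

section Simulation

open SplitVertex

theorem splitIdent_eq {V : Type*} {G : SimpleGraph V} {ident : V → ℕ} {rep : V → ℕ → ℕ} {N : ℕ}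
    {q : SplitVertex G ident rep} {y : ℕ}
    (hbase : y / N = ident q.base) (hname : y % N = q.name) : splitIdent N G ident rep q = y := by
  rw [splitIdent, ← hbase, ← hname, Nat.div_add_mod']

theorem IsSplitting.center_port_cases {V : Type*} {G : SimpleGraph V} {ident : V → ℕ}
    {rep : V → ℕ → ℕ} (hs : IsSplitting G ident rep)
    (hident : Function.Injective ident) {q q' : SplitVertex G ident rep}
    (h : (splitGraph G ident rep).Adj q q') :
    (∃ (u v : V) (huv : G.Adj u v), q = center u ∧ q' = port huv) ∨
    (∃ (u v : V) (huv : G.Adj u v), q = port huv ∧ q' = center u) ∨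
    (∃ (u v : V) (huv : G.Adj u v), q = port huv ∧ q' = port huv.symm) := by
  obtain hq | ⟨x, hx, hq⟩ := q.eq_center_or_port
  · rw [hq] at h
    obtain ⟨x, hx, hq'⟩ := hs.exists_eq_port_of_adj_center hident h
    exact Or.inl ⟨_, x, hx, hq, hq'⟩
  · rw [hq] at h
    obtain hq' | ⟨y, hy, hrep, hq'⟩ := hs.eq_center_or_port_of_adj_port hident h
    · exact Or.inr (Or.inl ⟨_, x, hx, hq, hq'⟩)
    · exact Or.inr (Or.inr ⟨_, y, hy, hq.trans (ext' rfl hrep.symm), hq'⟩)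

/-- What a node knows about its cluster in the split graph: its identifier, the identifiers of its
neighbours, the classes `rep` of its neighbours, and its own classes `repAt` at its neighbours. -/
structure ClusterInfo where
  id : ℕ
  nbrs : Finset ℕ
  rep : ℕ → ℕ
  repAt : ℕ → ℕ

/-- The adjacency of the member `a` of the cluster to the vertex with identifier `y`. -/
def ClusterInfo.Adj (N : ℕ) (k : ClusterInfo) (a y : ℕ) : Prop :=
  (y / N = k.id ∧ ((a = k.id ∧ ∃ x ∈ k.nbrs, k.rep x = y % N) ∨
    (y % N = k.id ∧ ∃ x ∈ k.nbrs, k.rep x = a))) ∨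
  (y / N ∈ k.nbrs ∧ k.rep (y / N) = a ∧ k.repAt (y / N) = y % N)

/-- The message that is sent over the edge to `x` when the members of the cluster prepare the
messages `outs`. -/
def ClusterInfo.message {Y : Type*} (N : ℕ) (k : ClusterInfo) (outs : ℕ → ℕ → Option Y) (x : ℕ) :
    Option Y := outs (k.rep x) (x * N + k.repAt x)

/-- The messages that the members of the cluster receive: those from the other members, which the
node itself knows, and those from other clusters, each of which arrives over its own edge. -/
noncomputable def ClusterInfo.received {Y : Type*} (N : ℕ) (k : ClusterInfo)
    (outs : ℕ → ℕ → Option Y) (m : ℕ → Option Y) (a y : ℕ) : Option Y :=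
  open Classical in
  if k.Adj N a y then if y / N = k.id then outs (y % N) (k.id * N + a) else m (y / N) else none

/-- The identifiers of the neighbours of the member `a` of the cluster. -/
noncomputable def ClusterInfo.neighbors (N : ℕ) (k : ClusterInfo) (a : ℕ) : Finset ℕ :=
  open Classical in (Finset.range (N * N)).filter (k.Adj N a)

variable {V : Type} [Fintype V] {G : SimpleGraph V} {ident : V → ℕ} {rep : V → ℕ → ℕ} {N : ℕ}
  {k : V → ClusterInfo}

/-- The nodes have the correct information about their clusters. -/
structure IsClusterInfo (G : SimpleGraph V) (ident : V → ℕ) (rep : V → ℕ → ℕ)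
    (k : V → ClusterInfo) : Prop where
  id_eq : ∀ u, (k u).id = ident u
  nbrs_eq : ∀ u, (k u).nbrs = neighborIdents G ident u
  rep_eq : ∀ u, (k u).rep = rep u
  repAt_eq : ∀ u v, G.Adj u v → (k u).repAt (ident v) = rep v (ident u)

theorem mem_neighborIdents {u : V} {x : ℕ} :
    x ∈ neighborIdents G ident u ↔ ∃ v, G.Adj u v ∧ ident v = x := by
  simp [neighborIdents]

namespace IsClusterInfo

variable (hk : IsClusterInfo G ident rep k)
include hk

theorem mem_nbrs {u : V} {x : ℕ} : x ∈ (k u).nbrs ↔ ∃ v, G.Adj u v ∧ ident v = x := by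
  rw [hk.nbrs_eq, mem_neighborIdents]

theorem exists_of_adj {u : V} {a y : ℕ} (h : (k u).Adj N a y) :
    ∃ q : SplitVertex G ident rep, q.base = u ∧ q.name = a := by
  have hport (x : ℕ) (hx : x ∈ (k u).nbrs) (hxa : (k u).rep x = a) :
      ∃ q : SplitVertex G ident rep, q.base = u ∧ q.name = a := by
    obtain ⟨v, hv, rfl⟩ := hk.mem_nbrs.1 hx
    exact ⟨port hv, rfl, by rwa [hk.rep_eq] at hxa⟩
  rcases h with ⟨-, ⟨h, -⟩ | ⟨-, x, hx, h⟩⟩ | ⟨hx, h, -⟩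
  · exact ⟨center u, rfl, by rw [h, hk.id_eq]; rfl⟩
  · exact hport x hx h
  · exact hport _ hx h

variable (hs : IsSplitting G ident rep) (hident : Function.Injective ident)
include hs hident

theorem exists_splitGraph_adj {q : SplitVertex G ident rep} {y : ℕ}
    (h : (k q.base).Adj N q.name y) :
    ∃ q', (splitGraph G ident rep).Adj q q' ∧ splitIdent N G ident rep q' = y := by
  simp only [ClusterInfo.Adj, hk.mem_nbrs, hk.id_eq, hk.rep_eq] at h
  rcases h with ⟨hbase, ⟨hcenter, _, ⟨v, hv, rfl⟩, hname⟩ | ⟨hcenter, _, ⟨v, hv, rfl⟩, hname⟩⟩ |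
    ⟨⟨v, hv, hbase⟩, hname, hname'⟩
  · have hq : q = center q.base := ext' rfl hcenter
    exact ⟨port hv, by have := hs.adj_center_port hident hv; rwa [← hq] at this,
      splitIdent_eq hbase hname.symm⟩
  · have hq : q = port hv := ext' rfl hname.symm
    exact ⟨center q.base, by have := (hs.adj_center_port hident hv).symm; rwa [← hq] at this,
      splitIdent_eq hbase hcenter⟩
  · rw [← hbase] at hname hname'
    rw [hk.repAt_eq _ _ hv] at hname'
    have hq : q = port hv := ext' rfl hname.symm
    exact ⟨port hv.symm, by
      have := splitGraph_adj_port (ident := ident) (rep := rep) hv; rwa [← hq] at this,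
      splitIdent_eq hbase.symm hname'.symm⟩

variable (hN : ∀ v, ident v < N)
include hN

theorem adj_of_splitGraph_adj {q q' : SplitVertex G ident rep}
    (h : (splitGraph G ident rep).Adj q q') :
    (k q.base).Adj N q.name (splitIdent N G ident rep q') := by
  simp only [ClusterInfo.Adj, hk.mem_nbrs, hk.id_eq, hk.rep_eq, hs.splitIdent_div hN,
    hs.splitIdent_mod hN]
  rcases hs.center_port_cases hident h with ⟨u, v, huv, rfl, rfl⟩ | ⟨u, v, huv, rfl, rfl⟩ |
    ⟨u, v, huv, rfl, rfl⟩
  · exact Or.inl ⟨rfl, Or.inl ⟨rfl, _, ⟨v, huv, rfl⟩, rfl⟩⟩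
  · exact Or.inl ⟨rfl, Or.inr ⟨rfl, _, ⟨v, huv, rfl⟩, rfl⟩⟩
  · exact Or.inr ⟨⟨v, huv, rfl⟩, rfl, hk.repAt_eq _ _ huv⟩

theorem adj_iff (q : SplitVertex G ident rep) (y : ℕ) : (k q.base).Adj N q.name y ↔
    ∃ q', (splitGraph G ident rep).Adj q q' ∧ splitIdent N G ident rep q' = y := by
  refine ⟨hk.exists_splitGraph_adj hs hident, ?_⟩
  rintro ⟨q', hq, rfl⟩
  exact hk.adj_of_splitGraph_adj hs hident hN hq

theorem received_eq {Y : Type*} (outs : V → ℕ → ℕ → Option Y) (q : SplitVertex G ident rep) :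
    (k q.base).received N (outs q.base)
      (received G ident (fun u => (k u).message N (outs u)) q.base) q.name =
    received (splitGraph G ident rep) (splitIdent N G ident rep)
      (fun q => outs q.base q.name) q := by
  funext y
  rw [ClusterInfo.received]
  split_ifs with hadj hbase
  · obtain ⟨q', hq, rfl⟩ := (hk.adj_iff hs hident hN q y).1 hadj
    rw [received_of_adj (hs.splitIdent_injective hident hN) _ hq, hs.splitIdent_mod hN]
    rw [hs.splitIdent_div hN, hk.id_eq] at hbase
    rw [hk.id_eq, hident hbase]
    rfl
  · obtain ⟨q', hq, rfl⟩ := (hk.adj_iff hs hident hN q y).1 hadj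
    rw [hs.splitIdent_div hN, hk.id_eq] at hbase
    obtain ⟨hG, hport, hport'⟩ := eq_port_of_adj hq fun h => hbase (by rw [h])
    have hname : rep q.base (ident q'.base) = q.name := (congrArg name hport).symm
    have hname' : rep q'.base (ident q.base) = q'.name := (congrArg name hport').symm
    rw [received_of_adj (hs.splitIdent_injective hident hN) _ hq, hs.splitIdent_div hN,
      received_of_adj hident _ hG, ClusterInfo.message, hk.rep_eq, hk.repAt_eq _ _ hG.symm,
      hname, hname']
    rfl
  · rw [received_eq_none]
    rwa [← hk.adj_iff hs hident hN]

theorem neighbors_eq [Fintype (SplitVertex G ident rep)] (q : SplitVertex G ident rep) :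
    (k q.base).neighbors N q.name =
      neighborIdents (splitGraph G ident rep) (splitIdent N G ident rep) q := by
  ext y
  rw [mem_neighborIdents, ← hk.adj_iff hs hident hN]
  simp only [ClusterInfo.neighbors, Finset.mem_filter]
  rw [and_iff_right_iff_imp, hk.adj_iff hs hident hN, Finset.mem_range]
  rintro ⟨q', -, rfl⟩
  exact hs.splitIdent_lt hN q'

end IsClusterInfo

variable {r M : ℕ} {Out : Type} (A : Algorithm r M Out)

/-- The initial states in the simulation of `A` on the split graph. -/
noncomputable def simInit (N : ℕ) (z : ClusterInfo × (Fin r → Fin N → A.Seed)) (a : ℕ) :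
    A.State × (ℕ → Option (Fin M)) :=
  (A.init (z.1.id * N + a) (z.1.neighbors N a), fun _ => none)

/-- The messages in the simulation of `A` on the split graph. -/
def simMsg (N : ℕ) (z : ClusterInfo × (Fin r → Fin N → A.Seed))
    (σ : ℕ → A.State × (ℕ → Option (Fin M))) : ℕ → Option (Fin M) :=
  z.1.message N (fun b => (σ b).2)

/-- One round in the simulation of `A` on the split graph. -/
noncomputable def simUpd (N : ℕ) [NeZero N] (i : ℕ) (z : ClusterInfo × (Fin r → Fin N → A.Seed))
    (σ : ℕ → A.State × (ℕ → Option (Fin M))) (m : ℕ → Option (Fin M)) (a : ℕ) :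
    A.State × (ℕ → Option (Fin M)) :=
  if h : i < r then A.step ⟨i, h⟩ (σ a).1 (z.1.received N (fun b => (σ b).2) m a)
    (z.2 ⟨i, h⟩ (Fin.ofNat N a)) else σ a

/-- States and prepared messages of all members of the clusters after `t` simulated rounds. -/
noncomputable def simConfig (N : ℕ) [NeZero N] {V : Type*} (G : SimpleGraph V) (ident : V → ℕ)
    (z : V → ClusterInfo × (Fin r → Fin N → A.Seed)) (t : ℕ) :
    V → ℕ → A.State × (ℕ → Option (Fin M)) :=
  iterate G ident z (simInit A N) (fun _ => simMsg A N) (simUpd A N) t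

/-- The outputs of all members of the clusters in the simulation of `A` on the split graph. -/
noncomputable def simOutput (N : ℕ) [NeZero N] {V : Type*} (G : SimpleGraph V) (ident : V → ℕ)
    (z : V → ClusterInfo × (Fin r → Fin N → A.Seed)) (v : V) (a : ℕ) : Out :=
  A.output (simConfig A N G ident z r v a).1

/-- The seeds of the vertices of the split graph in the simulation. -/
def splitSeed {V Ψ : Type*} (N : ℕ) [NeZero N] (G : SimpleGraph V) (ident : V → ℕ)
    (rep : V → ℕ → ℕ) (ψ : V → Fin r → Fin N → Ψ) (q : SplitVertex G ident rep) (i : Fin r) : Ψ :=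
  ψ q.base i (Fin.ofNat N q.name)

variable [NeZero N] [Fintype (SplitVertex G ident rep)] (hk : IsClusterInfo G ident rep k)
  (hs : IsSplitting G ident rep) (hident : Function.Injective ident) (hN : ∀ v, ident v < N)
include hk hs hident hN

theorem simConfig_eq (ψ : V → Fin r → Fin N → A.Seed) (t : ℕ) (q : SplitVertex G ident rep) :
    simConfig A N G ident (fun v => (k v, ψ v)) t q.base q.name =
      A.config (splitGraph G ident rep) (splitIdent N G ident rep)
        (splitSeed N G ident rep ψ) t q := by
  induction t generalizing q with
  | zero =>
    simp only [simConfig, iterate, simInit, Algorithm.config, hk.id_eq,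
      hk.neighbors_eq hs hident hN]
    rfl
  | succ t ih =>
    rw [Algorithm.config, simConfig, iterate]
    unfold simUpd
    dsimp only
    by_cases h : t < r
    · rw [dif_pos h, dif_pos h]
      congr 1
      · exact congrArg Prod.fst (ih q)
      · refine (hk.received_eq hs hident hN
          (fun u b => (simConfig A N G ident (fun v => (k v, ψ v)) t u b).2) q).trans ?_
        simp only [ih]
        rfl
    · rw [dif_neg h, dif_neg h]
      exact ih q

theorem simOutput_eq (ψ : V → Fin r → Fin N → A.Seed) (q : SplitVertex G ident rep) :
    simOutput A N G ident (fun v => (k v, ψ v)) q.base q.name =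
      A.result (splitGraph G ident rep) (splitIdent N G ident rep)
        (splitSeed N G ident rep ψ) q := by
  rw [simOutput, simConfig_eq A hk hs hident hN]
  rfl

end Simulation

/-! ### Tokens on cycles -/

section Token

open SplitVertex

/-- A token that travels along a cycle: the identifier of its origin and one further number. -/
abbrev Token (N : ℕ) : Type := Fin N × Fin N

/-- The position of `l` in `S`, counted from `0`. -/
def slot (S : Finset ℕ) (l : ℕ) : ℕ := (S.filter (· < l)).card

theorem slot_lt_card {S : Finset ℕ} {l : ℕ} (h : l ∈ S) : slot S l < S.card :=
  Finset.card_lt_card (Finset.filter_ssubset.2 ⟨l, h, lt_irrefl l⟩)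

theorem slot_strictMono {S : Finset ℕ} {l l' : ℕ} (h : l ∈ S) (hl : l < l') :
    slot S l < slot S l' := by
  refine Finset.card_lt_card ?_
  rw [Finset.ssubset_iff_of_subset]
  · exact ⟨l, by simp [h, hl], by simp⟩
  · intro x hx
    rw [Finset.mem_filter] at hx ⊢
    exact ⟨hx.1, hx.2.trans hl⟩

theorem eq_of_slot_eq {S : Finset ℕ} {l l' : ℕ} (h : l ∈ S) (h' : l' ∈ S)
    (hslot : slot S l = slot S l') : l = l' := by
  rcases lt_trichotomy l l' with hl | hl | hl
  · exact absurd hslot (slot_strictMono h hl).ne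
  · exact hl
  · exact absurd hslot (slot_strictMono h' hl).ne'

/-- Arrange values that are indexed by the labels in `S` as a vector. -/
noncomputable def pack {Y : Type*} (c : ℕ) (S : Finset ℕ) (f : ℕ → Option Y) : Fin c → Option Y :=
  open Classical in fun j => if h : ∃ l ∈ S, slot S l = j then f h.choose else none

/-- Recover the values that are indexed by the labels in `S` from a vector. -/
def unpack {Y : Type*} (c : ℕ) (S : Finset ℕ) (g : Fin c → Option Y) (l : ℕ) : Option Y :=
  if h : l ∈ S ∧ slot S l < c then g ⟨slot S l, h.2⟩ else none

theorem unpack_pack {Y : Type*} {c : ℕ} {S : Finset ℕ} (f : ℕ → Option Y) (hS : S.card ≤ c)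
    {l : ℕ} (hl : l ∈ S) : unpack c S (pack c S f) l = f l := by
  have hlt : slot S l < c := (slot_lt_card hl).trans_le hS
  have hex : ∃ l' ∈ S, slot S l' = slot S l := ⟨l, hl, rfl⟩
  simp only [unpack, hl, hlt, and_self, dif_pos, pack, hex]
  congr 1
  exact eq_of_slot_eq hex.choose_spec.1 hl hex.choose_spec.2

theorem mem_of_unpack {Y : Type*} {c : ℕ} {S : Finset ℕ} {g : Fin c → Option Y} {l : ℕ} {y : Y}
    (h : unpack c S g l = some y) : l ∈ S := by
  by_contra hl
  simp [unpack, hl] at h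

/-- What a node knows before the tokens are sent: its cluster, the labels of the cycles through the
edges at the members of its cluster, and the tokens that it emits. -/
structure TokenEnv (N : ℕ) where
  info : ClusterInfo
  labels : ℕ → ℕ → Finset ℕ
  emit : ℕ → ℕ → ℕ → Option (Token N)

/-- The tokens that the members of a cluster send next, indexed by the member, the identifier of
its neighbour and the label of the cycle, and the tokens received in every step so far. -/
abbrev TokenState (N : ℕ) : Type :=
  (ℕ → ℕ → ℕ → Option (Token N)) × (ℕ → ℕ → ℕ → ℕ → Option (Token N))

variable {N c : ℕ}

/-- The messages of the members of the cluster: one possible token for each label of an edge. -/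
noncomputable def tokenOuts (c : ℕ) (z : TokenEnv N) (σ : TokenState N) (a y : ℕ) :
    Option (Fin c → Option (Token N)) := some (pack c (z.labels a y) (σ.1 a y))

/-- The tokens received by the members of the cluster. -/
noncomputable def tokenRecv (c : ℕ) (z : TokenEnv N) (σ : TokenState N)
    (m : ℕ → Option (Fin c → Option (Token N))) (a y l : ℕ) : Option (Token N) :=
  (z.info.received N (tokenOuts c z σ) m a y).bind fun g => unpack c (z.labels a y) g l

/-- The state before the first step. -/
def tokenInit (z : TokenEnv N) : TokenState N := (z.emit, fun _ _ _ _ => none)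

/-- The messages that a node sends on behalf of its cluster. -/
noncomputable def tokenMsg (c : ℕ) (z : TokenEnv N) (σ : TokenState N) :
    ℕ → Option (Fin c → Option (Token N)) := z.info.message N (tokenOuts c z σ)

/-- One step of the cluster: a token that does not come from the node itself is forwarded along the
other edge with the same label. -/
noncomputable def tokenUpd (c i : ℕ) (z : TokenEnv N) (σ : TokenState N)
    (m : ℕ → Option (Fin c → Option (Token N))) : TokenState N :=
  open Classical in
  (fun a y l => if h : ∃ x, x ≠ y ∧ z.info.Adj N a x ∧ l ∈ z.labels a x then
      (tokenRecv c z σ m a h.choose l).filter (fun τ => (τ.1 : ℕ) ≠ z.info.id)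
    else none,
    Function.update σ.2 i (tokenRecv c z σ m))

/-- The states of the nodes after `s` steps. -/
noncomputable def tokenRun {V : Type*} (c : ℕ) (G : SimpleGraph V) (ident : V → ℕ)
    (z : V → TokenEnv N) (s : ℕ) (v : V) : TokenState N :=
  iterate G ident z tokenInit (fun _ => tokenMsg c) (tokenUpd c) s v

/-- The tokens that `v` receives in step `s`. -/
noncomputable def tokenAt {V : Type*} (c : ℕ) (G : SimpleGraph V) (ident : V → ℕ)
    (z : V → TokenEnv N) (s : ℕ) (v : V) : ℕ → ℕ → ℕ → Option (Token N) :=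
  tokenRecv c (z v) (tokenRun c G ident z s v)
    (received G ident (fun u => tokenMsg c (z u) (tokenRun c G ident z s u)) v)

theorem tokenRun_history {V : Type*} {G : SimpleGraph V} {ident : V → ℕ}
    {z : V → TokenEnv N} {s R : ℕ} (h : s < R) (v : V) :
    (tokenRun c G ident z R v).2 s = tokenAt c G ident z s v := by
  induction R with
  | zero => omega
  | succ R ih =>
    change Function.update (tokenRun c G ident z R v).2 R (tokenAt c G ident z R v) s = _
    rcases Nat.lt_succ_iff_lt_or_eq.1 h with hs | rfl
    · rw [Function.update_of_ne hs.ne, ih hs]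
    · rw [Function.update_self]

variable {V : Type} {G : SimpleGraph V} {ident : V → ℕ} {rep : V → ℕ → ℕ}

/-- The labels known to the nodes are those of the cycles of a cover of the split graph. -/
structure IsCoverInfo [Fintype V] (G : SimpleGraph V) (ident : V → ℕ) (rep : V → ℕ → ℕ)
    (d c : ℕ) (I : Finset ℕ) (C : ℕ → Set (Sym2 (SplitVertex G ident rep)))
    (z : V → TokenEnv N) : Prop where
  isSplitting : IsSplitting G ident rep
  ident_injective : Function.Injective ident
  ident_lt : ∀ v, ident v < N
  info : IsClusterInfo G ident rep (fun v => (z v).info)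
  cover : IsCycleCover (splitGraph G ident rep) d c I C
  mem_labels : ∀ q q', (splitGraph G ident rep).Adj q q' → ∀ l,
    l ∈ (z q.base).labels q.name (splitIdent N G ident rep q') ↔ l ∈ I ∧ s(q, q') ∈ C l

namespace IsCoverInfo

variable [Fintype V] {d : ℕ} {I : Finset ℕ} {C : ℕ → Set (Sym2 (SplitVertex G ident rep))}
  {z : V → TokenEnv N}

theorem labels_symm (h : IsCoverInfo G ident rep d c I C z) {q q' : SplitVertex G ident rep}
    (hq : (splitGraph G ident rep).Adj q q') :
    (z q.base).labels q.name (splitIdent N G ident rep q') =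
      (z q'.base).labels q'.name (splitIdent N G ident rep q) := by
  ext l
  rw [h.mem_labels _ _ hq, h.mem_labels _ _ hq.symm, Sym2.eq_swap]

theorem card_labels_le (h : IsCoverInfo G ident rep d c I C z) {q q' : SplitVertex G ident rep}
    (hq : (splitGraph G ident rep).Adj q q') :
    ((z q.base).labels q.name (splitIdent N G ident rep q')).card ≤ c := by
  rw [← Set.ncard_coe_finset]
  convert (h.cover.2 s(q, q') hq).2 using 2
  ext l
  simp [h.mem_labels _ _ hq]

theorem tokenAt_eq (h : IsCoverInfo G ident rep d c I C z) {q q' : SplitVertex G ident rep}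
    (hq : (splitGraph G ident rep).Adj q q') {l : ℕ} (hl : l ∈ I) (hC : s(q, q') ∈ C l) (s : ℕ) :
    tokenAt c G ident z s q.base q.name (splitIdent N G ident rep q') l =
      (tokenRun c G ident z s q'.base).1 q'.name (splitIdent N G ident rep q) l := by
  have hreceived := congrFun (h.info.received_eq h.isSplitting h.ident_injective h.ident_lt
    (fun u => tokenOuts c (z u) (tokenRun c G ident z s u)) q) (splitIdent N G ident rep q')
  rw [received_of_adj (h.isSplitting.splitIdent_injective h.ident_injective h.ident_lt) _ hq]
    at hreceived
  unfold tokenAt tokenRecv tokenMsg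
  rw [hreceived, tokenOuts, Option.bind_some, h.labels_symm hq]
  refine unpack_pack _ (h.card_labels_le hq.symm) ?_
  rw [h.mem_labels _ _ hq.symm, Sym2.eq_swap]
  exact ⟨hl, hC⟩

theorem exists_of_tokenAt (h : IsCoverInfo G ident rep d c I C z) {s : ℕ} {v : V} {a y l : ℕ}
    {τ : Token N} (hτ : tokenAt c G ident z s v a y l = some τ) :
    l ∈ I ∧ ∃ q q', (splitGraph G ident rep).Adj q q' ∧ s(q, q') ∈ C l ∧ q.base = v ∧
      q.name = a ∧ splitIdent N G ident rep q' = y := by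
  unfold tokenAt tokenRecv at hτ
  obtain ⟨g, hg, hu⟩ := Option.bind_eq_some_iff.1 hτ
  have hadj : (z v).info.Adj N a y := by
    by_contra hn
    simp [ClusterInfo.received, hn] at hg
  obtain ⟨q, rfl, rfl⟩ := h.info.exists_of_adj hadj
  obtain ⟨q', hq', rfl⟩ := (h.info.adj_iff h.isSplitting h.ident_injective h.ident_lt q y).1 hadj
  have := (h.mem_labels _ _ hq' _).1 (mem_of_unpack hu)
  exact ⟨this.1, q, q', hq', this.2, rfl, rfl, rfl⟩

/-- On a cycle, the only edge besides the one ahead with the same label is the one behind. -/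
theorem eq_splitIdent_iff (h : IsCoverInfo G ident rep d c I C z) {l m : ℕ} (hl : l ∈ I)
    {p : ℤ → SplitVertex G ident rep} (hp : IsCycleParam (splitGraph G ident rep) (C l) m p)
    (i : ℤ) (x : ℕ) :
    x ≠ splitIdent N G ident rep (p (i + 1 + 1)) ∧
        (z (p (i + 1)).base).info.Adj N (p (i + 1)).name x ∧
        l ∈ (z (p (i + 1)).base).labels (p (i + 1)).name x ↔
      x = splitIdent N G ident rep (p i) := by
  have hinj := h.isSplitting.splitIdent_injective h.ident_injective h.ident_lt
  rw [h.info.adj_iff h.isSplitting h.ident_injective h.ident_lt]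
  constructor
  · rintro ⟨hne, ⟨q', hq', rfl⟩, hlabel⟩
    have hC := ((h.mem_labels _ _ hq' l).1 hlabel).2
    rw [hp.mk_mem_iff, add_sub_cancel_right] at hC
    rcases hC with rfl | rfl
    · exact absurd rfl hne
    · rfl
  · rintro rfl
    have hback := (hp.adj i).symm
    refine ⟨fun heq => ?_, ⟨_, hback, rfl⟩, (h.mem_labels _ _ hback l).2 ⟨hl, ?_⟩⟩
    · have hne := hp.add_one_ne_sub_one (i + 1)
      rw [add_sub_cancel_right] at hne
      exact hne (hinj heq).symm
    · rw [Sym2.eq_swap]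
      exact hp.mem i

theorem tokenRun_succ (h : IsCoverInfo G ident rep d c I C z) {l m : ℕ} (hl : l ∈ I)
    {p : ℤ → SplitVertex G ident rep} (hp : IsCycleParam (splitGraph G ident rep) (C l) m p)
    (i : ℤ) (s : ℕ) :
    (tokenRun c G ident z (s + 1) (p (i + 1)).base).1 (p (i + 1)).name
        (splitIdent N G ident rep (p (i + 1 + 1))) l =
      ((tokenRun c G ident z s (p i).base).1 (p i).name
        (splitIdent N G ident rep (p (i + 1))) l).filter
          (fun τ => (τ.1 : ℕ) ≠ ident (p (i + 1)).base) := by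
  have hC : s(p (i + 1), p i) ∈ C l := by rw [Sym2.eq_swap]; exact hp.mem i
  have hbehind := h.eq_splitIdent_iff hl hp i
  have hex := (exists_congr hbehind).2 ⟨_, rfl⟩
  rw [← h.tokenAt_eq (hp.adj i).symm hl hC, ← (hbehind _).1 hex.choose_spec, ← h.info.id_eq]
  exact dif_pos hex

theorem tokenRun_eq_some (h : IsCoverInfo G ident rep d c I C z) {l m : ℕ} (hl : l ∈ I)
    {p : ℤ → SplitVertex G ident rep} (hp : IsCycleParam (splitGraph G ident rep) (C l) m p)
    (τ : Token N) (s : ℕ) :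
    (tokenRun c G ident z s (p s).base).1 (p s).name (splitIdent N G ident rep (p (s + 1))) l =
      some τ ↔ (z (p 0).base).emit (p 0).name (splitIdent N G ident rep (p 1)) l = some τ ∧
        ∀ i : ℕ, 1 ≤ i → i ≤ s → ident (p i).base ≠ τ.1 := by
  induction s with
  | zero =>
    have hvacuous : ∀ i : ℕ, 1 ≤ i → i ≤ 0 → ident (p i).base ≠ τ.1 := by omega
    exact Iff.trans Iff.rfl (and_iff_left hvacuous).symm
  | succ s ih =>
    push_cast
    rw [h.tokenRun_succ hl hp, Option.filter_eq_some_iff, ih, and_assoc]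
    refine and_congr_right fun _ => ?_
    simp only [decide_eq_true_eq]
    constructor
    · rintro ⟨hbefore, hlast⟩ i hi hi'
      rcases Nat.lt_succ_iff_lt_or_eq.1 (Nat.lt_succ_of_le hi') with hlt | rfl
      · exact hbefore i hi (by omega)
      · push_cast
        exact hlast.symm
    · intro hall
      refine ⟨fun i hi hi' => hall i hi (by omega), ?_⟩
      have hlast := hall (s + 1) (by omega) le_rfl
      push_cast at hlast
      exact hlast.symm

theorem tokenAt_eq_some_of_isCycleParam (h : IsCoverInfo G ident rep d c I C z) {l m : ℕ}
    (hl : l ∈ I) {p : ℤ → SplitVertex G ident rep}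
    (hp : IsCycleParam (splitGraph G ident rep) (C l) m p)
    {τ : Token N} {s : ℕ}
    (hemit : (z (p 0).base).emit (p 0).name (splitIdent N G ident rep (p 1)) l = some τ)
    (hne : ∀ i : ℕ, 1 ≤ i → i ≤ s → ident (p i).base ≠ τ.1) :
    tokenAt c G ident z s (p (s + 1)).base (p (s + 1)).name
      (splitIdent N G ident rep (p s)) l = some τ := by
  rw [h.tokenAt_eq (hp.adj s).symm hl (by rw [Sym2.eq_swap]; exact hp.mem s)]
  exact (h.tokenRun_eq_some hl hp τ s).2 ⟨hemit, hne⟩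

theorem exists_isCycleParam_of_tokenAt (h : IsCoverInfo G ident rep d c I C z) {s : ℕ} {v : V}
    {a y l : ℕ} {τ : Token N} (hτ : tokenAt c G ident z s v a y l = some τ) :
    l ∈ I ∧ ∃ m ≤ d, ∃ p, IsCycleParam (splitGraph G ident rep) (C l) m p ∧
      (p (s + 1)).base = v ∧ splitIdent N G ident rep (p s) = y ∧
      (z (p 0).base).emit (p 0).name (splitIdent N G ident rep (p 1)) l = some τ ∧
      ∀ i : ℕ, 1 ≤ i → i ≤ s → ident (p i).base ≠ τ.1 := by
  obtain ⟨hl, q, q', -, hC, rfl, rfl, rfl⟩ := h.exists_of_tokenAt hτ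
  obtain ⟨m, hm, p₀, hp₀⟩ := h.cover.exists_isCycleParam hl
  rw [Sym2.eq_swap] at hC
  obtain ⟨p₁, hp₁, hzero, hone⟩ := hp₀.exists_of_mem hC
  have hp := hp₁.shift (-s)
  have hq' : p₁ (s + -s) = q' := by rw [← hzero]; congr 1; ring
  have hq : p₁ (s + 1 + -s) = q := by rw [← hone]; congr 1; ring
  refine ⟨hl, m, hm, _, hp, congrArg base hq, congrArg _ hq', ?_⟩
  have hrun := h.tokenRun_eq_some hl hp τ s
  rw [← h.tokenAt_eq (hp.adj s).symm hl (by rw [Sym2.eq_swap]; exact hp.mem s), hq', hq] at hrun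
  exact hrun.1 hτ

end IsCoverInfo

end Token

/-! ### Links between classes -/

section Link

open SplitVertex

variable {V : Type*} {G : SimpleGraph V} {ident : V → ℕ} {rep : V → ℕ → ℕ} {N c d : ℕ}

/-- The vertices `p 0, …, p (s + 1)` of a parametrized cycle of the split graph: from the exit from
the cluster of `u` up to the first return to it. -/
structure IsSegment (G : SimpleGraph V) (ident : V → ℕ) (rep : V → ℕ → ℕ)
    (C : Set (Sym2 (SplitVertex G ident rep))) (d : ℕ) (u : V) (s : ℕ)
    (p : ℤ → SplitVertex G ident rep) : Prop where
  param : ∃ m ≤ d, IsCycleParam (splitGraph G ident rep) C m p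
  base_zero : (p 0).base = u
  one_le : 1 ≤ s
  base_last : (p (s + 1)).base = u
  base_ne : ∀ i : ℕ, 1 ≤ i → i ≤ s → (p i).base ≠ u

namespace IsSegment

variable {C : Set (Sym2 (SplitVertex G ident rep))} {u : V} {s : ℕ}
  {p : ℤ → SplitVertex G ident rep}

theorem lt (h : IsSegment G ident rep C d u s p) : s < d := by
  obtain ⟨m, hm, hp⟩ := h.param
  by_contra hs
  have hm3 := hp.three_le
  refine h.base_ne m (by omega) (by omega) ?_
  rw [hp.apply_period, h.base_zero]

theorem reverse (h : IsSegment G ident rep C d u s p) :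
    IsSegment G ident rep C d u s (fun i => p (s + 1 - i)) where
  param := by
    obtain ⟨m, hm, hp⟩ := h.param
    refine ⟨m, hm, ?_⟩
    convert hp.reverse.shift (-(s + 1)) using 2 with i
    congr 1
    ring
  base_zero := by rw [sub_zero]; exact h.base_last
  one_le := h.one_le
  base_last := by rw [sub_self]; exact h.base_zero
  base_ne i hi hi' := by
    have := h.base_ne (s + 1 - i) (by omega) (by omega)
    rwa [show (((s + 1 - i : ℕ)) : ℤ) = s + 1 - i by omega] at this

theorem adj_first (h : IsSegment G ident rep C d u s p) :
    ∃ hG : G.Adj u (p 1).base, p 0 = port hG ∧ p 1 = port hG.symm := by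
  obtain ⟨m, -, hp⟩ := h.param
  obtain ⟨⟩ := h.base_zero
  exact eq_port_of_adj (hp.adj 0) (h.base_ne 1 le_rfl h.one_le).symm

theorem adj_last (h : IsSegment G ident rep C d u s p) :
    ∃ hG : G.Adj u (p s).base, p (s + 1) = port hG ∧ p s = port hG.symm := by
  simpa using h.reverse.adj_first

end IsSegment

/-- The emission of tokens by which the links are found: on every edge that leaves the cluster, a
token with the identifiers of the two ends of that edge. -/
def linkEmit (N : ℕ) [NeZero N] (k : ClusterInfo) (_a y _l : ℕ) : Option (Token N) :=
  if y / N = k.id then none else some (Fin.ofNat N k.id, Fin.ofNat N (y / N))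

/-- According to the record `hist` of the received tokens, a token of the node with identifier `id`
that left towards `b` on the cycle `l` has come back from `a`. -/
def IsDetectedLink (N d id : ℕ) (hist : ℕ → ℕ → ℕ → ℕ → Option (Token N)) (l b a : ℕ) : Prop :=
  ∃ s < d, ∃ x y, ∃ τ : Token N,
    hist s x y l = some τ ∧ (τ.1 : ℕ) = id ∧ (τ.2 : ℕ) = b ∧ y / N = a

namespace IsCoverInfo

variable {V : Type} [Fintype V] {G : SimpleGraph V} {ident : V → ℕ} {rep : V → ℕ → ℕ}
  {I : Finset ℕ} {C : ℕ → Set (Sym2 (SplitVertex G ident rep))}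
  {z : V → TokenEnv N}

theorem emit_splitIdent [NeZero N] (h : IsCoverInfo G ident rep d c I C z)
    (hz : ∀ v, (z v).emit = linkEmit N (z v).info) (v : V) (a l : ℕ)
    (q : SplitVertex G ident rep) {τ : Token N} :
    (z v).emit a (splitIdent N G ident rep q) l = some τ ↔
      q.base ≠ v ∧ (τ.1 : ℕ) = ident v ∧ (τ.2 : ℕ) = ident q.base := by
  have hval (w : V) : ((Fin.ofNat N (ident w) : Fin N) : ℕ) = ident w :=
    Nat.mod_eq_of_lt (h.ident_lt w)
  rw [hz, linkEmit, h.isSplitting.splitIdent_div h.ident_lt, h.info.id_eq]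
  split_ifs with hv
  · simp [h.ident_injective hv]
  · rw [Option.some_inj, Prod.ext_iff, Fin.ext_iff, Fin.ext_iff, hval, hval, eq_comm,
      eq_comm (b := ident q.base)]
    exact (and_iff_right fun hv' => hv (congrArg ident hv')).symm

theorem isDetectedLink_iff [NeZero N] (h : IsCoverInfo G ident rep d c I C z)
    (hz : ∀ v, (z v).emit = linkEmit N (z v).info) (u : V) (l b a : ℕ) :
    IsDetectedLink N d (ident u) (tokenRun c G ident z d u).2 l b a ↔
      l ∈ I ∧ ∃ s p, IsSegment G ident rep (C l) d u s p ∧ ident (p 1).base = b ∧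
        ident (p s).base = a := by
  have hdiv := h.isSplitting.splitIdent_div h.ident_lt
  constructor
  · rintro ⟨s, hs, x, y, τ, hτ, horigin, rfl, rfl⟩
    rw [tokenRun_history hs] at hτ
    obtain ⟨hl, m, hm, p, hp, hlast, rfl, hemit, hne⟩ := h.exists_isCycleParam_of_tokenAt hτ
    obtain ⟨hfirst, hzero, hone⟩ := (h.emit_splitIdent hz _ _ _ _).1 hemit
    have hu : (p 0).base = u := h.ident_injective (hzero.symm.trans horigin)
    rw [hu] at hfirst
    have hpos : 1 ≤ s := by
      rw [Nat.one_le_iff_ne_zero]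
      rintro rfl
      exact hfirst hlast
    exact ⟨hl, s, p, ⟨⟨m, hm, hp⟩, hu, hpos, hlast,
      fun i hi his hiu => hne i hi his (by rw [hiu, horigin])⟩, hone.symm, (hdiv _).symm⟩
  · rintro ⟨hl, s, p, hseg, rfl, rfl⟩
    obtain ⟨m, -, hp⟩ := hseg.param
    let τ : Token N := (⟨ident u, h.ident_lt u⟩, ⟨ident (p 1).base, h.ident_lt _⟩)
    refine ⟨s, hseg.lt, (p (s + 1)).name, splitIdent N G ident rep (p s), τ, ?_, rfl, rfl, hdiv _⟩
    rw [tokenRun_history hseg.lt]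
    conv_lhs => rw [← hseg.base_last]
    refine h.tokenAt_eq_some_of_isCycleParam hl hp ((h.emit_splitIdent hz _ _ _ _).2 ?_) ?_
    · rw [hseg.base_zero]
      exact ⟨hseg.base_ne 1 le_rfl hseg.one_le, rfl, rfl⟩
    · exact fun i hi his hiu => hseg.base_ne i hi his (h.ident_injective hiu)

end IsCoverInfo

section FirstReturn

variable {C : Set (Sym2 (SplitVertex G ident rep))} {p : ℤ → SplitVertex G ident rep} {m : ℕ}
  (hs : IsSplitting G ident rep) (hident : Function.Injective ident)
  (hp : IsCycleParam (splitGraph G ident rep) C m p)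
include hs hident hp

theorem IsCycleParam.base_two_ne {u v : V} {huv : G.Adj u v} (hzero : p 0 = center u)
    (hone : p 1 = port huv) : (p 2).base ≠ u := by
  intro hbase
  have hadj := hp.adj 1
  rw [show (1 : ℤ) + 1 = 2 by norm_num, hone] at hadj
  obtain htwo | ⟨y, hy, -, htwo⟩ := hs.eq_center_or_port_of_adj_port hident hadj
  · rw [← hzero, hp.eq_iff] at htwo
    have hm := hp.three_le
    have := Int.le_of_dvd (by norm_num) htwo
    omega
  · rw [htwo] at hbase
    exact hy.ne' hbase

theorem IsCycleParam.exists_first_return {u v : V} {huv : G.Adj u v} (hzero : p 0 = center u)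
    (hone : p 1 = port huv) : ∃ s : ℕ, 1 ≤ s ∧ s + 2 ≤ m ∧ (p (s + 2 : ℕ)).base = u ∧
      ∀ j : ℕ, 2 ≤ j → j < s + 2 → (p j).base ≠ u := by
  classical
  have hm := hp.three_le
  have hreturn : 2 ≤ m ∧ (p m).base = u := ⟨by omega, by rw [hp.apply_period, hzero]; rfl⟩
  have hex : ∃ i : ℕ, 2 ≤ i ∧ (p i).base = u := ⟨m, hreturn⟩
  obtain ⟨htwo, hbase⟩ := Nat.find_spec hex
  have hmin (j : ℕ) (hj : 2 ≤ j) (hlt : j < Nat.find hex) : (p j).base ≠ u :=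
    fun hju => Nat.find_min hex hlt ⟨hj, hju⟩
  have hle : Nat.find hex ≤ m := Nat.find_min' hex hreturn
  obtain ⟨s, hs'⟩ := Nat.exists_eq_add_of_le' htwo
  rw [hs'] at hbase hmin hle
  refine ⟨s, Nat.one_le_iff_ne_zero.2 ?_, hle, hbase, hmin⟩
  rintro rfl
  exact hp.base_two_ne hs hident hzero hone hbase

/-- A cycle cannot come back to the cluster of `u` at the port by which it left: the center of `u`
is the predecessor of that port on the cycle, and it would have to be passed a second time. -/
theorem IsCycleParam.exists_isSegment {u v : V} {huv : G.Adj u v} (hm : m ≤ d)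
    (hzero : p 0 = center u) (hone : p 1 = port huv) : ∃ s p',
      IsSegment G ident rep C d u s p' ∧ rep u (ident (p' 1).base) = rep u (ident v) ∧
        rep u (ident (p' s).base) ≠ rep u (ident v) := by
  obtain ⟨s, hpos, hsm, hlast, hne⟩ := hp.exists_first_return hs hident hzero hone
  have hcast : ((s : ℕ) : ℤ) + 1 + 1 = (s + 2 : ℕ) := by push_cast; ring
  have hseg : IsSegment G ident rep C d u s (fun j => p (j + 1)) := by
    refine ⟨⟨m, hm, hp.shift 1⟩, ?_, hpos, by rw [hcast]; exact hlast, fun i hi his => ?_⟩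
    · rw [zero_add, hone]
      rfl
    · exact_mod_cast hne (i + 1) (by omega) (by omega)
  refine ⟨s, _, hseg, ?_, fun hrep => ?_⟩
  · obtain ⟨hG, hfirst, -⟩ := hseg.adj_first
    rw [zero_add, hone] at hfirst
    exact (congrArg name hfirst).symm
  · obtain ⟨hG, hport, -⟩ := hseg.adj_last
    rw [hcast] at hport
    have heq : p (s + 2 : ℕ) = p 1 := by
      rw [hone]
      exact ext' hlast ((congrArg name hport).trans hrep)
    have hmod := (hp.eq_iff _ _).1 heq
    rcases hsm.lt_or_eq with hlt | hsm
    · have := Int.le_of_dvd (by omega) hmod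
      omega
    · rw [hsm, hp.apply_period, hp.eq_iff, zero_sub, dvd_neg] at heq
      have := Int.le_of_dvd (by norm_num) heq
      omega

end FirstReturn

theorem IsCoverInfo.exists_segment {V : Type} [Fintype V] {G : SimpleGraph V} {ident : V → ℕ}
    {rep : V → ℕ → ℕ} {I : Finset ℕ}
    {C : ℕ → Set (Sym2 (SplitVertex G ident rep))} {z : V → TokenEnv N}
    (h : IsCoverInfo G ident rep d c I C z) {u v : V} (huv : G.Adj u v) :
    ∃ l ∈ I, ∃ s p, IsSegment G ident rep (C l) d u s p ∧
      rep u (ident (p 1).base) = rep u (ident v) ∧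
      rep u (ident (p s).base) ≠ rep u (ident v) := by
  obtain ⟨l, hl, hC⟩ := h.cover.exists_mem_of_mem_edgeSet (e := s(center u, port huv))
    (h.isSplitting.adj_center_port h.ident_injective huv)
  obtain ⟨m, hm, p₀, hp₀⟩ := h.cover.exists_isCycleParam hl
  obtain ⟨p, hp, hzero, hone⟩ := hp₀.exists_of_mem hC
  exact ⟨l, hl, hp.exists_isSegment h.isSplitting h.ident_injective hm hzero hone⟩

end Link

/-! ### Trees from token routes -/

section VisitPlan

variable {V : Type*} {G : SimpleGraph V} {u ρ : V} {B : ℕ} {Visit : V → ℕ → V → Prop}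

/-- Visits `Visit w k y` of the vertices `w` from `y` at the times `k` such that the first visits
define a tree with root `ρ` that avoids `u`. -/
structure IsVisitPlan (G : SimpleGraph V) (u ρ : V) (B : ℕ) (Visit : V → ℕ → V → Prop) : Prop where
  root_ne : ρ ≠ u
  root : Visit ρ 0 u
  earlier : ∀ w k y, Visit w k y → w ≠ u → y ≠ u → ∃ k' < k, ∃ y', Visit y k' y'
  start : ∀ w k, Visit w k u → w ≠ u → w = ρ ∨ ∃ k' < k, ∃ y', Visit w k' y'
  adj : ∀ w k y, Visit w k y → w ≠ u → y ≠ u → y ≠ w → G.Adj w y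
  unique : ∀ w w' k y y', Visit w k y → Visit w' k y' → w = w'
  lt : ∀ w k y, Visit w k y → k < B

/-- The vertices other than `u` that are visited. -/
def covered (u : V) (Visit : V → ℕ → V → Prop) : Set V := {w | w ≠ u ∧ ∃ k y, Visit w k y}

/-- No visit of `w` precedes its visit from `y` at time `k`. -/
structure IsFirstVisit (Visit : V → ℕ → V → Prop) (w : V) (k : ℕ) (y : V) : Prop where
  visit : Visit w k y
  le : ∀ k' y', Visit w k' y' → k ≤ k'

/-- Every visited vertex outputs the name of a vertex from which it was first visited, unless this
is `u`. -/
structure IsVisitOutput {α : Type*} (u : V) (Visit : V → ℕ → V → Prop) (name : V → α)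
    (out : V → Option α) : Prop where
  eq_none : ∀ w ∉ covered u Visit, out w = none
  exists_isFirstVisit : ∀ w ∈ covered u Visit, ∃ k y, IsFirstVisit Visit w k y ∧
    (y = u → out w = none) ∧ (y ≠ u → out w = some (name y))

namespace IsVisitPlan

variable (h : IsVisitPlan G u ρ B Visit) {key : V → ℕ} {par : V → V}
  (hfirst : ∀ w ∈ covered u Visit, IsFirstVisit Visit w (key w) (par w))
include h

theorem root_mem_covered : ρ ∈ covered u Visit := ⟨h.root_ne, 0, u, h.root⟩

include hfirst

theorem par_root : par ρ = u := by
  by_contra hne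
  have hρ := hfirst ρ h.root_mem_covered
  obtain ⟨k, hk, -⟩ := h.earlier ρ _ _ hρ.visit h.root_ne hne
  exact absurd (hρ.le 0 u h.root) (by omega)

theorem par_ne {w : V} (hw : w ∈ covered u Visit) (hne : w ≠ ρ) : par w ≠ u := by
  intro hu
  have hvisit := (hfirst w hw).visit
  rw [hu] at hvisit
  obtain hρ | ⟨k, hk, y, hy⟩ := h.start w _ hvisit hw.1
  · exact hne hρ
  · exact absurd ((hfirst w hw).le _ _ hy) (by omega)

theorem isParentMap : IsParentMap G (covered u Visit) ρ par key := by
  have hpar (w : V) (hw : w ∈ covered u Visit) (hne : w ≠ ρ) :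
      par w ∈ covered u Visit ∧ key (par w) < key w := by
    have hu := h.par_ne hfirst hw hne
    obtain ⟨k, hk, y, hy⟩ := h.earlier w _ _ (hfirst w hw).visit hw.1 hu
    have hmem : par w ∈ covered u Visit := ⟨hu, k, y, hy⟩
    exact ⟨hmem, ((hfirst _ hmem).le _ _ hy).trans_lt hk⟩
  refine ⟨h.root_mem_covered, fun w hw hne => (hpar w hw hne).1, fun w hw hne => ?_,
    fun w hw hne => (hpar w hw hne).2⟩
  refine h.adj w _ _ (hfirst w hw).visit hw.1 (h.par_ne hfirst hw hne) fun hfix => ?_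
  have hlt := (hpar w hw hne).2
  rw [hfix] at hlt
  exact hlt.false

theorem ncard_covered_le : (covered u Visit).ncard ≤ B := by
  have hinj : Set.InjOn key (covered u Visit) := by
    intro w hw w' hw' hkey
    have hvisit := (hfirst w hw).visit
    rw [hkey] at hvisit
    exact h.unique _ _ _ _ _ hvisit (hfirst w' hw').visit
  calc (covered u Visit).ncard ≤ (Set.Iio B).ncard :=
        Set.ncard_le_ncard_of_injOn key (fun w hw => h.lt _ _ _ (hfirst w hw).visit) hinj
          (Set.finite_Iio B)
    _ = B := by simp

theorem exists_visit_of_mem_edgeSet {e : Sym2 V}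
    (he : e ∈ (h.isParentMap hfirst).tree.edgeSet) : ∃ w k y, e = s(w, y) ∧ Visit w k y := by
  induction e with
  | h x y =>
    obtain ⟨hx, -, hpar⟩ | ⟨hy, -, hpar⟩ := he
    · obtain rfl : y = par x := hpar
      exact ⟨x, key x, par x, rfl, (hfirst x hx).visit⟩
    · obtain rfl : x = par y := hpar
      exact ⟨y, key y, par y, Sym2.eq_swap, (hfirst y hy).visit⟩

end IsVisitPlan

theorem IsVisitPlan.exists_tree {V : Type} [Finite V] {G : SimpleGraph V} {u ρ : V} {B : ℕ}
    {Visit : V → ℕ → V → Prop} (h : IsVisitPlan G u ρ B Visit) {α : Type*} {name : V → α}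
    {out : V → Option α} (hout : IsVisitOutput u Visit name out) :
    ∃ T : G.Subgraph, T.coe.IsTree ∧ T.verts = covered u Visit ∧ T.coe.diam ≤ B ∧
      (∃ ρ ∈ T.verts, ∀ w, (∃ p, IsParent T ρ w p ∧ out w = some (name p)) ∨
        ((w = ρ ∨ w ∉ T.verts) ∧ out w = none)) ∧
      ∀ e ∈ T.edgeSet, ∃ w k y, e = s(w, y) ∧ Visit w k y := by
  have hchoice (w : V) : ∃ (k : ℕ) (y : V), w ∈ covered u Visit → IsFirstVisit Visit w k y ∧
      (y = u → out w = none) ∧ (y ≠ u → out w = some (name y)) := by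
    by_cases hw : w ∈ covered u Visit
    · obtain ⟨k, y, hky⟩ := hout.exists_isFirstVisit w hw
      exact ⟨k, y, fun _ => hky⟩
    · exact ⟨0, u, fun hcov => absurd hcov hw⟩
  choose key par hkp using hchoice
  have hfirst (w : V) (hw : w ∈ covered u Visit) := (hkp w hw).1
  have hmap := h.isParentMap hfirst
  refine ⟨hmap.tree, hmap.isTree, rfl, hmap.diam_lt.le.trans (h.ncard_covered_le hfirst),
    ⟨ρ, hmap.root_mem, fun w => ?_⟩, fun e => h.exists_visit_of_mem_edgeSet hfirst⟩
  by_cases hw : w ∈ covered u Visit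
  · by_cases hρ : w = ρ
    · refine Or.inr ⟨Or.inl hρ, (hkp w hw).2.1 ?_⟩
      rw [hρ, h.par_root hfirst]
    · exact Or.inl ⟨par w, hmap.isParent hw hρ, (hkp w hw).2.2 (h.par_ne hfirst hw hρ)⟩
  · exact Or.inr ⟨Or.inr hw, hout.eq_none w hw⟩

end VisitPlan

section Visit

open SplitVertex

/-- Families of cycles in one split graph for each phase: the classes that define the split graph,
the labels of the cycles, and the cycles. -/
structure PhaseCovers {V : Type*} (G : SimpleGraph V) (ident : V → ℕ) where
  rep : ℕ → V → ℕ → ℕ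
  labels : ℕ → Finset ℕ
  cycles : ∀ t, ℕ → Set (Sym2 (SplitVertex G ident (rep t)))

variable {V : Type*} {G : SimpleGraph V} {ident : V → ℕ}

/-- `p` is the route of a token that `u` sends in phase `t < L` with number `j` along the cycle `l`,
up to its arrival at `p (s + 1)`; the number depends on the cycle and on the first edge. -/
structure IsRoute (𝒞 : PhaseCovers G ident) (d L : ℕ) (num : ℕ × ℕ → ℕ → Option ℕ) (u : V)
    (t l : ℕ) (p : ℤ → SplitVertex G ident (𝒞.rep t)) (s j : ℕ) : Prop where
  phase_lt : t < L
  mem_labels : l ∈ 𝒞.labels t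
  param : ∃ m ≤ d, IsCycleParam (splitGraph G ident (𝒞.rep t)) (𝒞.cycles t l) m p
  lt : s < d
  num_eq : num (t, l) (ident (p 1).base) = some j
  base_zero : (p 0).base = u
  base_one_ne : (p 1).base ≠ u
  base_ne : ∀ i : ℕ, 1 ≤ i → i ≤ s → (p i).base ≠ u

/-- A token of `u` arrives at `w` from `y`. A token with number `j` that arrives in step `s` counts
as a visit at time `j * d + s`, as if the tokens were sent one after the other. -/
def Visit (𝒞 : PhaseCovers G ident) (d L : ℕ) (num : ℕ × ℕ → ℕ → Option ℕ) (u w : V) (k : ℕ)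
    (y : V) : Prop :=
  ∃ t l p s j, IsRoute 𝒞 d L num u t l p s j ∧ (p (s + 1)).base = w ∧ (p s).base = y ∧
    k = j * d + s

/-- The neighbours of `u` linked by a segment in one of the first `L` phases; the label of the link
consists of the phase and the label of the cycle. -/
def SegmentLink (𝒞 : PhaseCovers G ident) (d L : ℕ) (u : V) (x : ℕ × ℕ) (b a : ℕ) : Prop :=
  x.1 < L ∧ x.2 ∈ 𝒞.labels x.1 ∧
    ∃ (s : ℕ) (p : ℤ → SplitVertex G ident (𝒞.rep x.1)),
      IsSegment G ident (𝒞.rep x.1) (𝒞.cycles x.1 x.2) d u s p ∧ ident (p 1).base = b ∧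
        ident (p s).base = a

variable {𝒞 : PhaseCovers G ident} {d L : ℕ} {num : ℕ × ℕ → ℕ → Option ℕ} {u : V}

theorem SegmentLink.symm {x : ℕ × ℕ} {b a : ℕ} (h : SegmentLink 𝒞 d L u x b a) :
    SegmentLink 𝒞 d L u x a b := by
  obtain ⟨hL, hl, s, p, hp, rfl, rfl⟩ := h
  exact ⟨hL, hl, s, _, hp.reverse, by rw [add_sub_cancel_right], by rw [add_sub_cancel_left]⟩

theorem SegmentLink.exists_adj_source {x : ℕ × ℕ} {b a : ℕ} (h : SegmentLink 𝒞 d L u x b a) :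
    ∃ v, G.Adj u v ∧ ident v = b := by
  obtain ⟨-, -, s, p, hp, hb, -⟩ := h
  obtain ⟨hadj, -⟩ := hp.adj_first
  exact ⟨_, hadj, hb⟩

theorem SegmentLink.exists_visit {x : ℕ × ℕ} {b a j : ℕ} (h : SegmentLink 𝒞 d L u x b a)
    (hj : num x b = some j) :
    (∃ v, ident v = b ∧ v ≠ u ∧ Visit 𝒞 d L num u v (j * d) u) ∧
      ∃ w, ident w = a ∧ w ≠ u ∧ ∃ k < (j + 1) * d, ∃ y, Visit 𝒞 d L num u w k y := by
  obtain ⟨hL, hl, s, p, hp, rfl, rfl⟩ := h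
  have hs := hp.lt
  have hone := hp.base_ne 1 le_rfl hp.one_le
  have hroute (s' : ℕ) (hs' : s' ≤ s) : IsRoute 𝒞 d L num u x.1 x.2 p s' j :=
    ⟨hL, hl, hp.param, by omega, hj, hp.base_zero, hone,
      fun i hi his => hp.base_ne i hi (his.trans hs')⟩
  refine ⟨⟨_, rfl, hone, x.1, x.2, p, 0, j, hroute 0 (Nat.zero_le s), rfl, hp.base_zero, rfl⟩, ?_⟩
  obtain ⟨s, rfl⟩ := Nat.exists_eq_add_of_le' hp.one_le
  exact ⟨_, rfl, hp.base_ne _ (by omega) le_rfl, j * d + s, by rw [Nat.succ_mul]; omega,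
    (p s).base, x.1, x.2, p, s, j, hroute s (by omega), rfl, rfl, rfl⟩

theorem IsRoute.natCast_eq (hident : Function.Injective ident) {t l s s' j : ℕ}
    {p p' : ℤ → SplitVertex G ident (𝒞.rep t)} (h : IsRoute 𝒞 d L num u t l p s j)
    (h' : IsRoute 𝒞 d L num u t l p' s' j) (hone : ident (p 1).base = ident (p' 1).base) (i : ℕ) :
    p i = p' i := by
  obtain ⟨m, -, hp⟩ := h.param
  obtain ⟨m', -, hp'⟩ := h'.param
  have hzero := h.base_zero.trans h'.base_zero.symm
  have hadj := hp.adj 0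
  have hadj' := hp'.adj 0
  rw [zero_add] at hadj hadj'
  obtain ⟨hG, hport, hport'⟩ := eq_port_of_adj hadj (by
    rw [h.base_zero]
    exact h.base_one_ne.symm)
  obtain ⟨hG', hqort, hqort'⟩ := eq_port_of_adj hadj' (by
    rw [h'.base_zero]
    exact h'.base_one_ne.symm)
  refine hp.natCast_eq_natCast hp' (ext' hzero ?_) (ext' (hident hone) ?_) i
  · rw [congrArg name hport, congrArg name hqort, name_port, name_port, hzero, hone]
  · rw [congrArg name hport', congrArg name hqort', name_port, name_port, hzero, hident hone]

theorem Visit.exists_earlier {w y : V} {k : ℕ} (h : Visit 𝒞 d L num u w k y) (hy : y ≠ u) :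
    ∃ k' < k, ∃ y', Visit 𝒞 d L num u y k' y' := by
  obtain ⟨t, l, p, s, j, hroute, rfl, rfl, rfl⟩ := h
  obtain rfl | hs := Nat.eq_zero_or_pos s
  · exact absurd hroute.base_zero hy
  · obtain ⟨s, rfl⟩ := Nat.exists_eq_add_of_le' hs
    have hlt := hroute.lt
    exact ⟨j * d + s, by omega, (p s).base, t, l, p, s, j,
      { hroute with
        lt := by omega
        base_ne := fun i hi his => hroute.base_ne i hi (by omega) }, rfl, rfl, rfl⟩

theorem Visit.adj {w y : V} {k : ℕ} (h : Visit 𝒞 d L num u w k y) (hne : y ≠ w) : G.Adj w y := by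
  obtain ⟨t, l, p, s, j, hroute, rfl, rfl, rfl⟩ := h
  obtain ⟨m, -, hp⟩ := hroute.param
  obtain ⟨hG, -⟩ := eq_port_of_adj (hp.adj s) hne
  exact hG.symm

section Exploration

variable {S : Finset ℕ}

local notation "ℛ" => SegmentLink 𝒞 d L u

theorem Visit.lt {w y : V} {k : ℕ} (h : Visit 𝒞 d L (rank S ℛ) u w k y) :
    k < (exploration S ℛ).1 * d := by
  obtain ⟨t, l, p, s, j, hroute, -, -, rfl⟩ := h
  have hj := Nat.mul_le_mul_right d (Nat.succ_le_of_lt (rank_spec hroute.num_eq).1)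
  have hs := hroute.lt
  rw [Nat.succ_mul] at hj
  omega

/-- The time of a visit determines the number of the token and its step, the number determines the
link, and the link determines the cycle and the first edge of the route. -/
theorem Visit.unique (hident : Function.Injective ident) {w w' y y' : V} {k : ℕ}
    (h : Visit 𝒞 d L (rank S ℛ) u w k y) (h' : Visit 𝒞 d L (rank S ℛ) u w' k y') : w = w' := by
  obtain ⟨t, l, p, s, j, hroute, rfl, -, rfl⟩ := h
  obtain ⟨t', l', p', s', j', hroute', rfl, -, htime⟩ := h'
  have hd := hroute.lt
  obtain rfl : s = s' := by
    simpa [Nat.mul_add_mod', Nat.mod_eq_of_lt, hd, hroute'.lt] using congrArg (· % d) htime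
  obtain rfl : j = j' := Nat.eq_of_mul_eq_mul_right (by omega) (Nat.add_right_cancel htime)
  obtain ⟨-, hlabel, hsource⟩ := rank_spec hroute.num_eq
  obtain ⟨-, hlabel', hsource'⟩ := rank_spec hroute'.num_eq
  obtain ⟨rfl, rfl⟩ := Prod.mk.inj (hlabel.symm.trans hlabel')
  have heq := hroute.natCast_eq hident hroute' (hsource.symm.trans hsource') (s + 1)
  push_cast at heq
  rw [heq]

theorem exists_visit_target {j : ℕ} (hE : IsLinkSequence ℛ ((exploration S ℛ).2 0).source
      (exploration S ℛ).1 (exploration S ℛ).2) (hj : j < (exploration S ℛ).1) :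
    ∃ w, ident w = ((exploration S ℛ).2 j).target ∧ w ≠ u ∧
      ∃ k < (j + 1) * d, ∃ y, Visit 𝒞 d L (rank S ℛ) u w k y := by
  obtain ⟨i, hij, hrank⟩ := exists_rank_le hj
  obtain ⟨-, w, hw, hwu, k, hk, hvisit⟩ := (hE.rel j hj).exists_visit hrank
  exact ⟨w, hw, hwu, k, hk.trans_le (Nat.mul_le_mul_right d (by omega)), hvisit⟩

theorem exists_visit_root (hE : IsExploration S ℛ (exploration S ℛ).1 (exploration S ℛ).2) :
    ∃ ρ, ident ρ = ((exploration S ℛ).2 0).source ∧ ρ ≠ u ∧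
      Visit 𝒞 d L (rank S ℛ) u ρ 0 u := by
  obtain ⟨i, hi, hrank⟩ := exists_rank_le hE.pos
  obtain rfl : i = 0 := by omega
  obtain ⟨⟨ρ, hρ, hρu, hvisit⟩, -⟩ := (hE.isLinkSequence.rel 0 hE.pos).exists_visit hrank
  rw [Nat.zero_mul] at hvisit
  exact ⟨ρ, hρ, hρu, hvisit⟩

/-- A token starts at the source of its link, which is the root or the target of an earlier link. -/
theorem Visit.eq_or_exists_earlier (hident : Function.Injective ident)
    (hE : IsLinkSequence ℛ ((exploration S ℛ).2 0).source (exploration S ℛ).1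
      (exploration S ℛ).2) {w : V} {k : ℕ} (h : Visit 𝒞 d L (rank S ℛ) u w k u) :
    ident w = ((exploration S ℛ).2 0).source ∨
      ∃ k' < k, ∃ y, Visit 𝒞 d L (rank S ℛ) u w k' y := by
  obtain ⟨t, l, p, s, j, hroute, rfl, hu, rfl⟩ := h
  obtain rfl : s = 0 := by
    by_contra hs
    exact hroute.base_ne s (by omega) le_rfl hu
  obtain ⟨hj, -, hsource⟩ := rank_spec hroute.num_eq
  obtain hstart | ⟨i, hij, htarget⟩ := hE.source_mem j hj
  · exact Or.inl (hsource.symm.trans hstart)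
  · obtain ⟨w, hw, -, k, hk, y, hvisit⟩ := exists_visit_target hE (hij.trans hj)
    obtain rfl : w = (p 1).base := hident (hw.trans (htarget.trans hsource))
    have hle : (i + 1) * d ≤ j * d := Nat.mul_le_mul_right d hij
    exact Or.inr ⟨k, hk.trans_le hle, y, hvisit⟩

theorem exists_isVisitPlan (hident : Function.Injective ident)
    (hE : IsExploration S ℛ (exploration S ℛ).1 (exploration S ℛ).2) :
    ∃ ρ, IsVisitPlan G u ρ ((exploration S ℛ).1 * d) (Visit 𝒞 d L (rank S ℛ) u) := by
  obtain ⟨ρ, hρ, hρu, hvisit⟩ := exists_visit_root hE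
  refine ⟨ρ, hρu, hvisit, fun w k y h _ hy => h.exists_earlier hy, fun w k h _ => ?_,
    fun w k y h _ _ hne => h.adj hne, fun w w' k y y' h h' => h.unique hident h',
    fun w k y h => h.lt⟩
  exact (h.eq_or_exists_earlier hident hE.isLinkSequence).imp_left
    fun hw => hident (hw.trans hρ.symm)

theorem mem_covered (hident : Function.Injective ident)
    (hE : IsExploration S ℛ (exploration S ℛ).1 (exploration S ℛ).2) {v : V} (hv : ident v ∈ S) :
    v ∈ covered u (Visit 𝒞 d L (rank S ℛ) u) := by
  obtain hroot | ⟨j, hj, htarget⟩ := hE.subset_visited hv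
  · obtain ⟨ρ, hρ, hρu, hvisit⟩ := exists_visit_root hE
    obtain rfl : v = ρ := hident (hroot.trans hρ.symm)
    exact ⟨hρu, 0, u, hvisit⟩
  · obtain ⟨w, hw, hwu, k, -, y, hvisit⟩ := exists_visit_target hE.isLinkSequence hj
    obtain rfl : v = w := hident (htarget.symm.trans hw.symm)
    exact ⟨hwu, k, y, hvisit⟩

end Exploration

end Visit

section Congestion

open SplitVertex

/-- The vertices whose clusters are met by a set of edges of the split graph. -/
def bases {V : Type*} {G : SimpleGraph V} {ident : V → ℕ} {rep : V → ℕ → ℕ}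
    (C : Set (Sym2 (SplitVertex G ident rep))) : Set V := {u | ∃ q q', s(q, q') ∈ C ∧ q.base = u}

theorem IsCycleParam.ncard_bases_le {V : Type*} {G : SimpleGraph V} {ident : V → ℕ}
    {rep : V → ℕ → ℕ} {C : Set (Sym2 (SplitVertex G ident rep))} {m : ℕ}
    {p : ℤ → SplitVertex G ident rep} (hp : IsCycleParam (splitGraph G ident rep) C m p) :
    (bases C).ncard ≤ m := by
  have hsub : bases C ⊆ base '' Set.range p := by
    rintro u ⟨q, q', hq, rfl⟩
    obtain ⟨i, hi⟩ := (hp.mem_iff _).1 hq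
    obtain ⟨rfl, -⟩ | ⟨rfl, -⟩ := Sym2.eq_iff.1 hi <;> exact ⟨_, ⟨_, rfl⟩, rfl⟩
  calc (bases C).ncard ≤ (base '' Set.range p).ncard :=
        Set.ncard_le_ncard hsub (hp.finite_range.image base)
    _ ≤ (Set.range p).ncard := Set.ncard_image_le hp.finite_range
    _ ≤ m := hp.ncard_range_le

variable {V : Type} {G : SimpleGraph V} {ident : V → ℕ} {𝒞 : PhaseCovers G ident} {d L : ℕ}

theorem Visit.exists_mem_bases {num : ℕ × ℕ → ℕ → Option ℕ} {u w y a b : V} {k : ℕ}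
    (h : Visit 𝒞 d L num u w k y) (hab : G.Adj a b) (hwy : s(a, b) = s(w, y)) :
    ∃ t < L, ∃ l ∈ 𝒞.labels t, s(port hab, port hab.symm) ∈ 𝒞.cycles t l ∧
      u ∈ bases (𝒞.cycles t l) := by
  obtain ⟨t, l, p, s, j, hroute, rfl, rfl, -⟩ := h
  obtain ⟨m, -, hp⟩ := hroute.param
  refine ⟨t, hroute.phase_lt, l, hroute.mem_labels, ?_, p 0, p (0 + 1), hp.mem 0, hroute.base_zero⟩
  have hadj : G.Adj (p (s + 1)).base (p s).base := by
    rwa [← SimpleGraph.mem_edgeSet, ← hwy]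
  obtain ⟨hG, hport, hport'⟩ := eq_port_of_adj (hp.adj s) hadj.ne'
  have hmem : s(port hG, port hG.symm) ∈ 𝒞.cycles t l :=
    congrArg₂ (fun q q' => s(q, q')) hport hport' ▸ hp.mem s
  have hmem' : s(port hG.symm, port hG) ∈ 𝒞.cycles t l := by rwa [Sym2.eq_swap] at hmem
  clear hport hport'
  generalize (p (s + 1)).base = w at *
  generalize (p s).base = y at *
  obtain ⟨rfl, rfl⟩ | ⟨rfl, rfl⟩ := Sym2.eq_iff.1 hwy
  · exact hmem'
  · exact hmem

/-- An edge of `G` lies on at most `c` cycles in each of the `L` phases, and each cycle meets the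
clusters of at most `d` nodes. -/
theorem ncard_visit_le [Finite V] {c : ℕ} {num : V → ℕ × ℕ → ℕ → Option ℕ}
    (hcover : ∀ t < L,
      IsCycleCover (splitGraph G ident (𝒞.rep t)) d c (𝒞.labels t) (𝒞.cycles t))
    {e : Sym2 V} (he : e ∈ G.edgeSet) :
    {u | ∃ w k y, e = s(w, y) ∧ Visit 𝒞 d L (num u) u w k y}.ncard ≤ c * d * L := by
  classical
  induction e with
  | h a b =>
  have hab : G.Adj a b := he
  let labels (t : ℕ) : Finset ℕ :=
    (𝒞.labels t).filter fun l => s(port hab, port hab.symm) ∈ 𝒞.cycles t l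
  have hlabels (t : ℕ) (ht : t < L) : (labels t).card ≤ c := by
    rw [← Set.ncard_coe_finset]
    convert ((hcover t ht).2 s(port hab, port hab.symm) (splitGraph_adj_port hab)).2 using 2
    ext l
    simp [labels]
  have hbases (t : ℕ) (ht : t < L) (l : ℕ) (hl : l ∈ labels t) :
      (bases (𝒞.cycles t l)).ncard ≤ d := by
    obtain ⟨m, hm, p, hp⟩ := (hcover t ht).exists_isCycleParam (Finset.mem_filter.1 hl).1
    exact hp.ncard_bases_le.trans hm
  have hsub : {u | ∃ w k y, s(a, b) = s(w, y) ∧ Visit 𝒞 d L (num u) u w k y} ⊆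
      ⋃ t ∈ Finset.range L, ⋃ l ∈ labels t, bases (𝒞.cycles t l) := by
    rintro u ⟨w, k, y, hwy, hvisit⟩
    obtain ⟨t, ht, l, hl, hmem, hu⟩ := hvisit.exists_mem_bases hab hwy
    simp only [Set.mem_iUnion, exists_prop]
    exact ⟨t, Finset.mem_range.2 ht, l, Finset.mem_filter.2 ⟨hl, hmem⟩, hu⟩
  calc _ ≤ (⋃ t ∈ Finset.range L, ⋃ l ∈ labels t, bases (𝒞.cycles t l)).ncard :=
        Set.ncard_le_ncard hsub (Set.toFinite _)
    _ ≤ ∑ t ∈ Finset.range L, ∑ l ∈ labels t, (bases (𝒞.cycles t l)).ncard :=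
        (Finset.set_ncard_biUnion_le _ _).trans
          (Finset.sum_le_sum fun t _ => Finset.set_ncard_biUnion_le _ _)
    _ ≤ (Finset.range L).card * (c * d) := by
        refine Finset.sum_le_card_nsmul _ _ _ fun t ht => ?_
        rw [Finset.mem_range] at ht
        calc _ ≤ (labels t).card * d := Finset.sum_le_card_nsmul _ _ _ (hbases t ht)
          _ ≤ c * d := Nat.mul_le_mul_right d (hlabels t ht)
    _ = c * d * L := by rw [Finset.card_range, Nat.mul_comm]

end Congestion

/-! ### The construction -/

theorem TwoVertexConnected.two_le_card {V : Type} [Fintype V] {G : SimpleGraph V} {ident : V → ℕ}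
    (hG : TwoVertexConnected G) (hident : Function.Injective ident) (u : V) :
    2 ≤ (neighborIdents G ident u).card := by
  obtain ⟨w, hwu, -⟩ := hG.exists_ne_ne u u
  obtain ⟨v, hv⟩ : ∃ v, G.Adj u v := by
    obtain ⟨p⟩ := hG.connected.preconnected u w
    cases p with
    | nil => exact absurd rfl hwu
    | cons huv _ => exact ⟨_, huv⟩
  obtain ⟨x, hxu, hxv⟩ := hG.exists_ne_ne u v
  obtain ⟨v', hv', hne⟩ : ∃ v', G.Adj u v' ∧ v' ≠ v := by
    obtain ⟨p⟩ := (hG.2 v).preconnected ⟨u, hv.ne⟩ ⟨x, hxv⟩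
    cases p with
    | nil => exact absurd rfl hxu
    | @cons _ y _ huy _ => exact ⟨y.1, huy, y.2⟩
  exact Finset.one_lt_card.2 ⟨ident v, mem_neighborIdents.2 ⟨v, hv, rfl⟩, ident v',
    mem_neighborIdents.2 ⟨v', hv', rfl⟩, fun heq => hne (hident heq).symm⟩

section PhaseRecord

/-- What a node remembers of a phase: its cluster in the split graph, the labels of the cycles
through the edges at its cluster, and the tokens received in every step. -/
structure PhaseRecord (N : ℕ) where
  info : ClusterInfo
  labels : ℕ → ℕ → Finset ℕ
  history : ℕ → ℕ → ℕ → ℕ → Option (Token N)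

instance (N : ℕ) : Inhabited (PhaseRecord N) :=
  ⟨⟨⟨0, ∅, fun _ => 0, fun _ => 0⟩, fun _ _ => ∅, fun _ _ _ _ => none⟩⟩

variable (N d L : ℕ)

/-- The equivalence relation generated by the links found in the first `t` phases. -/
def Linked (R : ℕ → PhaseRecord N) (t : ℕ) : ℕ → ℕ → Prop :=
  Relation.EqvGen fun b a =>
    ∃ i < t, ∃ l, IsDetectedLink N d (R i).info.id (R i).history l b a

/-- The links found in the first `L` phases; their labels consist of a phase and the label of a
cycle. -/
def PhaseLink (R : ℕ → PhaseRecord N) (x : ℕ × ℕ) (b a : ℕ) : Prop :=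
  x.1 < L ∧ IsDetectedLink N d (R x.1).info.id (R x.1).history x.2 b a

variable {N d} {R R' : ℕ → PhaseRecord N} {t t' : ℕ}

theorem linked_equivalence (R : ℕ → PhaseRecord N) (t : ℕ) : Equivalence (Linked N d R t) :=
  Relation.EqvGen.is_equivalence _

theorem linked_mono (h : t ≤ t') {x y : ℕ} (hxy : Linked N d R t x y) : Linked N d R t' x y :=
  Relation.EqvGen.mono (fun _ _ ⟨i, hi, hl⟩ => ⟨i, hi.trans_le h, hl⟩) x y hxy

theorem linked_congr (h : ∀ i < t, R i = R' i) : Linked N d R t = Linked N d R' t := by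
  unfold Linked
  congr 1
  funext b a
  refine propext (exists_congr fun i => and_congr_right fun hi => ?_)
  rw [h i hi]

end PhaseRecord

section TreeOutput

variable (N d L : ℕ)

/-- The emission of tokens by which the trees are built, in phase `t`, by a node with identifier
`id`. -/
noncomputable def treeEmit [NeZero N] (id : ℕ) (S : Finset ℕ) (R : ℕ → PhaseRecord N)
    (t _a y l : ℕ) : Option (Token N) :=
  if y / N = id then none else
    (rank S (PhaseLink N d L R) (t, l) (y / N)).map fun j => (Fin.ofNat N id, Fin.ofNat N j)

/-- According to the tokens `hist t` received in the phases `t < L`, a token of the node with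
identifier `o` has arrived from the node with identifier `y`; `k` is the time of this visit. -/
def IsCandidate (hist : ℕ → ℕ → ℕ → ℕ → ℕ → Option (Token N)) (o k y : ℕ) : Prop :=
  ∃ t < L, ∃ s < d, ∃ a x l, ∃ τ : Token N, hist t s a x l = some τ ∧ (τ.1 : ℕ) = o ∧
    k = τ.2 * d + s ∧ y = x / N

/-- A node whose token belongs to the first visit, where `Q k y` says that there is a visit at time
`k` by a token from the node with identifier `y`. -/
noncomputable def firstSource (Q : ℕ → ℕ → Prop) : Option ℕ :=
  open Classical in if hex : ∃ k y, Q k y then some (Nat.find_spec hex).choose else none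

/-- The output of the node with identifier `id`: its parent in the tree of `o` is the node from
which the first token of `o` has arrived, and it is the root if that node is `o`. -/
noncomputable def treeOutput (id : ℕ) (hist : ℕ → ℕ → ℕ → ℕ → ℕ → Option (Token N)) (o : ℕ) :
    Option ℕ :=
  if o = id then none else (firstSource (IsCandidate N d L hist o)).filter (· ≠ o)

variable {N d L} {id o : ℕ} {hist : ℕ → ℕ → ℕ → ℕ → ℕ → Option (Token N)}

theorem firstSource_eq_none {Q : ℕ → ℕ → Prop} (h : ∀ k y, ¬ Q k y) : firstSource Q = none :=
  dif_neg fun ⟨k, y, hky⟩ => h k y hky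

theorem exists_firstSource_eq {Q : ℕ → ℕ → Prop} (hex : ∃ k y, Q k y) :
    ∃ k y, Q k y ∧ (∀ k' y', Q k' y' → k ≤ k') ∧ firstSource Q = some y := by
  classical
  exact ⟨Nat.find hex, _, (Nat.find_spec hex).choose_spec,
    fun k' y' hk => Nat.find_min' hex ⟨y', hk⟩, dif_pos hex⟩

theorem treeOutput_eq_none (h : o ≠ id → ∀ k y, ¬ IsCandidate N d L hist o k y) :
    treeOutput N d L id hist o = none := by
  unfold treeOutput
  split_ifs with ho
  · rfl
  · rw [firstSource_eq_none (h ho), Option.filter_none]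

theorem exists_treeOutput_eq (ho : o ≠ id) (hex : ∃ k y, IsCandidate N d L hist o k y) :
    ∃ k y, IsCandidate N d L hist o k y ∧ (∀ k' y', IsCandidate N d L hist o k' y' → k ≤ k') ∧
      treeOutput N d L id hist o = if y = o then none else some y := by
  obtain ⟨k, y, hky, hmin, heq⟩ := exists_firstSource_eq hex
  refine ⟨k, y, hky, hmin, ?_⟩
  rw [treeOutput, if_neg ho, heq]
  by_cases hy : y = o <;> simp [hy, Option.filter]

theorem treeOutput_congr {hist' : ℕ → ℕ → ℕ → ℕ → ℕ → Option (Token N)}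
    (h : ∀ t < L, hist t = hist' t) : treeOutput N d L id hist = treeOutput N d L id hist' := by
  have hcand : IsCandidate N d L hist = IsCandidate N d L hist' := by
    funext o k y
    refine propext (exists_congr fun t => and_congr_right fun ht => ?_)
    rw [h t ht]
  funext o
  rw [treeOutput, treeOutput, hcand]

end TreeOutput

section Construction

open SplitVertex

variable {r M : ℕ} (A : Algorithm r M (ℕ → Finset ℕ)) (N d c L : ℕ) [NeZero N]
  {V : Type} [Fintype V] (G : SimpleGraph V) (ident : V → ℕ)

/-- The knowledge about the clusters after every node has announced the classes of its
neighbours. -/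
noncomputable def clusterInfo (rep : V → ℕ → ℕ) (u : V) : ClusterInfo :=
  ⟨ident u, neighborIdents G ident u, rep u, fun x =>
    (received G ident (fun v y => some (Fin.ofNat N (rep v y))) u x).elim 0 Fin.val⟩

/-- The knowledge of the nodes before the links are found. -/
noncomputable def linkEnv (rep : V → ℕ → ℕ) (ψ : V → Fin r → Fin N → A.Seed) (u : V) :
    TokenEnv N :=
  ⟨clusterInfo N G ident rep u,
    simOutput A N G ident (fun v => (clusterInfo N G ident rep v, ψ v)) u,
    linkEmit N (clusterInfo N G ident rep u)⟩

/-- The records of a phase. -/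
noncomputable def phaseRecord (rep : V → ℕ → ℕ) (ψ : V → Fin r → Fin N → A.Seed) (u : V) :
    PhaseRecord N :=
  ⟨(linkEnv A N G ident rep ψ u).info, (linkEnv A N G ident rep ψ u).labels,
    (tokenRun c G ident (linkEnv A N G ident rep ψ) d u).2⟩

/-- The records of the first `t` phases. -/
noncomputable def records (ψ : ℕ → V → Fin r → Fin N → A.Seed) : ℕ → V → ℕ → PhaseRecord N
  | 0 => fun _ _ => default
  | t + 1 => fun u => Function.update (records ψ t u) t
      (phaseRecord A N d c G ident (fun v => classRep (neighborIdents G ident v)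
        (Linked N d (records ψ t v) t)) (ψ t) u)

/-- The classes of the neighbours in phase `t`. -/
noncomputable def repAt (ψ : ℕ → V → Fin r → Fin N → A.Seed) (t : ℕ) (u : V) : ℕ → ℕ :=
  classRep (neighborIdents G ident u) (Linked N d (records A N d c G ident ψ t u) t)

/-- The knowledge of the nodes before the tokens of phase `t` by which the trees are built are
sent. -/
noncomputable def treeEnv (R : V → ℕ → PhaseRecord N) (t : ℕ) (u : V) : TokenEnv N :=
  ⟨(R u t).info, (R u t).labels, treeEmit N d L (ident u) (neighborIdents G ident u) (R u) t⟩

/-- The tokens by which the trees are built that are received in phase `t`. -/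
noncomputable def treeHistory (R : V → ℕ → PhaseRecord N) (u : V) (t : ℕ) :
    ℕ → ℕ → ℕ → ℕ → Option (Token N) :=
  (tokenRun c G ident (treeEnv N d L G ident R t) d u).2

/-- The output of the algorithm. -/
noncomputable def finalOutput (ψ : ℕ → V → Fin r → Fin N → A.Seed) (u : V) : ℕ → Option ℕ :=
  treeOutput N d L (ident u) (treeHistory N d c L G ident (records A N d c G ident ψ L) u)

/-- The simulation of the given algorithm on the split graph succeeds. -/
def SplitSucceeds (rep : V → ℕ → ℕ) (ψ : V → Fin r → Fin N → A.Seed) : Prop :=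
  ∀ _ : Fintype (SplitVertex G ident rep),
    IsCycleCoverOutput (splitGraph G ident rep) (splitIdent N G ident rep) d c
      (A.result (splitGraph G ident rep) (splitIdent N G ident rep) (splitSeed N G ident rep ψ))

/-- The simulation of the given algorithm in phase `t` succeeds. -/
def PhaseSucceeds (ψ : ℕ → V → Fin r → Fin N → A.Seed) (t : ℕ) : Prop :=
  SplitSucceeds A N d c G ident (repAt A N d c G ident ψ t) (ψ t)

variable {A N d c L G ident} {ψ : ℕ → V → Fin r → Fin N → A.Seed}

theorem records_eq {t i : ℕ} (h : i < t) (u : V) : records A N d c G ident ψ t u i =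
    phaseRecord A N d c G ident (repAt A N d c G ident ψ i) (ψ i) u := by
  induction t with
  | zero => omega
  | succ t ih =>
    rw [records]
    dsimp only
    rcases Nat.lt_succ_iff_lt_or_eq.1 h with hi | rfl
    · rw [Function.update_of_ne hi.ne, ih hi]
    · rw [Function.update_self]
      rfl

theorem repAt_eq {t : ℕ} (h : t ≤ L) (u : V) : repAt A N d c G ident ψ t u =
    classRep (neighborIdents G ident u) (Linked N d (records A N d c G ident ψ L u) t) := by
  unfold repAt
  rw [linked_congr]
  intro i hi
  rw [records_eq hi, records_eq (hi.trans_le h)]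

theorem isSplitting_repAt (hG : TwoVertexConnected G) (hident : Function.Injective ident) (t : ℕ) :
    IsSplitting G ident (repAt A N d c G ident ψ t) where
  exists_ident u v huv := by
    have hmem := (classRep_spec (linked_equivalence (d := d) (records A N d c G ident ψ t u) t)
      (mem_neighborIdents.2 ⟨v, huv, rfl⟩ : ident v ∈ neighborIdents G ident u)).1
    obtain ⟨w, hw, hrep⟩ := mem_neighborIdents.1 hmem
    exact ⟨w, hw, hrep.symm⟩
  exists_ne u := by
    obtain ⟨x, hx, y, hy, hne⟩ := exists_classRep_ne
      (linked_equivalence (d := d) (records A N d c G ident ψ t u) t) (hG.two_le_card hident u)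
    obtain ⟨v, hv, rfl⟩ := mem_neighborIdents.1 hx
    obtain ⟨w, hw, rfl⟩ := mem_neighborIdents.1 hy
    exact ⟨v, w, hv, hw, hne⟩

theorem isClusterInfo_clusterInfo {rep : V → ℕ → ℕ} (hs : IsSplitting G ident rep)
    (hident : Function.Injective ident) (hN : ∀ v, ident v < N) :
    IsClusterInfo G ident rep (clusterInfo N G ident rep) where
  id_eq _ := rfl
  nbrs_eq _ := rfl
  rep_eq _ := rfl
  repAt_eq u v huv := by
    obtain ⟨w, -, hrep⟩ := hs.exists_ident v u huv.symm
    simp only [clusterInfo, received_of_adj hident _ huv, Option.elim_some]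
    exact Nat.mod_eq_of_lt (hrep ▸ hN w)

theorem PhaseSucceeds.exists_isCoverInfo {t : ℕ} (h : PhaseSucceeds A N d c G ident ψ t)
    (hG : TwoVertexConnected G) (hident : Function.Injective ident) (hN : ∀ v, ident v < N) :
    ∃ I C, IsCoverInfo G ident (repAt A N d c G ident ψ t) d c I C
      (linkEnv A N G ident (repAt A N d c G ident ψ t) (ψ t)) := by
  have hs := isSplitting_repAt (A := A) (N := N) (d := d) (c := c) (ψ := ψ) hG hident t
  have := hs.finite
  have := Fintype.ofFinite (SplitVertex G ident (repAt A N d c G ident ψ t))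
  obtain ⟨I, C, hcover, hlabels⟩ := h this
  have hk := isClusterInfo_clusterInfo hs hident hN
  refine ⟨I, C, hs, hident, hN, hk, hcover, fun q q' hq l => ?_⟩
  rw [← hlabels q q' hq l, ← simOutput_eq A hk hs hident hN]
  rfl

/-- In a successful phase, a segment from each class of neighbours links it to another class. -/
theorem linked_of_succeeds (hG : TwoVertexConnected G) (hident : Function.Injective ident)
    (hN : ∀ v, ident v < N) (hall : ∀ t < L, PhaseSucceeds A N d c G ident ψ t) (u : V)
    (hcard : (neighborIdents G ident u).card < 2 ^ (L + 1)) :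
    ∀ x ∈ neighborIdents G ident u, ∀ y ∈ neighborIdents G ident u,
      Linked N d (records A N d c G ident ψ L u) L x y := by
  refine rel_of_merge (linked_equivalence _) (fun t x y => linked_mono t.le_succ) ?_ hcard
  intro t ht htotal x hx
  obtain ⟨v, hv, rfl⟩ := mem_neighborIdents.1 hx
  obtain ⟨I, C, hinfo⟩ := (hall t ht).exists_isCoverInfo hG hident hN
  obtain ⟨l, hl, s, p, hp, hfirst, hlast⟩ := hinfo.exists_segment hv
  have hlink := (hinfo.isDetectedLink_iff (fun _ => rfl) u l _ _).2 ⟨hl, s, p, hp, rfl, rfl⟩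
  rw [repAt_eq ht.le] at hfirst hlast
  have hE := linked_equivalence (d := d) (records A N d c G ident ψ L u) t
  obtain ⟨hadj, -⟩ := hp.adj_first
  obtain ⟨hadj', -⟩ := hp.adj_last
  have hrel := rel_of_classRep_eq hE (mem_neighborIdents.2 ⟨_, hadj, rfl⟩) hx hfirst
  refine ⟨ident (p s).base, mem_neighborIdents.2 ⟨_, hadj', rfl⟩, ?_, ?_⟩
  · refine (linked_equivalence _ _).trans (linked_mono t.le_succ (hE.symm hrel)) ?_
    refine Relation.EqvGen.rel _ _ ⟨t, t.lt_succ_self, l, ?_⟩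
    rw [records_eq ht]
    exact hlink
  · exact fun hxy => not_rel_of_classRep_ne hE htotal hlast (hE.symm hxy)

end Construction

/-! ### Correctness -/

section Correctness

open SplitVertex

section NeighborIdents

variable {V : Type} [Fintype V] {G : SimpleGraph V} {ident : V → ℕ}

theorem card_neighborIdents_le (G : SimpleGraph V) (ident : V → ℕ) (u : V) :
    (neighborIdents G ident u).card ≤ (G.neighborSet u).ncard := by
  rw [neighborIdents, ← Set.ncard_coe_finset, Finset.coe_image]
  refine (Set.ncard_image_le (Finset.finite_toSet _)).trans (le_of_eq ?_)
  congr 1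
  ext v
  simp

theorem card_neighborIdents_le_of_ident_lt {N : ℕ} (hN : ∀ v, ident v < N) (u : V) :
    (neighborIdents G ident u).card ≤ N := by
  have hsub : neighborIdents G ident u ⊆ Finset.range N := fun x hx => by
    obtain ⟨v, -, rfl⟩ := mem_neighborIdents.1 hx
    exact Finset.mem_range.2 (hN v)
  simpa using Finset.card_le_card hsub

end NeighborIdents

theorem IsCoverInfo.congr {V : Type} [Fintype V] {G : SimpleGraph V} {ident : V → ℕ} {N d c : ℕ}
    {rep : V → ℕ → ℕ} {I : Finset ℕ} {C : ℕ → Set (Sym2 (SplitVertex G ident rep))}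
    {z z' : V → TokenEnv N} (h : IsCoverInfo G ident rep d c I C z)
    (hinfo : ∀ v, (z' v).info = (z v).info) (hlabels : ∀ v, (z' v).labels = (z v).labels) :
    IsCoverInfo G ident rep d c I C z' :=
  { h with
    info := by simpa only [hinfo] using h.info
    mem_labels := by simpa only [hlabels] using h.mem_labels }

variable {r M : ℕ} {A : Algorithm r M (ℕ → Finset ℕ)} {N d c L : ℕ} [NeZero N]
  {V : Type} [Fintype V] {G : SimpleGraph V} {ident : V → ℕ}
  {ψ : ℕ → V → Fin r → Fin N → A.Seed} {𝒞 : PhaseCovers G ident}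

/-- The families of cycles in `𝒞` are cycle covers of the split graphs of the first `L` phases, and
the nodes know them before the links are found. -/
structure IsPhaseCovers (A : Algorithm r M (ℕ → Finset ℕ)) (N d c L : ℕ) [NeZero N]
    (ψ : ℕ → V → Fin r → Fin N → A.Seed) (𝒞 : PhaseCovers G ident) : Prop where
  rep_eq : ∀ t, 𝒞.rep t = repAt A N d c G ident ψ t
  isCoverInfo : ∀ t < L, IsCoverInfo G ident (𝒞.rep t) d c (𝒞.labels t) (𝒞.cycles t)
    (linkEnv A N G ident (𝒞.rep t) (ψ t))

theorem exists_isPhaseCovers (hG : TwoVertexConnected G) (hident : Function.Injective ident)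
    (hN : ∀ v, ident v < N) (hall : ∀ t < L, PhaseSucceeds A N d c G ident ψ t) :
    ∃ 𝒞 : PhaseCovers G ident, IsPhaseCovers A N d c L ψ 𝒞 := by
  have hex (t : ℕ) : ∃ (I : Finset ℕ)
      (C : ℕ → Set (Sym2 (SplitVertex G ident (repAt A N d c G ident ψ t)))), t < L →
      IsCoverInfo G ident (repAt A N d c G ident ψ t) d c I C
        (linkEnv A N G ident (repAt A N d c G ident ψ t) (ψ t)) := by
    by_cases ht : t < L
    · obtain ⟨I, C, h⟩ := (hall t ht).exists_isCoverInfo hG hident hN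
      exact ⟨I, C, fun _ => h⟩
    · exact ⟨∅, fun _ => ∅, fun h => absurd h ht⟩
  choose I C hinfo using hex
  exact ⟨⟨_, I, C⟩, fun _ => rfl, hinfo⟩

/-- The numbers of the tokens of `u` by which its tree is built, for each cycle and each first
vertex: their positions in an exploration of the neighbours of `u`. -/
noncomputable abbrev tokenNum (𝒞 : PhaseCovers G ident) (d L : ℕ) (u : V) : ℕ × ℕ → ℕ → Option ℕ :=
  rank (neighborIdents G ident u) (SegmentLink 𝒞 d L u)

namespace IsPhaseCovers

variable (h : IsPhaseCovers A N d c L ψ 𝒞)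
include h

theorem records_eq {t : ℕ} (ht : t < L) (u : V) : records A N d c G ident ψ L u t =
    phaseRecord A N d c G ident (𝒞.rep t) (ψ t) u := by
  rw [PrivateTrees.records_eq ht, h.rep_eq]

theorem isCoverInfo_treeEnv {t : ℕ} (ht : t < L) :
    IsCoverInfo G ident (𝒞.rep t) d c (𝒞.labels t) (𝒞.cycles t)
      (treeEnv N d L G ident (records A N d c G ident ψ L) t) :=
  (h.isCoverInfo t ht).congr (fun v => by rw [treeEnv, h.records_eq ht]; rfl)
    fun v => by rw [treeEnv, h.records_eq ht]; rfl

theorem phaseLink_eq (u : V) :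
    PhaseLink N d L (records A N d c G ident ψ L u) = SegmentLink 𝒞 d L u := by
  funext x b a
  refine propext (and_congr_right fun hx => ?_)
  rw [h.records_eq hx]
  exact (h.isCoverInfo x.1 hx).isDetectedLink_iff (fun _ => rfl) u x.2 b a

theorem isExploration (hG : TwoVertexConnected G) (hident : Function.Injective ident)
    (hN : ∀ v, ident v < N) (hall : ∀ t < L, PhaseSucceeds A N d c G ident ψ t) (u : V)
    (hcard : (neighborIdents G ident u).card < 2 ^ (L + 1)) :
    IsExploration (neighborIdents G ident u) (SegmentLink 𝒞 d L u)
      (exploration (neighborIdents G ident u) (SegmentLink 𝒞 d L u)).1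
      (exploration (neighborIdents G ident u) (SegmentLink 𝒞 d L u)).2 := by
  refine isExploration_exploration (exists_isExploration (hG.two_le_card hident u)
    (fun x b a hba => mem_neighborIdents.2 hba.symm.exists_adj_source)
    (fun x b a hba => hba.symm) fun x hx y hy => ?_)
  refine Relation.EqvGen.mono ?_ x y (linked_of_succeeds hG hident hN hall u hcard x hx y hy)
  rintro b a ⟨t, ht, l, hl⟩
  refine ⟨(t, l), ?_⟩
  rw [← h.phaseLink_eq]
  exact ⟨ht, hl⟩

theorem treeEnv_emit_splitIdent (hident : Function.Injective ident) (hN : ∀ v, ident v < N)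
    {t : ℕ} (ht : t < L) (v : V) (a l : ℕ) (q : SplitVertex G ident (𝒞.rep t)) {τ : Token N} :
    (treeEnv N d L G ident (records A N d c G ident ψ L) t v).emit a
        (splitIdent N G ident (𝒞.rep t) q) l = some τ ↔
      q.base ≠ v ∧ (τ.1 : ℕ) = ident v ∧
        tokenNum 𝒞 d L v (t, l) (ident q.base) = some (τ.2 : ℕ) := by
  have hval : ((Fin.ofNat N (ident v) : Fin N) : ℕ) = ident v := Nat.mod_eq_of_lt (hN v)
  have hnum {j : ℕ} (hj : tokenNum 𝒞 d L v (t, l) (ident q.base) = some j) :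
      ((Fin.ofNat N j : Fin N) : ℕ) = j :=
    Nat.mod_eq_of_lt ((rank_lt_card hj).trans_le (card_neighborIdents_le_of_ident_lt hN v))
  have hdiv := (h.isCoverInfo t ht).isSplitting.splitIdent_div hN q
  change treeEmit N d L (ident v) _ _ t a _ l = some τ ↔ _
  rw [treeEmit, hdiv, h.phaseLink_eq]
  split_ifs with hv
  · simp [hident hv]
  replace hv : q.base ≠ v := fun hqv => hv (congrArg ident hqv)
  rw [Option.map_eq_some_iff]
  constructor
  · rintro ⟨j, hj, rfl⟩
    exact ⟨hv, hval, hj.trans (congrArg some (hnum hj).symm)⟩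
  · rintro ⟨-, horigin, hj⟩
    exact ⟨_, hj, Prod.ext (Fin.ext (hval.trans horigin.symm)) (Fin.ext (hnum hj))⟩

theorem isCandidate_iff (hident : Function.Injective ident) (hN : ∀ v, ident v < N) (w : V)
    (o k x : ℕ) :
    IsCandidate N d L (treeHistory N d c L G ident (records A N d c G ident ψ L) w) o k x ↔
      ∃ u y, ident u = o ∧ ident y = x ∧ Visit 𝒞 d L (tokenNum 𝒞 d L u) u w k y := by
  constructor
  · rintro ⟨t, ht, s, hs, a, y, l, τ, hτ, rfl, rfl, rfl⟩
    have hinfo := h.isCoverInfo_treeEnv ht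
    rw [treeHistory, tokenRun_history hs] at hτ
    obtain ⟨hl, m, hm, p, hp, hw, rfl, hemit, hne⟩ := hinfo.exists_isCycleParam_of_tokenAt hτ
    obtain ⟨hone, horigin, hnum⟩ := (h.treeEnv_emit_splitIdent hident hN ht _ _ _ _).1 hemit
    exact ⟨(p 0).base, (p s).base, horigin.symm, (hinfo.isSplitting.splitIdent_div hN _).symm,
      t, l, p, s, τ.2, ⟨ht, hl, ⟨m, hm, hp⟩, hs, hnum, rfl, hone,
        fun i hi his hiu => hne i hi his (by rw [hiu, horigin])⟩, hw, rfl, rfl⟩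
  · rintro ⟨u, y, rfl, rfl, t, l, p, s, j, hroute, rfl, rfl, rfl⟩
    obtain ⟨ht, hl, ⟨m, -, hp⟩, hs, hnum, rfl, hone, hne⟩ := hroute
    have hinfo := h.isCoverInfo_treeEnv ht
    have hj := (rank_lt_card hnum).trans_le (card_neighborIdents_le_of_ident_lt hN _)
    let τ : Token N := (⟨ident (p 0).base, hN _⟩, ⟨j, hj⟩)
    refine ⟨t, ht, s, hs, (p (s + 1)).name, splitIdent N G ident _ (p s), l, τ, ?_, rfl, rfl,
      (hinfo.isSplitting.splitIdent_div hN _).symm⟩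
    rw [treeHistory, tokenRun_history hs]
    exact hinfo.tokenAt_eq_some_of_isCycleParam hl hp
      ((h.treeEnv_emit_splitIdent hident hN ht _ _ _ _).2 ⟨hone, rfl, hnum⟩)
      fun i hi his hiu => hne i hi his (hident hiu)

theorem isVisitOutput_finalOutput (hident : Function.Injective ident) (hN : ∀ v, ident v < N)
    (u : V) : IsVisitOutput u (Visit 𝒞 d L (tokenNum 𝒞 d L u) u) ident
      fun w => finalOutput A N d c L G ident ψ w (ident u) := by
  have hiff (w : V) (k x : ℕ) : IsCandidate N d L
      (treeHistory N d c L G ident (records A N d c G ident ψ L) w) (ident u) k x ↔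
      ∃ y, ident y = x ∧ Visit 𝒞 d L (tokenNum 𝒞 d L u) u w k y := by
    rw [h.isCandidate_iff hident hN]
    refine ⟨?_, fun ⟨y, hy, hvisit⟩ => ⟨u, y, rfl, hy, hvisit⟩⟩
    rintro ⟨u', y, hu, hy, hvisit⟩
    obtain rfl := hident hu
    exact ⟨y, hy, hvisit⟩
  refine ⟨fun w hw => treeOutput_eq_none fun hne k x hcand => hw ?_, ?_⟩
  · obtain ⟨y, -, hvisit⟩ := (hiff w k x).1 hcand
    exact ⟨fun hwu => hne (congrArg ident hwu.symm), k, y, hvisit⟩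
  · rintro w ⟨hwu, k, y, hvisit⟩
    obtain ⟨k, x, hcand, hmin, hout⟩ := exists_treeOutput_eq
      (fun heq => hwu (hident heq).symm) ⟨k, _, (hiff w k _).2 ⟨y, rfl, hvisit⟩⟩
    obtain ⟨y, rfl, hvisit⟩ := (hiff w k x).1 hcand
    refine ⟨k, y, ⟨hvisit, fun k' y' hvisit' =>
      hmin k' _ ((hiff w k' _).2 ⟨y', rfl, hvisit'⟩)⟩, fun hyu => ?_, fun hyu => ?_⟩
    · rw [finalOutput, hout, if_pos (congrArg ident hyu)]
    · rw [finalOutput, hout, if_neg fun heq => hyu (hident heq)]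

theorem exists_tree {Δ : ℕ} (hident : Function.Injective ident) (hN : ∀ v, ident v < N) {u : V}
    (hΔ : (G.neighborSet u).ncard ≤ Δ)
    (hE : IsExploration (neighborIdents G ident u) (SegmentLink 𝒞 d L u)
      (exploration (neighborIdents G ident u) (SegmentLink 𝒞 d L u)).1
      (exploration (neighborIdents G ident u) (SegmentLink 𝒞 d L u)).2) :
    ∃ T : G.Subgraph, (T.coe.IsTree ∧ G.neighborSet u ⊆ T.verts ∧ u ∉ T.verts ∧
        T.coe.diam ≤ d * Δ) ∧
      (∃ ρ ∈ T.verts, ∀ w, (∃ p, IsParent T ρ w p ∧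
          finalOutput A N d c L G ident ψ w (ident u) = some (ident p)) ∨
        ((w = ρ ∨ w ∉ T.verts) ∧ finalOutput A N d c L G ident ψ w (ident u) = none)) ∧
      ∀ e ∈ T.edgeSet, ∃ w k y, e = s(w, y) ∧ Visit 𝒞 d L (tokenNum 𝒞 d L u) u w k y := by
  obtain ⟨ρ, hplan⟩ := exists_isVisitPlan hident hE
  obtain ⟨T, htree, hverts, hdiam, hparent, hedges⟩ :=
    hplan.exists_tree (h.isVisitOutput_finalOutput hident hN u)
  refine ⟨T, ⟨htree, fun v hv => ?_, ?_, hdiam.trans ?_⟩, hparent, hedges⟩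
  · rw [hverts]
    exact mem_covered hident hE (mem_neighborIdents.2 ⟨v, hv, rfl⟩)
  · rw [hverts]
    exact fun hu => hu.1 rfl
  · rw [Nat.mul_comm d]
    exact Nat.mul_le_mul_right d
      ((exploration_fst_le_card _ _).trans ((card_neighborIdents_le G ident u).trans hΔ))

end IsPhaseCovers

theorem isPrivateTreesOutput_finalOutput {Δ : ℕ} (hG : TwoVertexConnected G)
    (hident : Function.Injective ident) (hN : ∀ v, ident v < N)
    (hΔ : ∀ v, (G.neighborSet v).ncard ≤ Δ)
    (hL : ∀ v, (neighborIdents G ident v).card < 2 ^ (L + 1))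
    (hall : ∀ t < L, PhaseSucceeds A N d c G ident ψ t) :
    IsPrivateTreesOutput G ident (d * Δ) (c * d * L) (finalOutput A N d c L G ident ψ) := by
  obtain ⟨𝒞, h𝒞⟩ := exists_isPhaseCovers hG hident hN hall
  choose T htree hparent hedges using fun u => h𝒞.exists_tree hident hN (hΔ u)
    (h𝒞.isExploration hG hident hN hall u (hL u))
  refine ⟨T, ⟨htree, fun e he => ?_⟩, hparent, fun w x hx => ?_⟩
  · exact (Set.ncard_le_ncard (fun u hu => hedges u e hu) (Set.toFinite _)).trans
      (ncard_visit_le (fun t ht => (h𝒞.isCoverInfo t ht).cover) he)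
  · refine treeOutput_eq_none fun _ k y hcand => ?_
    obtain ⟨u, -, hu, -⟩ := (h𝒞.isCandidate_iff hident hN w x k y).1 hcand
    exact hx u hu

end Correctness

/-! ### Failure probability -/

section Probability

open SplitVertex

variable {r M : ℕ} {A : Algorithm r M (ℕ → Finset ℕ)} {N d c L : ℕ} [NeZero N]
  {V : Type} [Fintype V] {G : SimpleGraph V} {ident : V → ℕ}

theorem records_congr {ψ ψ' : ℕ → V → Fin r → Fin N → A.Seed} {t : ℕ}
    (h : ∀ i < t, ψ i = ψ' i) :
    records A N d c G ident ψ t = records A N d c G ident ψ' t := by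
  induction t with
  | zero => rfl
  | succ t ih =>
    rw [records, records, ih fun i hi => h i (hi.trans t.lt_succ_self), h t t.lt_succ_self]

theorem repAt_congr {ψ ψ' : ℕ → V → Fin r → Fin N → A.Seed} {t : ℕ}
    (h : ∀ i < t, ψ i = ψ' i) :
    repAt A N d c G ident ψ t = repAt A N d c G ident ψ' t := by
  unfold repAt
  rw [records_congr h]

omit [Fintype V] in
theorem IsSplitting.seedIndex_injective {rep : V → ℕ → ℕ} (hs : IsSplitting G ident rep)
    (hN : ∀ v, ident v < N) (r : ℕ) : Function.Injective
      fun x : SplitVertex G ident rep × Fin r => (x.1.base, x.2, Fin.ofNat N x.1.name) := by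
  rintro ⟨q, i⟩ ⟨q', i'⟩ h
  simp only [Prod.mk.injEq] at h
  obtain ⟨hbase, hround, hname⟩ := h
  have hmod : q.name % N = q'.name % N := congrArg Fin.val hname
  rw [Nat.mod_eq_of_lt (hs.name_lt hN q), Nat.mod_eq_of_lt (hs.name_lt hN q')] at hmod
  rw [ext' hbase hmod, hround]

omit [Fintype V] in
theorem IsSplitting.card_not_splitSucceeds_div_card [Finite V] {rep : V → ℕ → ℕ}
    [Fintype (SplitVertex G ident rep)] (hs : IsSplitting G ident rep) (hN : ∀ v, ident v < N) :
    (Nat.card {ψ : V → Fin r → Fin N → A.Seed // ¬ SplitSucceeds A N d c G ident rep ψ} : ℝ) /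
        Nat.card (V → Fin r → Fin N → A.Seed) =
      A.failureProb (splitGraph G ident rep) (splitIdent N G ident rep)
        (IsCycleCoverOutput (splitGraph G ident rep) (splitIdent N G ident rep) d c) := by
  have := A.seedFinite
  have := A.seedNonempty
  let curry : (V × Fin r × Fin N → A.Seed) ≃ (V → Fin r → Fin N → A.Seed) :=
    (Equiv.curry _ _ _).trans (Equiv.arrowCongr (Equiv.refl V) (Equiv.curry _ _ _))
  let splitCurry := Equiv.curry (SplitVertex G ident rep) (Fin r) A.Seed
  let Fails (ω : SplitVertex G ident rep → Fin r → A.Seed) : Prop :=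
    ¬ IsCycleCoverOutput (splitGraph G ident rep) (splitIdent N G ident rep) d c
      (A.result (splitGraph G ident rep) (splitIdent N G ident rep) ω)
  have hsplit (f : V × Fin r × Fin N → A.Seed) :
      Fails (splitCurry (f ∘ fun x => (x.1.base, x.2, Fin.ofNat N x.1.name))) ↔
        ¬ SplitSucceeds A N d c G ident rep (curry f) := by
    refine not_congr ⟨fun h inst => ?_, fun h => h _⟩
    rwa [Subsingleton.elim inst]
  rw [Algorithm.failureProb, ← Nat.card_congr curry,
    ← Nat.card_congr (Equiv.subtypeEquiv curry hsplit),
    card_comp_injective_div_card (hs.seedIndex_injective hN r) fun g => Fails (splitCurry g),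
    ← Nat.card_congr splitCurry, ← Nat.card_congr (Equiv.subtypeEquiv splitCurry fun _ => Iff.rfl)]

theorem ConstructsCycleCovers.card_not_splitSucceeds_le {n D Δ κ : ℕ} {δ : ℝ} [NeZero (n ^ κ)]
    (hA : ConstructsCycleCovers A (n ^ 2) (3 * D + 2) Δ κ d c δ)
    (hG : IsNetwork n D Δ κ G ident) {rep : V → ℕ → ℕ} (hs : IsSplitting G ident rep) :
    (Nat.card {ψ : V → Fin r → Fin (n ^ κ) → A.Seed //
        ¬ SplitSucceeds A (n ^ κ) d c G ident rep ψ} : ℝ) ≤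
      δ * Nat.card (V → Fin r → Fin (n ^ κ) → A.Seed) := by
  have := A.seedFinite
  have := A.seedNonempty
  have := hs.finite
  have := Fintype.ofFinite (SplitVertex G ident rep)
  obtain ⟨-, -, -, -, -, hN⟩ := id hG
  rw [← div_le_iff₀ (by exact_mod_cast Nat.card_pos), hs.card_not_splitSucceeds_div_card hN]
  exact hA _ _ _ (hs.isNetwork hG)

/-- The seeds of the phases, from the seeds of the nodes. There are only `L` phases; the seeds of
the later ones are arbitrary. -/
noncomputable def phaseSeeds (A : Algorithm r M (ℕ → Finset ℕ)) (N L : ℕ)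
    (φ : V → Fin L → Fin r → Fin N → A.Seed) (t : ℕ) (v : V) : Fin r → Fin N → A.Seed :=
  have := A.seedNonempty
  if h : t < L then φ v ⟨t, h⟩ else Classical.arbitrary _

omit [NeZero N] [Fintype V] in
theorem phaseSeeds_update_self (φ : Fin L → V → Fin r → Fin N → A.Seed) (t : Fin L)
    (z : V → Fin r → Fin N → A.Seed) :
    phaseSeeds A N L (Function.swap (Function.update φ t z)) t = z := by
  funext v
  simp [phaseSeeds, Function.swap]

omit [NeZero N] [Fintype V] in
theorem phaseSeeds_update_of_lt (φ : Fin L → V → Fin r → Fin N → A.Seed) (t : Fin L)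
    (z : V → Fin r → Fin N → A.Seed) {i : ℕ} (hi : i < t) :
    phaseSeeds A N L (Function.swap (Function.update φ t z)) i =
      phaseSeeds A N L (Function.swap φ) i := by
  funext v
  have hne : (⟨i, hi.trans t.2⟩ : Fin L) ≠ t := Fin.ne_of_lt hi
  simp [phaseSeeds, Function.swap, Function.update_of_ne hne, hi.trans t.2]

/-- The classes in a phase depend only on the seeds of the earlier phases, so the bound for a fixed
splitting applies to each phase. -/
theorem card_not_phaseSucceeds_le {δ : ℝ} (hG : TwoVertexConnected G)
    (hident : Function.Injective ident)
    (hsplit : ∀ rep, IsSplitting G ident rep →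
      (Nat.card {ψ : V → Fin r → Fin N → A.Seed // ¬ SplitSucceeds A N d c G ident rep ψ} : ℝ) ≤
        δ * Nat.card (V → Fin r → Fin N → A.Seed)) (t : Fin L) :
    (Nat.card {φ : V → Fin L → Fin r → Fin N → A.Seed //
        ¬ PhaseSucceeds A N d c G ident (phaseSeeds A N L φ) t} : ℝ) ≤
      δ * Nat.card (V → Fin L → Fin r → Fin N → A.Seed) := by
  have := A.seedFinite
  have := A.seedNonempty
  let swap : (Fin L → V → Fin r → Fin N → A.Seed) ≃ (V → Fin L → Fin r → Fin N → A.Seed) :=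
    Equiv.piComm _
  rw [← Nat.card_congr swap, ← Nat.card_congr (Equiv.subtypeEquiv swap fun _ => Iff.rfl)]
  refine card_subtype_le_of_forall_update t _ δ fun φ => ?_
  have hphase (z : V → Fin r → Fin N → A.Seed) :
      PhaseSucceeds A N d c G ident (phaseSeeds A N L (swap (Function.update φ t z))) t ↔
        SplitSucceeds A N d c G ident
          (repAt A N d c G ident (phaseSeeds A N L (swap φ)) t) z := by
    have hrep : repAt A N d c G ident (phaseSeeds A N L (swap (Function.update φ t z))) t =
        repAt A N d c G ident (phaseSeeds A N L (swap φ)) t :=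
      repAt_congr fun i hi => phaseSeeds_update_of_lt φ t z hi
    rw [PhaseSucceeds, hrep]
    exact iff_of_eq (congrArg _ (phaseSeeds_update_self φ t z))
  simpa only [hphase] using hsplit _ (isSplitting_repAt hG hident t)

theorem card_not_isPrivateTreesOutput_finalOutput_le {n D Δ κ : ℕ} {δ : ℝ} [NeZero (n ^ κ)]
    (hA : ConstructsCycleCovers A (n ^ 2) (3 * D + 2) Δ κ d c δ)
    (hG : IsNetwork n D Δ κ G ident)
    (hL : ∀ v, (neighborIdents G ident v).card < 2 ^ (L + 1)) :
    (Nat.card {φ : V → Fin L → Fin r → Fin (n ^ κ) → A.Seed //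
        ¬ IsPrivateTreesOutput G ident (d * Δ) (c * d * L)
          (finalOutput A (n ^ κ) d c L G ident (phaseSeeds A (n ^ κ) L φ))} : ℝ) ≤
      L * δ * Nat.card (V → Fin L → Fin r → Fin (n ^ κ) → A.Seed) := by
  have := A.seedFinite
  obtain ⟨hconn, -, -, hΔ, hident, hN⟩ := id hG
  have hunion := card_not_le_sum_card_not
    (Q := fun (t : Fin L) (φ : V → Fin L → Fin r → Fin (n ^ κ) → A.Seed) =>
      PhaseSucceeds A (n ^ κ) d c G ident (phaseSeeds A (n ^ κ) L φ) t)
    fun φ h => isPrivateTreesOutput_finalOutput hconn hident hN hΔ hL fun t ht => h ⟨t, ht⟩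
  refine (Nat.cast_le.2 hunion).trans ?_
  rw [Nat.cast_sum, mul_assoc]
  refine (Finset.sum_le_sum fun t _ => card_not_phaseSucceeds_le hconn hident
    (fun rep hs => hA.card_not_splitSucceeds_le hG hs) t).trans (le_of_eq ?_)
  rw [Finset.sum_const, Finset.card_univ, Fintype.card_fin, nsmul_eq_mul]

end Probability

/-! ### Running time -/

section RunningTime

variable {r M' : ℕ} (A : Algorithm r M' (ℕ → Finset ℕ)) (N d c L : ℕ) [NeZero N]
  {M qN qA qT : ℕ}

/-- The initial knowledge of the nodes together with the records of the first `t` phases. -/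
noncomputable def phaseValue (t : ℕ) : LocalValue (Fin L → Fin r → Fin N → A.Seed)
    ((ℕ × Finset ℕ × (Fin L → Fin r → Fin N → A.Seed)) × (ℕ → PhaseRecord N)) :=
  fun _ _ G ident φ v => ((ident v, neighborIdents G ident v, φ v),
    records A N d c G ident (phaseSeeds A N L φ) t v)

/-- The knowledge of the nodes together with the tokens received in the first `t` phases of the
construction of the trees. -/
noncomputable def treeValue (t : ℕ) : LocalValue (Fin L → Fin r → Fin N → A.Seed)
    (((ℕ × Finset ℕ × (Fin L → Fin r → Fin N → A.Seed)) × (ℕ → PhaseRecord N)) ×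
      (ℕ → ℕ → ℕ → ℕ → ℕ → Option (Token N))) :=
  fun V _ G ident φ v => (phaseValue A N d c L L V G ident φ v,
    fun i => if i < t then treeHistory N d c L G ident
      (records A N d c G ident (phaseSeeds A N L φ) L) v i else fun _ _ _ _ => none)

variable {A N d c L}

theorem computableIn_phaseValue (hN : Transmissible M qN (Fin N))
    (hA : Transmissible M qA (Fin M')) (hT : Transmissible M qT (Fin c → Option (Token N)))
    (t : ℕ) : ComputableIn M (t * (qN + r * qA + d * qT)) (phaseValue A N d c L t) := by
  classical
  have := A.seedNonempty
  induction t with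
  | zero =>
    rw [Nat.zero_mul]
    exact ComputableIn.init.map fun x => (x, fun _ => default)
  | succ t ih =>
    have hinfo := (ih.exchange hN (fun x y =>
      some (Fin.ofNat N (classRep x.1.2.1 (Linked N d x.2 t) y)))).map (fun x =>
        (x.1, (⟨x.1.1.1, x.1.1.2.1, classRep x.1.1.2.1 (Linked N d x.1.2 t),
          fun y => (x.2 y).elim 0 Fin.val⟩ : ClusterInfo)))
    have hcover := (hinfo.iterate hA (fun x => (x.2, if h : t < L then x.1.1.2.2 ⟨t, h⟩ else
      Classical.arbitrary _)) (simInit A N) (fun _ => simMsg A N) (simUpd A N) r).map (fun x =>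
        (x.1.1, x.1.2, fun a => A.output (x.2 a).1))
    have hlinks := (hcover.iterate hT
      (fun x => (⟨x.2.1, x.2.2, linkEmit N x.2.1⟩ : TokenEnv N))
      tokenInit (fun _ => tokenMsg c) (tokenUpd c) d).map (fun x =>
        (x.1.1.1, Function.update x.1.1.2 t (⟨x.1.2.1, x.1.2.2, x.2.2⟩ : PhaseRecord N)))
    rw [Nat.succ_mul, ← Nat.add_assoc, ← Nat.add_assoc]
    exact hlinks.congr fun _ _ _ _ _ _ => rfl

theorem computableIn_treeValue {T : ℕ} (h : ComputableIn M T (phaseValue A N d c L L))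
    (hT : Transmissible M qT (Fin c → Option (Token N))) (t : ℕ) :
    ComputableIn M (T + t * (d * qT)) (treeValue A N d c L t) := by
  induction t with
  | zero =>
    rw [Nat.zero_mul]
    refine (h.map fun x => (x, fun (_ _ _ _ _ : ℕ) => (none : Option (Token N)))).congr ?_
    intro V _ G ident φ v
    simp [treeValue]
  | succ t ih =>
    have hnext := (ih.iterate hT (fun x => (⟨(x.1.2 t).info, (x.1.2 t).labels,
      treeEmit N d L x.1.1.1 x.1.1.2.1 x.1.2 t⟩ : TokenEnv N))
      tokenInit (fun _ => tokenMsg c) (tokenUpd c) d).map (fun x =>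
        (x.1.1, fun i => if i = t then x.2.2 else x.1.2 i))
    rw [Nat.succ_mul, ← Nat.add_assoc]
    refine hnext.congr fun V _ G ident φ v => Prod.ext rfl ?_
    funext i
    rcases lt_trichotomy i t with hi | rfl | hi
    · simp only [treeValue, if_pos hi, if_neg hi.ne, if_pos (hi.trans t.lt_succ_self)]
    · simp only [treeValue, if_true, Nat.lt_succ_self]
      rfl
    · simp only [treeValue, if_neg (Nat.not_lt.2 (Nat.succ_le_of_lt hi)), if_neg hi.not_gt,
        if_neg hi.ne']

theorem computableIn_finalOutput (hN : Transmissible M qN (Fin N))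
    (hA : Transmissible M qA (Fin M')) (hT : Transmissible M qT (Fin c → Option (Token N))) :
    ComputableIn M (L * (qN + r * qA + d * qT) + L * (d * qT))
      (fun _ _ G ident φ v => finalOutput A N d c L G ident (phaseSeeds A N L φ) v :
        LocalValue (Fin L → Fin r → Fin N → A.Seed) (ℕ → Option ℕ)) := by
  refine ((computableIn_treeValue (computableIn_phaseValue hN hA hT L) hT L).map
    fun x => treeOutput N d L x.1.1.1 x.2).congr fun V _ G ident φ v => ?_
  refine treeOutput_congr fun t ht => ?_
  simp [treeValue, ht]

theorem pow_add_one_le_add_one_pow {n κ β : ℕ} (hκ : 1 ≤ κ) (hβ : 1 ≤ β) :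
    n ^ κ + 1 ≤ (n ^ β + 1) ^ κ :=
  Nat.pow_lt_pow_left (Nat.lt_succ_of_le (Nat.le_self_pow (by omega) n)) (by omega)

omit [NeZero N] in
theorem transmissible_fin {q : ℕ} (h : N + 1 ≤ (M + 1) ^ q) : Transmissible M q (Fin N) :=
  transmissible_of_card_le (by rwa [Nat.card_fin])

theorem transmissible_letter {n β : ℕ} : Transmissible (n ^ β) 2 (Fin ((n ^ 2) ^ β)) := by
  refine transmissible_fin ?_
  rw [pow_right_comm]
  exact Nat.pow_lt_pow_left (by omega) two_ne_zero

omit [NeZero N] in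
theorem transmissible_token {q : ℕ} (hN : N + 1 ≤ (M + 1) ^ q) (hM : 1 ≤ M) (c : ℕ) :
    Transmissible M (2 * q * c + 1) (Fin c → Option (Token N)) := by
  refine transmissible_of_card_le ?_
  calc Nat.card (Fin c → Option (Token N)) + 1
      = (N * N + 1) ^ c + 1 := by simp [Nat.card_eq_fintype_card]
    _ ≤ ((M + 1) ^ (2 * q)) ^ c + 1 := by
        gcongr
        calc N * N + 1 ≤ (N + 1) ^ 2 := by nlinarith
          _ ≤ ((M + 1) ^ q) ^ 2 := Nat.pow_le_pow_left hN 2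
          _ = (M + 1) ^ (2 * q) := by rw [← pow_mul, Nat.mul_comm]
    _ ≤ (M + 1) ^ (2 * q * c + 1) := by
        rw [← pow_mul, pow_succ]
        have hpos : 1 ≤ (M + 1) ^ (2 * q * c) := Nat.one_le_pow _ _ M.succ_pos
        nlinarith

theorem rounds_le {κ d c r L l : ℕ} (hL : L ≤ l) (hdc : 1 ≤ d * c) :
    L * (κ + r * 2 + d * (2 * κ * c + 1)) + L * (d * (2 * κ * c + 1)) + 1 ≤
      (5 * κ + 5) * (l + 1) * (r + d * c) := by
  have hd : d ≤ d * c := Nat.le_mul_of_pos_right d (Nat.pos_of_mul_pos_left hdc)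
  have hphase : κ + r * 2 + d * (2 * κ * c + 1) + d * (2 * κ * c + 1) ≤
      (5 * κ + 4) * (r + d * c) := by
    nlinarith [Nat.le_mul_of_pos_right κ hdc, Nat.zero_le (κ * r)]
  calc L * (κ + r * 2 + d * (2 * κ * c + 1)) + L * (d * (2 * κ * c + 1)) + 1
      = L * (κ + r * 2 + d * (2 * κ * c + 1) + d * (2 * κ * c + 1)) + 1 := by ring
    _ ≤ l * ((5 * κ + 4) * (r + d * c)) + (r + d * c) :=
        Nat.add_le_add (Nat.mul_le_mul hL hphase) (by omega)
    _ ≤ (5 * κ + 5) * (l + 1) * (r + d * c) := by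
        nlinarith [Nat.zero_le (κ * (r + d * c)), Nat.zero_le (l * (r + d * c))]

end RunningTime

/-! ### Existence of the algorithm -/

section FailureProbability

namespace Algorithm

variable {r M : ℕ} {Out : Type} (A : Algorithm r M Out) {V : Type} [Fintype V]
  (G : SimpleGraph V) (ident : V → ℕ)

theorem failureProb_nonneg (P : (V → Out) → Prop) : 0 ≤ A.failureProb G ident P :=
  div_nonneg (Nat.cast_nonneg _) (Nat.cast_nonneg _)

theorem failureProb_le_one (P : (V → Out) → Prop) : A.failureProb G ident P ≤ 1 := by
  have := A.seedFinite
  refine div_le_one_of_le₀ ?_ (Nat.cast_nonneg _)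
  exact_mod_cast Nat.card_le_card_of_injective _ Subtype.val_injective

theorem failureProb_mono {P Q : (V → Out) → Prop} (h : ∀ out, P out → Q out) :
    A.failureProb G ident Q ≤ A.failureProb G ident P := by
  have := A.seedFinite
  refine div_le_div_of_nonneg_right ?_ (Nat.cast_nonneg _)
  exact_mod_cast Nat.card_le_card_of_injective _ (Subtype.impEmbedding
    (fun ω => ¬ Q (A.result G ident ω)) _ fun _ => mt (h _)).injective

theorem failureProb_eq_one {P : (V → Out) → Prop} (hP : ∀ out, ¬ P out) :
    A.failureProb G ident P = 1 := by
  have := A.seedFinite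
  have := A.seedNonempty
  have hcard : Nat.card {ω : V → Fin r → A.Seed // ¬ P (A.result G ident ω)} =
      Nat.card (V → Fin r → A.Seed) :=
    Nat.card_congr (Equiv.subtypeUnivEquiv fun ω => hP _)
  rw [failureProb, hcard]
  exact div_self (by exact_mod_cast Nat.card_pos.ne')

end Algorithm

theorem IsPrivateTreesOutput.mono {V : Type} {G : SimpleGraph V} {ident : V → ℕ} {d c c' : ℕ}
    {out : V → ℕ → Option ℕ} (h : IsPrivateTreesOutput G ident d c out) (hc : c ≤ c') :
    IsPrivateTreesOutput G ident d c' out := by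
  obtain ⟨T, ⟨htree, hcong⟩, hout⟩ := h
  exact ⟨T, ⟨htree, fun e he => (hcong e he).trans hc⟩, hout⟩

end FailureProbability

section Networks

variable {n D Δ κ d c : ℕ} {δ : ℝ} {V : Type} [Fintype V] {G : SimpleGraph V} {ident : V → ℕ}

namespace IsNetwork

variable (h : IsNetwork n D Δ κ G ident)
include h

theorem mono {n' D' : ℕ} (hn : n ≤ n') (hD : D ≤ D') : IsNetwork n' D' Δ κ G ident := by
  obtain ⟨hconn, hcard, hdiam, hdeg, hident, hN⟩ := h
  exact ⟨hconn, hcard.trans hn, hdiam.trans hD, hdeg, hident, fun v =>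
    (hN v).trans_le (Nat.pow_le_pow_left hn κ)⟩

theorem three_le : 3 ≤ n := h.1.1.trans h.2.1

theorem card_neighborIdents_le (v : V) : (neighborIdents G ident v).card ≤ min Δ n := by
  obtain ⟨-, hcard, -, hdeg, -, -⟩ := h
  classical
  exact le_min ((PrivateTrees.card_neighborIdents_le G ident v).trans (hdeg v))
    ((Finset.card_image_le.trans (Finset.card_le_univ _)).trans hcard)

theorem exists_two_le_card_neighborIdents : ∃ u, 2 ≤ (neighborIdents G ident u).card := by
  obtain ⟨hconn, -, -, -, hident, -⟩ := h
  obtain ⟨u⟩ : Nonempty V := Fintype.card_pos_iff.1 (three_pos.trans_le hconn.1)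
  exact ⟨u, hconn.two_le_card hident u⟩

theorem one_le_log : 1 ≤ Nat.log 2 Δ := by
  obtain ⟨u, hu⟩ := h.exists_two_le_card_neighborIdents
  exact Nat.log_pos one_lt_two
    (hu.trans ((h.card_neighborIdents_le u).trans (min_le_left _ _)))

theorem one_le_mul_of_isCycleCoverOutput {out : V → ℕ → Finset ℕ}
    (hout : IsCycleCoverOutput G ident d c out) : 1 ≤ d * c := by
  obtain ⟨I, C, hC, -⟩ := hout
  obtain ⟨u, hu⟩ := h.exists_two_le_card_neighborIdents
  obtain ⟨x, hx⟩ := Finset.card_pos.1 (two_pos.trans_le hu)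
  obtain ⟨v, huv, -⟩ := mem_neighborIdents.1 hx
  obtain ⟨i, hi, -⟩ := hC.exists_mem_of_mem_edgeSet (e := s(u, v)) huv
  obtain ⟨w, p, hp, hlength, -⟩ := hC.1 i hi
  obtain ⟨hone, hc⟩ := hC.2 s(u, v) huv
  exact Nat.mul_pos (three_pos.trans_le (hp.three_le_length.trans hlength)) (hone.trans hc)

end IsNetwork

namespace ConstructsCycleCovers

variable {r M : ℕ} {A : Algorithm r M (ℕ → Finset ℕ)}
  (hA : ConstructsCycleCovers A (n ^ 2) (3 * D + 2) Δ κ d c δ) (hG : IsNetwork n D Δ κ G ident)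
include hA hG

theorem failureProb_le_of_isNetwork :
    A.failureProb G ident (IsCycleCoverOutput G ident d c) ≤ δ :=
  hA V G ident (hG.mono (Nat.le_self_pow two_ne_zero n) (by omega))

theorem nonneg : 0 ≤ δ :=
  (A.failureProb_nonneg G ident _).trans (hA.failureProb_le_of_isNetwork hG)

theorem one_le_of_mul_eq_zero (hdc : d * c = 0) : 1 ≤ δ := by
  rw [← A.failureProb_eq_one G ident fun out hout =>
    Nat.one_le_iff_ne_zero.1 (hG.one_le_mul_of_isCycleCoverOutput hout) hdc]
  exact hA.failureProb_le_of_isNetwork hG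

end ConstructsCycleCovers

end Networks

section Existence

variable {n D Δ κ β d c r : ℕ} {δ : ℝ}

theorem ConstructsPrivateTrees.mono {M c' : ℕ} {δ' : ℝ} {B : Algorithm r M (ℕ → Option ℕ)}
    (hB : ConstructsPrivateTrees B n D Δ κ d c δ) (hc : c ≤ c')
    (hδ : ∀ (V : Type) [Fintype V] (G : SimpleGraph V) (ident : V → ℕ),
      IsNetwork n D Δ κ G ident → δ ≤ δ') : ConstructsPrivateTrees B n D Δ κ d c' δ' :=
  fun V _ G ident hG =>
    ((B.failureProb_mono G ident fun _ hout => IsPrivateTreesOutput.mono hout hc).trans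
      (hB V G ident hG)).trans (hδ V G ident hG)

theorem exists_constructsPrivateTrees_of_one_le {M : ℕ} (κ : ℕ)
    (hδ : ∀ (V : Type) [Fintype V] (G : SimpleGraph V) (ident : V → ℕ),
      IsNetwork n D Δ κ G ident → 1 ≤ δ) (d c : ℕ) :
    ∃ B : Algorithm 0 M (ℕ → Option ℕ), ConstructsPrivateTrees B n D Δ κ d c δ :=
  ⟨⟨Unit, Unit, inferInstance, inferInstance, fun _ _ => (),
    fun _ _ _ _ => ((), fun _ => none), fun _ _ => none⟩, fun V _ G ident hG =>
      (Algorithm.failureProb_le_one _ G ident _).trans (hδ V G ident hG)⟩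

theorem ConstructsCycleCovers.exists_constructsPrivateTrees (hκ : 1 ≤ κ) (hβ : 1 ≤ β) (hn : 1 ≤ n)
    {A : Algorithm r ((n ^ 2) ^ β) (ℕ → Finset ℕ)}
    (hA : ConstructsCycleCovers A (n ^ 2) (3 * D + 2) Δ κ d c δ) :
    let L := Nat.log 2 (min Δ n)
    ∃ B : Algorithm (L * (κ + r * 2 + d * (2 * κ * c + 1)) + L * (d * (2 * κ * c + 1)) + 1)
      (n ^ β) (ℕ → Option ℕ),
      ConstructsPrivateTrees B n D Δ κ (d * Δ) (c * d * L) (L * δ) := by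
  intro L
  have : NeZero (n ^ κ) := ⟨(Nat.pow_pos hn).ne'⟩
  have := A.seedFinite
  have := A.seedNonempty
  have hpow : n ^ κ + 1 ≤ (n ^ β + 1) ^ κ := pow_add_one_le_add_one_pow hκ hβ
  obtain ⟨B, hB⟩ := (computableIn_finalOutput (A := A) (d := d) (L := L) (transmissible_fin hpow)
    transmissible_letter (transmissible_token hpow (Nat.one_le_pow _ _ hn) c)).exists_algorithm
  refine ⟨B, fun V _ G ident hG => ?_⟩
  rw [hB, div_le_iff₀ (by exact_mod_cast Nat.card_pos)]
  exact card_not_isPrivateTreesOutput_finalOutput_le hA hG fun v =>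
    (hG.card_neighborIdents_le v).trans_lt (Nat.lt_pow_succ_log_self one_lt_two _)

end Existence

end PrivateTrees

/-- Messages on networks with size parameter `N` have `β log N` bits (alphabet of size `N ^ β`) and
identifiers have `κ log N` bits. The given algorithm is run on networks with parameters `n ^ 2`,
`3 * D + 2`, `Δ`, the constructed one on networks with parameters `n`, `D`, `Δ`. -/
theorem mainTheorem4 (κ β : ℕ) (hκ : 1 ≤ κ) (hβ : 1 ≤ β) :
    ∃ K k : ℕ, ∀ (n D Δ d c r : ℕ) (δ : ℝ)
      (A : PrivateTrees.Algorithm r ((n ^ 2) ^ β) (ℕ → Finset ℕ)),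
      PrivateTrees.ConstructsCycleCovers A (n ^ 2) (3 * D + 2) Δ κ d c δ →
      ∃ r' : ℕ, r' ≤ K * (Nat.log 2 n + 1) ^ k * (r + d * c) ∧
        ∃ B : PrivateTrees.Algorithm r' (n ^ β) (ℕ → Option ℕ),
          PrivateTrees.ConstructsPrivateTrees B n D Δ κ (d * Δ) (c * d * Nat.log 2 Δ)
            (Nat.log 2 Δ * δ) := by
  refine ⟨5 * κ + 5, 1, fun n D Δ d c r δ A hA => ?_⟩
  by_cases hdeg : 1 ≤ n ∧ 1 ≤ d * c
  · obtain ⟨hn, hdc⟩ := hdeg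
    have hlog : Nat.log 2 (min Δ n) ≤ Nat.log 2 Δ := Nat.log_mono_right (min_le_left _ _)
    obtain ⟨B, hB⟩ := hA.exists_constructsPrivateTrees hκ hβ hn
    refine ⟨_, ?_, B, hB.mono (Nat.mul_le_mul_left _ hlog) fun V _ G ident hG => ?_⟩
    · rw [pow_one]
      exact PrivateTrees.rounds_le (Nat.log_mono_right (min_le_right _ _)) hdc
    · exact mul_le_mul_of_nonneg_right (Nat.cast_le.2 hlog) (hA.nonneg hG)
  -- Without cycles of positive length, the given algorithm fails with probability one on every
  -- network, so that failing always is allowed.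
  · refine ⟨0, Nat.zero_le _, PrivateTrees.exists_constructsPrivateTrees_of_one_le κ
      (fun V _ G ident hG => ?_) _ _⟩
    have hdc : d * c = 0 := by have := hG.three_le; grind
    exact one_le_mul_of_one_le_of_one_le (Nat.one_le_cast.2 hG.one_le_log)
      (hA.one_le_of_mul_eq_zero hG hdc)
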